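/- Let $\Omega\subset\mathbb R^2$ be an open set of states $U=(u,v)$ and let $M=M(u,v)$ be a $2\times2$ matrix of class $C^2$ on $\Omega$ with two different real eigenvalues $\lambda_1\neq\lambda_2$ at each state (strict hyperbolicity). Let $r_1=\Phi_1(u,v)$, $r_2=\Phi_2(u,v)$ be Riemann invariants of class $C^2$ (the differential $d\Phi_k$ is a non-zero left eigenvector of $M$ for $\lambda_k$) that are coordinates on $\Omega$ with values filling a product $J_1\times J_2$ of open intervals; the $\lambda_k$ are then also functions of $(r_1,r_2)\in J_1\times J_2$. Consider the Cauchy problem $$\frac{\partial U}{\partial x}+M(U)\frac{\partial U}{\partial y}=0,\qquad U(\gamma(\tau))=U^0(\tau),$$ where $\gamma(\tau)=(x(\tau),y(\tau))$ and $U^0(\tau)\in\Omega$ are of class $C^1$ on an open interval $I\supset[a,b]$, $a<b$, the curve is nowhere characteristic ($y'\neq\lambda_k(U^0)\,x'$ for $k=1,2$), and $\gamma$ is injective on $[a,b]$. Write $r_k(\tau)=\Phi_k(U^0(\tau))$ and $\Lambda=\operatorname{diag}(\lambda_1,\lambda_2)$. For $(r_1^0,r_2^0)\in J_1\times J_2$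 consider the linear system for $C^1$ functions $\varphi,\psi$ on $J_1\times J_2$ $$\Lambda\nabla_R\varphi=\nabla_R\psi,\qquad \nabla_R=(\partial/\partial r_1,\partial/\partial r_2)^T,\qquad(1)$$ with one of the two pairs of conditions $$(\psi-\lambda_1\varphi)|_{r_1=r_1^0}=1,\qquad(\psi-\lambda_2\varphi)|_{r_2=r_2^0}=0,\qquad(2)$$ $$(\psi-\lambda_1\varphi)|_{r_1=r_1^0}=\lambda_1|_{r_1=r_1^0},\qquad(\psi-\lambda_2\varphi)|_{r_2=r_2^0}=0\qquad(3)$$ (where $\lambda_1,\lambda_2\ne0$, condition (3) reads $(\psi/\lambda_1-\varphi)|_{r_1=r_1^0}=1$, $(\psi/\lambda_2-\varphi)|_{r_2=r_2^0}=0$). Then solving the Cauchy problem is equivalent to solving the linear problems (1),(2) and (1),(3), in the following sense, without any assumption on the Jacobian $\partial(r_1,r_2)/\partial(x,y)$. (i) For each $(r_1^0,r_2^0)\in J_1\times J_2$, each of the problems (1),(2) and (1),(3) has exactly one solution on $J_1\times J_2$. (ii) Let $U$ be a $C^1$ solution of the system, with values in $\Omega$, in a simply connected open set $G$. Let $s,t\in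 I$ be such that the part $PQ$ of the curve between $P=\gamma(s)$ and $Q=\gamma(t)$ lies in $G$ and $U=U^0$ on it. Let a characteristic $dy=\lambda_1(U)\,dx$ starting at $Q$ and a characteristic $dy=\lambda_2(U)\,dx$ starting at $P$, both in $G$, meet at a point $M=(M_x,M_y)$. Then $r_1(M)=r_1^0:=r_1(t)$, $r_2(M)=r_2^0:=r_2(s)$, and $$M_x=x(t)-\int_s^t\Big(\psi\frac{dx}{d\tau}-\varphi\frac{dy}{d\tau}\Big)d\tau,\qquad M_y=y(t)-\int_s^t\Big(\psi\frac{dx}{d\tau}-\varphi\frac{dy}{d\tau}\Big)d\tau,\qquad(4)$$ where $\varphi,\psi$ are taken at $(r_1(\tau),r_2(\tau))$ and solve (1),(2) in the first formula and (1),(3) in the second. (iii) For $s,t\in I$ let $H(s,t)$ be the point with coordinates (4), computed from the solutions of the linear problems with $(r_1^0,r_2^0)=(r_1(t),r_2(s))$. Let $V\subset I\times I$ be an open set that contains with each $(s,t)$ all pairs of parameters between $s$ and $t$, and suppose that $H$ is a $C^1$ diffeomorphism of $V$ onto an open set $G$. Then a function $U$ on $G$ is a $C^1$ solution of the system in $G$,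 with values in $\Omega$, and with $U(\gamma(\tau))=U^0(\tau)$ whenever $(\tau,\tau)\in V$, if and only if, for all $(s,t)\in V$, $U(H(s,t))$ is the state in $\Omega$ with Riemann invariants $r_1=r_1(t)$, $r_2=r_2(s)$. (iv) Each neighbourhood of the arc $\gamma([a,b])$ contains a set $G=H(V)$ as in (iii) with $(\tau,\tau)\in V$ for all $\tau\in[a,b]$. -/

import Mathlib

namespace QuasiHyp

/-- The plane: points `(x, y)`, and also pairs `(r₁, r₂)` of Riemann invariants and pairs `(s, t)` of
parameters on the initial curve. -/
abbrev Plane := ℝ × ℝ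

/-- The space of states `U = (u, v)`. -/
abbrev State := Fin 2 → ℝ

/-- Strict hyperbolicity on `Ω`: at each state the matrix `A` has the two different real
eigenvalues `lam 0`, `lam 1` (the numbering of the eigenvalues is free). -/
def StrictlyHyperbolic (A : State → Matrix (Fin 2) (Fin 2) ℝ) (lam : Fin 2 → State → ℝ)
    (Ω : Set State) : Prop :=
  ∀ u ∈ Ω, lam 0 u ≠ lam 1 u ∧ ∀ k, (A u - lam k u • (1 : Matrix (Fin 2) (Fin 2) ℝ)).det = 0

/-- The pair `(r₁, r₂) = (Φ₁(u, v), Φ₂(u, v))`. -/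
def riem (Φ : Fin 2 → State → ℝ) (u : State) : Plane := (Φ 0 u, Φ 1 u)

/-- `Φ 0, Φ 1` are Riemann invariants on `Ω`: the differential of `Φ k` is a left eigenvector
(so it does not vanish) of `A` for the eigenvalue `lam k`, and `(Φ 0, Φ 1)` are coordinates on `Ω`
with values filling the box `J 0 × J 1`. -/
structure IsRiemannInvariants (A : State → Matrix (Fin 2) (Fin 2) ℝ) (lam : Fin 2 → State → ℝ)
    (Ω : Set State) (Φ : Fin 2 → State → ℝ) (J : Fin 2 → Set ℝ) : Prop where
  smooth : ∀ k, ContDiffOn ℝ 2 (Φ k) Ω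
  ne_zero : ∀ k, ∀ u ∈ Ω, fderiv ℝ (Φ k) u ≠ 0
  left_eigenvector : ∀ k, ∀ u ∈ Ω, ∀ w : State,
    fderiv ℝ (Φ k) u ((A u).mulVec w) = lam k u * fderiv ℝ (Φ k) u w
  bijOn : Set.BijOn (riem Φ) Ω (J 0 ×ˢ J 1)

/-- `U` is a classical solution with values in `Ω` of `∂U/∂x + A(U) ∂U/∂y = 0` in the open set `G`. -/
structure IsSolution (A : State → Matrix (Fin 2) (Fin 2) ℝ) (Ω : Set State)
    (G : Set Plane) (U : Plane → State) : Prop where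
  smooth : ContDiffOn ℝ 1 U G
  mapsTo : Set.MapsTo U G Ω
  pde : ∀ p ∈ G, fderiv ℝ U p (1, 0) + (A (U p)).mulVec (fderiv ℝ U p (0, 1)) = 0

/-- The initial curve `γ = (x(τ), y(τ))`, `τ ∈ I`, with the data `U₀` on it: both are of class `C¹`,
the data have values in `Ω`, and the curve is nowhere characteristic. -/
structure IsCauchyData (lam : Fin 2 → State → ℝ) (Ω : Set State) (I : Set ℝ)
    (γ : ℝ → Plane) (U₀ : ℝ → State) : Prop where
  curve_smooth : ContDiffOn ℝ 1 γ I
  data_smooth : ContDiffOn ℝ 1 U₀ I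
  data_mapsTo : Set.MapsTo U₀ I Ω
  noncharacteristic : ∀ k, ∀ τ ∈ I, (deriv γ τ).2 ≠ lam k (U₀ τ) * (deriv γ τ).1

/-- `c`, on `[0, 1]`, is a characteristic curve `dy = lam(U) dx` of `U` that runs inside `G`
from the point `p` to the point `q`. -/
structure IsCharacteristic (lam : State → ℝ) (U : Plane → State) (G : Set Plane)
    (c : ℝ → Plane) (p q : Plane) : Prop where
  source : c 0 = p
  target : c 1 = q
  smooth : ContDiffOn ℝ 1 c (Set.Icc 0 1)
  mapsTo : Set.MapsTo c (Set.Icc 0 1) G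
  slope : ∀ σ ∈ Set.Icc (0 : ℝ) 1,
    (derivWithin c (Set.Icc 0 1) σ).2 = lam (U (c σ)) * (derivWithin c (Set.Icc 0 1) σ).1

/-- `Λ ∇_R φ = ∇_R ψ` for `C¹` functions `φ`, `ψ` of `(r₁, r₂)` on the box `J 0 × J 1`. The
coefficients at `(r₁, r₂)` are the eigenvalues at the state `u` with Riemann invariants `(r₁, r₂)`. -/
structure IsLinearSolution (lam : Fin 2 → State → ℝ) (Ω : Set State) (Φ : Fin 2 → State → ℝ)
    (J : Fin 2 → Set ℝ) (φ ψ : Plane → ℝ) : Prop where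
  smooth_fst : ContDiffOn ℝ 1 φ (J 0 ×ˢ J 1)
  smooth_snd : ContDiffOn ℝ 1 ψ (J 0 ×ˢ J 1)
  eq_one : ∀ u ∈ Ω,
    lam 0 u * fderiv ℝ φ (riem Φ u) (1, 0) = fderiv ℝ ψ (riem Φ u) (1, 0)
  eq_two : ∀ u ∈ Ω,
    lam 1 u * fderiv ℝ φ (riem Φ u) (0, 1) = fderiv ℝ ψ (riem Φ u) (0, 1)

/-- The first linear problem: `ψ - λ₁ φ = 1` on `r₁ = r₁⁰` and `ψ - λ₂ φ = 0` on `r₂ = r₂⁰`. -/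
structure IsGoursatX (lam : Fin 2 → State → ℝ) (Ω : Set State) (Φ : Fin 2 → State → ℝ)
    (J : Fin 2 → Set ℝ) (r₀ : Plane) (φ ψ : Plane → ℝ) : Prop where
  linear : IsLinearSolution lam Ω Φ J φ ψ
  on_one : ∀ u ∈ Ω, Φ 0 u = r₀.1 → ψ (riem Φ u) - lam 0 u * φ (riem Φ u) = 1
  on_two : ∀ u ∈ Ω, Φ 1 u = r₀.2 → ψ (riem Φ u) - lam 1 u * φ (riem Φ u) = 0

/-- The second linear problem: `ψ / λ₁ - φ = 1` on `r₁ = r₁⁰` and `ψ / λ₂ - φ = 0` on `r₂ = r₂⁰`,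
written without denominators, so that it also makes sense where an eigenvalue vanishes. -/
structure IsGoursatY (lam : Fin 2 → State → ℝ) (Ω : Set State) (Φ : Fin 2 → State → ℝ)
    (J : Fin 2 → Set ℝ) (r₀ : Plane) (φ ψ : Plane → ℝ) : Prop where
  linear : IsLinearSolution lam Ω Φ J φ ψ
  on_one : ∀ u ∈ Ω, Φ 0 u = r₀.1 → ψ (riem Φ u) - lam 0 u * φ (riem Φ u) = lam 0 u
  on_two : ∀ u ∈ Ω, Φ 1 u = r₀.2 → ψ (riem Φ u) - lam 1 u * φ (riem Φ u) = 0

/-- Where the eigenvalues do not vanish, the conditions of the second problem are literally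
`ψ / λ₁ - φ = 1` on `r₁ = r₁⁰` and `ψ / λ₂ - φ = 0` on `r₂ = r₂⁰`. -/
theorem isGoursatY_iff_div {lam : Fin 2 → State → ℝ} {Ω : Set State} {Φ : Fin 2 → State → ℝ}
    {J : Fin 2 → Set ℝ} {r₀ : Plane} {φ ψ : Plane → ℝ}
    (h₁ : ∀ u ∈ Ω, Φ 0 u = r₀.1 → lam 0 u ≠ 0) (h₂ : ∀ u ∈ Ω, Φ 1 u = r₀.2 → lam 1 u ≠ 0) :
    IsGoursatY lam Ω Φ J r₀ φ ψ ↔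
      IsLinearSolution lam Ω Φ J φ ψ ∧
      (∀ u ∈ Ω, Φ 0 u = r₀.1 → ψ (riem Φ u) / lam 0 u - φ (riem Φ u) = 1) ∧
      (∀ u ∈ Ω, Φ 1 u = r₀.2 → ψ (riem Φ u) / lam 1 u - φ (riem Φ u) = 0) := by
  have key : ∀ a b l c : ℝ, l ≠ 0 → (a / l - b = c ↔ a - l * b = l * c) := by
    intro a b l c hl
    rw [sub_eq_iff_eq_add, div_eq_iff hl, sub_eq_iff_eq_add]
    constructor <;> intro h <;> linarith
  constructor
  · intro h
    refine ⟨h.linear, fun u hu hr => ?_, fun u hu hr => ?_⟩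
    · rw [key _ _ _ _ (h₁ u hu hr), mul_one]
      exact h.on_one u hu hr
    · rw [key _ _ _ _ (h₂ u hu hr), mul_zero]
      exact h.on_two u hu hr
  · rintro ⟨h, h1, h2⟩
    refine ⟨h, fun u hu hr => ?_, fun u hu hr => ?_⟩
    · have := (key _ _ _ _ (h₁ u hu hr)).1 (h1 u hu hr)
      rwa [mul_one] at this
    · have := (key _ _ _ _ (h₂ u hu hr)).1 (h2 u hu hr)
      rwa [mul_zero] at this

/-- The line integral of `ψ dx - φ dy` along the initial curve from `γ s` to `γ t`. -/
noncomputable def lineIntegral (Φ : Fin 2 → State → ℝ) (γ : ℝ → Plane) (U₀ : ℝ → State)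
    (φ ψ : Plane → ℝ) (s t : ℝ) : ℝ :=
  ∫ τ in s..t, (ψ (riem Φ (U₀ τ)) * (deriv γ τ).1 - φ (riem Φ (U₀ τ)) * (deriv γ τ).2)

/-- The pair `(r₁⁰, r₂⁰)` that belongs to `P = γ s` and `Q = γ t`: the value of `r₁` at `Q` and the
value of `r₂` at `P`. -/
def corner (Φ : Fin 2 → State → ℝ) (U₀ : ℝ → State) (s t : ℝ) : Plane :=
  (Φ 0 (U₀ t), Φ 1 (U₀ s))

/-- The point of the plane computed, for `P = γ s` and `Q = γ t`, from a family `φx, ψx` of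
solutions of the first linear problem and a family `φy, ψy` of solutions of the second one
(the families are indexed by `(r₁⁰, r₂⁰)`). -/
noncomputable def meetingPoint (Φ : Fin 2 → State → ℝ) (γ : ℝ → Plane) (U₀ : ℝ → State)
    (φx ψx φy ψy : Plane → Plane → ℝ) (p : Plane) : Plane :=
  ((γ p.2).1 - lineIntegral Φ γ U₀ (φx (corner Φ U₀ p.1 p.2)) (ψx (corner Φ U₀ p.1 p.2)) p.1 p.2,
   (γ p.2).2 - lineIntegral Φ γ U₀ (φy (corner Φ U₀ p.1 p.2)) (ψy (corner Φ U₀ p.1 p.2)) p.1 p.2)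

/-- `V` is an open set of parameter pairs `(s, t)` that contains with `(s, t)` all pairs of parameters
between `s` and `t`, and `H` is a `C¹` diffeomorphism of `V` onto the open set `G`. -/
structure IsChart (I : Set ℝ) (H : Plane → Plane) (V G : Set Plane) : Prop where
  subset : V ⊆ I ×ˢ I
  isOpen_source : IsOpen V
  isOpen_target : IsOpen G
  square : ∀ s t : ℝ, (s, t) ∈ V → Set.uIcc s t ×ˢ Set.uIcc s t ⊆ V
  bijOn : Set.BijOn H V G
  smooth : ContDiffOn ℝ 1 H V
  inverse : ∃ K : Plane → Plane, ContDiffOn ℝ 1 K G ∧ ∀ p ∈ V, K (H p) = p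

end QuasiHyp

open QuasiHyp

/-! The invariant r₁ is constant along dy = λ₁ dx, and r₂ along dy = λ₂ dx. Label a point by the
parameters (s, t) at which its second and its first characteristic meet the initial curve. The state
there has the invariants (r₁(t), r₂(s)), which are known in advance, and the coordinates x, y as
functions of (s, t) satisfy the linear system y_s = λ₁ x_s, y_t = λ₂ x_t, with (x, y) = γ on the
diagonal s = t. The independent variables are s, t and not r₁, r₂, so nothing is ever divided by r₁'
or r₂', and no Jacobian condition arises.

System (1) for φ, ψ has the same form. With ξ = x_s, η = x_t, m = x_st, equality of the mixed
derivatives of y is m (μ₁ - μ₂) = (μ₂)_s η - (μ₁)_t ξ. As ξ and η are integrals of m, this is a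
Volterra equation for m with merely continuous coefficients. `exists_volterra` solves it by a
Neumann series and `exists_hodograph` integrates back; this serves both `exists_goursat` (data on a
cross) and `exists_cauchy` (data on the diagonal). Uniqueness follows from the Gronwall inequality
`IsDependenceDomain.eq_zero_of_le`.

Formula (4) holds because ψ dx - φ dy is a closed form. It vanishes along the second characteristic
through P, and along the first one through Q it is dx for (2) and dy for (3); integrate over the
triangle P, Q, M. The argument is used in the (x, y) plane for a given solution
(`IsSolution.exists_primitive`, `IsSolution.apply_meetingPoint`), and in the (s, t) plane for the
linear system (`IsHodograph.eq_sub_integral`). The latter identifies H with the solution of the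
linear Cauchy problem (`IsCauchyData.exists_isCauchyMap`), so that H_s = ξ (1, λ₁) and H_t = η (1,
λ₂).

For the equivalence, if U ∘ H has the prescribed invariants, then each invariant has derivative zero
along its characteristic direction, since ξ, η ≠ 0 on a chart. Conversely, the difference between
the invariants of a solution at H(s, t) and the prescribed ones vanishes on the diagonal and
satisfies the Gronwall inequality. Charts exist near the arc because the curve is noncharacteristic,
which gives ξ, η ≠ 0 on the diagonal, and γ is injective there. -/

namespace QuasiHyp

open Set Filter Topology MeasureTheory intervalIntegral

/-! ### Exponential weights and a Gronwall inequality in two variables -/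

/-- An integral against an exponential weight that decreases away from the end point. -/
theorem abs_integral_le_of_exp {L M w x s : ℝ} {g : ℝ → ℝ} (hL : 0 < L) (hM : 0 ≤ M)
    (hg : ∀ σ ∈ uIcc x s, |g σ| ≤ M * Real.exp (L * (w - |s - σ|))) :
    |∫ σ in x..s, g σ| ≤ M * Real.exp (L * w) / L := by
  rcases le_total x s with h | h
  · have hd : ∀ σ ∈ uIcc x s, HasDerivAt (fun σ => M * Real.exp (L * (w - (s - σ))) / L)
        (M * Real.exp (L * (w - (s - σ)))) σ := by
      intro σ _
      have h1 : HasDerivAt (fun σ : ℝ => L * (w - (s - σ))) L σ := by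
        simpa using (((hasDerivAt_id σ).const_sub s).const_sub w).const_mul L
      exact ((h1.exp.const_mul M).div_const L).congr_deriv (by field_simp)
    have hc : Continuous fun σ => M * Real.exp (L * (w - (s - σ))) := by fun_prop
    have h2 := integral_eq_sub_of_hasDerivAt hd (hc.intervalIntegrable _ _)
    have h3 : ‖∫ σ in x..s, g σ‖ ≤ ∫ σ in x..s, M * Real.exp (L * (w - (s - σ))) := by
      refine intervalIntegral.norm_integral_le_of_norm_le h (ae_of_all _ fun σ hσ => ?_)
        (hc.intervalIntegrable _ _)
      have := hg σ (by rw [uIcc_of_le h]; exact Ioc_subset_Icc_self hσ)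
      rwa [abs_of_nonneg (by linarith [hσ.2] : 0 ≤ s - σ)] at this
    rw [h2, Real.norm_eq_abs] at h3
    -- The contribution of the far end point to the primitive has a favourable sign and is dropped.
    have : 0 ≤ M * Real.exp (L * (w - (s - x))) / L := by positivity
    simp only [sub_self, sub_zero] at h3
    linarith
  · have hd : ∀ σ ∈ uIcc s x, HasDerivAt (fun σ => -(M * Real.exp (L * (w - (σ - s))) / L))
        (M * Real.exp (L * (w - (σ - s)))) σ := by
      intro σ _
      have h1 : HasDerivAt (fun σ : ℝ => L * (w - (σ - s))) (-L) σ := by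
        simpa using (((hasDerivAt_id σ).sub_const s).const_sub w).const_mul L
      exact ((h1.exp.const_mul M).div_const L).neg.congr_deriv (by field_simp)
    have hc : Continuous fun σ => M * Real.exp (L * (w - (σ - s))) := by fun_prop
    have h2 := integral_eq_sub_of_hasDerivAt hd (hc.intervalIntegrable _ _)
    have h3 : ‖∫ σ in s..x, g σ‖ ≤ ∫ σ in s..x, M * Real.exp (L * (w - (σ - s))) := by
      refine intervalIntegral.norm_integral_le_of_norm_le h (ae_of_all _ fun σ hσ => ?_)
        (hc.intervalIntegrable _ _)
      have := hg σ (by rw [uIcc_of_ge h]; exact Ioc_subset_Icc_self hσ)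
      rwa [abs_of_nonpos (by linarith [hσ.1] : s - σ ≤ 0), neg_sub] at this
    rw [h2, Real.norm_eq_abs] at h3
    have : 0 ≤ M * Real.exp (L * (w - (x - s))) / L := by positivity
    simp only [sub_self, sub_zero] at h3
    rw [integral_symm, abs_neg]
    linarith

/-- `K` contains, with each point, the horizontal segment to the curve `s = α t` and the vertical
segment to the curve `t = β s`, and `w` grows at least at unit speed along these segments. -/
structure IsDependenceDomain (α β : ℝ → ℝ) (w : Plane → ℝ) (K : Set Plane) : Prop where
  horizontal : ∀ p ∈ K, ∀ σ ∈ uIcc (α p.2) p.1, (σ, p.2) ∈ K ∧ w (σ, p.2) + |p.1 - σ| ≤ w p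
  vertical : ∀ p ∈ K, ∀ τ ∈ uIcc (β p.1) p.2, (p.1, τ) ∈ K ∧ w (p.1, τ) + |p.2 - τ| ≤ w p

/-- Since `w` drops at least at unit speed along the segment, integrating something of size exp(L w)
gains a factor 1/L. A large L therefore makes integration a contraction in the weighted sup norm, on
any compact dependence domain. -/
theorem IsDependenceDomain.abs_integral_horizontal_le {α β : ℝ → ℝ} {w : Plane → ℝ} {K : Set Plane}
    (hK : IsDependenceDomain α β w K) {L M : ℝ} (hL : 0 < L) (hM : 0 ≤ M) {e : Plane → ℝ}
    (he : ∀ p ∈ K, |e p| ≤ M * Real.exp (L * w p)) {p : Plane} (hp : p ∈ K) :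
    |∫ σ in α p.2..p.1, e (σ, p.2)| ≤ M * Real.exp (L * w p) / L := by
  refine abs_integral_le_of_exp hL hM fun σ hσ => ?_
  obtain ⟨h1, h2⟩ := hK.horizontal p hp σ hσ
  refine (he _ h1).trans ?_
  gcongr
  linarith

theorem IsDependenceDomain.abs_integral_vertical_le {α β : ℝ → ℝ} {w : Plane → ℝ} {K : Set Plane}
    (hK : IsDependenceDomain α β w K) {L M : ℝ} (hL : 0 < L) (hM : 0 ≤ M) {e : Plane → ℝ}
    (he : ∀ p ∈ K, |e p| ≤ M * Real.exp (L * w p)) {p : Plane} (hp : p ∈ K) :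
    |∫ τ in β p.1..p.2, e (p.1, τ)| ≤ M * Real.exp (L * w p) / L := by
  refine abs_integral_le_of_exp hL hM fun σ hσ => ?_
  obtain ⟨h1, h2⟩ := hK.vertical p hp σ hσ
  refine (he _ h1).trans ?_
  gcongr
  linarith

/-- A Gronwall inequality in two variables. -/
theorem IsDependenceDomain.eq_zero_of_le {α β : ℝ → ℝ} {w : Plane → ℝ} {K : Set Plane}
    (hK : IsDependenceDomain α β w K) (hc : IsCompact K) (hw : ContinuousOn w K) {e : Plane → ℝ}
    (he : ContinuousOn e K) {C : ℝ}
    (hle : ∀ p ∈ K, |e p| ≤ C * (|(∫ σ in α p.2..p.1, |e (σ, p.2)|)| +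
      |(∫ τ in β p.1..p.2, |e (p.1, τ)|)|)) {p : Plane} (hp : p ∈ K) : e p = 0 := by
  -- Chosen so that the two integrals together cost at most 2|C|/L ≤ 1/2.
  set L : ℝ := 4 * |C| + 1
  have hL : 0 < L := by positivity
  obtain ⟨q, hq, hmax⟩ := hc.exists_isMaxOn ⟨p, hp⟩
    (f := fun p => |e p| * Real.exp (-(L * w p))) (he.abs.mul (by fun_prop))
  set M := |e q| * Real.exp (-(L * w q)) with hM
  have hM0 : 0 ≤ M := by positivity
  have hb : ∀ r ∈ K, |(|e r|)| ≤ M * Real.exp (L * w r) := by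
    intro r hr
    have h1 : |e r| * Real.exp (-(L * w r)) ≤ M := hmax hr
    calc |(|e r|)| = |e r| * Real.exp (-(L * w r)) * Real.exp (L * w r) := by
          rw [mul_assoc, ← Real.exp_add]; simp
      _ ≤ _ := by gcongr
  have h1 := hK.abs_integral_horizontal_le hL hM0 (e := fun p => |e p|) hb hq
  have h2 := hK.abs_integral_vertical_le hL hM0 (e := fun p => |e p|) hb hq
  have h3 : |e q| = M * Real.exp (L * w q) := by
    rw [hM, mul_assoc, ← Real.exp_add]; simp
  set B := M * Real.exp (L * w q) with hB
  have hB0 : 0 ≤ B := by positivity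
  -- At the maximum point `q` of the weighted function the hypothesis bounds B by half of itself, so
  -- the maximum is zero.
  have h4 : B ≤ |C| * (B / L + B / L) := by
    rw [← h3]
    refine (hle q hq).trans ?_
    rw [h3]
    exact (mul_le_mul_of_nonneg_right (le_abs_self C) (by positivity)).trans (by gcongr)
  have h5 : |C| * (B / L + B / L) ≤ B / 2 := by
    rw [← add_div, ← mul_div_assoc, div_le_iff₀ hL]
    simp only [L]
    nlinarith [abs_nonneg C]
  have h6 : B = 0 := by linarith
  have h7 : M = 0 := by
    rcases mul_eq_zero.1 (hB.symm.trans h6) with h | h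
    · exact h
    · exact absurd h (Real.exp_pos _).ne'
  have := hb p hp
  rw [h7, zero_mul, abs_abs] at this
  exact abs_nonpos_iff.1 this

/-! ### Integrals of functions that are continuous on an open box only -/

theorem hasDerivAt_integral_of_ordConnected {J : Set ℝ} (hJ : IsOpen J) (hJ' : J.OrdConnected)
    {f : ℝ → ℝ} (hf : ContinuousOn f J) {x y : ℝ} (hx : x ∈ J) (hy : y ∈ J) :
    HasDerivAt (fun z => ∫ σ in x..z, f σ) (f y) y :=
  integral_hasDerivAt_right ((hf.mono (hJ'.uIcc_subset hx hy)).intervalIntegrable)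
    (hf.stronglyMeasurableAtFilter hJ _ hy) (hf.continuousAt (hJ.mem_nhds hy))

theorem exists_Icc_subset_nhds {J : Set ℝ} (hJ : IsOpen J) (hJ' : J.OrdConnected) {x y : ℝ}
    (hx : x ∈ J) (hy : y ∈ J) : ∃ c d, c ≤ d ∧ Icc c d ⊆ J ∧ Icc c d ∈ 𝓝 x ∧ Icc c d ∈ 𝓝 y := by
  obtain ⟨ε, hε, h1⟩ := Metric.isOpen_iff.1 hJ _ hx
  obtain ⟨δ, hδ, h2⟩ := Metric.isOpen_iff.1 hJ _ hy
  have hm : ∀ z ∈ J, ∀ ρ > 0, Metric.ball z ρ ⊆ J → z - ρ / 2 ∈ J ∧ z + ρ / 2 ∈ J := by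
    intro z _ ρ hρ h
    constructor <;> apply h <;> rw [Metric.mem_ball, Real.dist_eq, abs_lt] <;>
      constructor <;> linarith
  obtain ⟨a1, b1⟩ := hm x hx ε hε h1
  obtain ⟨a2, b2⟩ := hm y hy δ hδ h2
  refine ⟨min (x - ε / 2) (y - δ / 2), max (x + ε / 2) (y + δ / 2), ?_, ?_, ?_, ?_⟩
  · exact (min_le_left _ _).trans (le_trans (by linarith) (le_max_left _ _))
  · apply hJ'.out
    · rcases min_choice (x - ε / 2) (y - δ / 2) with h | h <;> rw [h] <;> assumption
    · rcases max_choice (x + ε / 2) (y + δ / 2) with h | h <;> rw [h] <;> assumption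
  · exact Icc_mem_nhds ((min_le_left _ _).trans_lt (by linarith))
      (lt_of_lt_of_le (by linarith) (le_max_left _ _))
  · exact Icc_mem_nhds ((min_le_right _ _).trans_lt (by linarith))
      (lt_of_lt_of_le (by linarith) (le_max_right _ _))

/-- A parametric integral over an interval with variable end points, of a function that is
continuous on an open box only. -/
theorem continuousOn_integral_of_box {J₁ J₂ : Set ℝ} (h₁ : IsOpen J₁) (h₁' : J₁.OrdConnected)
    (h₂ : IsOpen J₂) (h₂' : J₂.OrdConnected) {m : Plane → ℝ} (hm : ContinuousOn m (J₁ ×ˢ J₂))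
    {X : Type*} [TopologicalSpace X] {S : Set X} {x y t : X → ℝ} (hx : ContinuousOn x S)
    (hy : ContinuousOn y S) (ht : ContinuousOn t S) (hx' : MapsTo x S J₁) (hy' : MapsTo y S J₁)
    (ht' : MapsTo t S J₂) : ContinuousOn (fun q => ∫ σ in x q..y q, m (σ, t q)) S := by
  intro q hq
  obtain ⟨c, d, hcd, hI, hnx, hny⟩ := exists_Icc_subset_nhds h₁ h₁' (hx' hq) (hy' hq)
  obtain ⟨c', d', hcd', hI', hnt, -⟩ := exists_Icc_subset_nhds h₂ h₂' (ht' hq) (ht' hq)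
  -- Clamping to a compact box makes the integrand continuous on the whole plane without changing it
  -- near `q`, so the global theorem on parametric integrals applies.
  set k : ℝ → ℝ := fun z => max c (min d z)
  set k' : ℝ → ℝ := fun z => max c' (min d' z)
  have hk : ∀ z, k z ∈ Icc c d := fun z => ⟨le_max_left _ _, max_le hcd (min_le_left _ _)⟩
  have hk' : ∀ z, k' z ∈ Icc c' d' := fun z => ⟨le_max_left _ _, max_le hcd' (min_le_left _ _)⟩
  have hke : ∀ z ∈ Icc c d, k z = z := fun z hz => by
    simp only [k]; rw [min_eq_right hz.2, max_eq_right hz.1]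
  have hke' : ∀ z ∈ Icc c' d', k' z = z := fun z hz => by
    simp only [k']; rw [min_eq_right hz.2, max_eq_right hz.1]
  have hmc : Continuous fun p : Plane => m (k p.1, k' p.2) := by
    refine hm.comp_continuous (f := fun p : Plane => (k p.1, k' p.2)) (by fun_prop) fun p => ?_
    exact ⟨hI (hk _), hI' (hk' _)⟩
  have hF : Continuous fun z : ℝ × ℝ => ∫ σ in (0 : ℝ)..z.1, m (k σ, k' z.2) := by
    refine intervalIntegral.continuous_parametric_intervalIntegral_of_continuous (μ := volume)
      (f := fun z σ => m (k σ, k' z.2)) (a₀ := 0) (s := fun z : ℝ × ℝ => z.1) ?_ continuous_fst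
    exact hmc.comp (by fun_prop : Continuous fun z : (ℝ × ℝ) × ℝ => (z.2, z.1.2))
  have hev : ∀ᶠ r in 𝓝[S] q, (∫ σ in x r..y r, m (σ, t r)) =
      (∫ σ in (0 : ℝ)..y r, m (k σ, k' (t r))) - ∫ σ in (0 : ℝ)..x r, m (k σ, k' (t r)) := by
    filter_upwards [hx q hq hnx, hy q hq hny, ht q hq hnt] with r h1 h2 h3
    have hcont : Continuous fun σ => m (k σ, k' (t r)) :=
      hmc.comp (by fun_prop : Continuous fun σ : ℝ => (σ, t r))
    rw [integral_interval_sub_left (hcont.intervalIntegrable _ _) (hcont.intervalIntegrable _ _)]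
    refine integral_congr fun σ hσ => ?_
    have := ordConnected_Icc.uIcc_subset h1 h2 hσ
    simp only [hke σ this, hke' _ h3]
  refine ContinuousWithinAt.congr_of_eventuallyEq ?_ hev (hev.self_of_nhdsWithin hq)
  have e1 : ContinuousWithinAt (fun r => (y r, t r)) S q := (hy q hq).prodMk (ht q hq)
  have e2 : ContinuousWithinAt (fun r => (x r, t r)) S q := (hx q hq).prodMk (ht q hq)
  exact (hF.continuousAt.comp_continuousWithinAt e1).sub
    (hF.continuousAt.comp_continuousWithinAt e2)

theorem continuousOn_integral_of_box' {J₁ J₂ : Set ℝ} (h₁ : IsOpen J₁) (h₁' : J₁.OrdConnected)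
    (h₂ : IsOpen J₂) (h₂' : J₂.OrdConnected) {m : Plane → ℝ} (hm : ContinuousOn m (J₁ ×ˢ J₂))
    {X : Type*} [TopologicalSpace X] {S : Set X} {x y s : X → ℝ} (hx : ContinuousOn x S)
    (hy : ContinuousOn y S) (hs : ContinuousOn s S) (hx' : MapsTo x S J₂) (hy' : MapsTo y S J₂)
    (hs' : MapsTo s S J₁) : ContinuousOn (fun q => ∫ τ in x q..y q, m (s q, τ)) S :=
  continuousOn_integral_of_box h₂ h₂' h₁ h₁' (m := fun p : Plane => m (p.2, p.1))
    (hm.comp (continuous_swap.continuousOn) fun _ hp => ⟨hp.2, hp.1⟩) hx hy hs hx' hy' hs'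

end QuasiHyp

namespace QuasiHyp

open Set Filter Topology MeasureTheory intervalIntegral

/-! ### The Volterra equation -/

/-- The Volterra operator with coefficients `c`, `d` and with initial curves `s = α t`, `t = β s`. -/
noncomputable def volterraOp (α β : ℝ → ℝ) (c d m : Plane → ℝ) (p : Plane) : ℝ :=
  c p * (∫ σ in α p.2..p.1, m (σ, p.2)) + d p * ∫ τ in β p.1..p.2, m (p.1, τ)

theorem continuousOn_volterraOp {J₁ J₂ : Set ℝ} (h₁ : IsOpen J₁) (h₁' : J₁.OrdConnected)
    (h₂ : IsOpen J₂) (h₂' : J₂.OrdConnected) {α β : ℝ → ℝ} (hα : ContinuousOn α J₂)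
    (hα' : MapsTo α J₂ J₁) (hβ : ContinuousOn β J₁) (hβ' : MapsTo β J₁ J₂) {c d m : Plane → ℝ}
    (hc : ContinuousOn c (J₁ ×ˢ J₂)) (hd : ContinuousOn d (J₁ ×ˢ J₂))
    (hm : ContinuousOn m (J₁ ×ˢ J₂)) : ContinuousOn (volterraOp α β c d m) (J₁ ×ˢ J₂) := by
  refine (hc.mul ?_).add (hd.mul ?_)
  · exact continuousOn_integral_of_box h₁ h₁' h₂ h₂' hm
      (hα.comp continuousOn_snd fun _ hp => hp.2) continuousOn_fst continuousOn_snd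
      (fun _ hp => hα' hp.2) (fun _ hp => hp.1) fun _ hp => hp.2
  · exact continuousOn_integral_of_box' h₁ h₁' h₂ h₂' hm
      (hβ.comp continuousOn_fst fun _ hp => hp.1) continuousOn_snd continuousOn_fst
      (fun _ hp => hβ' hp.1) (fun _ hp => hp.2) fun _ hp => hp.1

/-- On a compact dependence domain the iterates of the Volterra operator decrease geometrically. -/
theorem IsDependenceDomain.iterate_volterraOp_le {α β : ℝ → ℝ} {w : Plane → ℝ} {K : Set Plane}
    (hK : IsDependenceDomain α β w K) (hKc : IsCompact K) (hw : ContinuousOn w K)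
    {c d h : Plane → ℝ} (hc : ContinuousOn c K) (hd : ContinuousOn d K) (hh : ContinuousOn h K) :
    ∃ B : ℝ, ∀ n, ∀ p ∈ K, |(volterraOp α β c d)^[n] h p| ≤ B * (1 / 2) ^ n := by
  obtain ⟨C₁, hC₁⟩ := hKc.exists_bound_of_continuousOn hc
  obtain ⟨C₂, hC₂⟩ := hKc.exists_bound_of_continuousOn hd
  set C := |C₁| + |C₂|
  have hC0 : 0 ≤ C := by positivity
  -- One application of the operator costs at most C/L ≤ 1/2 in the norm weighted by exp(-L w).
  set L : ℝ := 4 * C + 1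
  have hL : 0 < L := by positivity
  obtain ⟨M₁, hM₁⟩ := hKc.exists_bound_of_continuousOn
    (f := fun p => h p * Real.exp (-(L * w p))) (hh.mul (by fun_prop))
  set M := |M₁|
  have hM0 : 0 ≤ M := abs_nonneg _
  obtain ⟨E, hE⟩ := hKc.exists_bound_of_continuousOn
    (f := fun p => Real.exp (L * w p)) (by fun_prop)
  have key : ∀ n, ∀ p ∈ K,
      |(volterraOp α β c d)^[n] h p| ≤ M * (1 / 2) ^ n * Real.exp (L * w p) := by
    intro n
    induction n with
    | zero =>
      intro p hp
      have h1 := (hM₁ p hp).trans (le_abs_self _)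
      rw [Real.norm_eq_abs, abs_mul, abs_of_pos (Real.exp_pos _)] at h1
      calc |h p| = |h p| * Real.exp (-(L * w p)) * Real.exp (L * w p) := by
            rw [mul_assoc, ← Real.exp_add]; simp
        _ ≤ _ := by rw [pow_zero, mul_one]; gcongr
    | succ n ih =>
      intro p hp
      rw [Function.iterate_succ_apply']
      set u := (volterraOp α β c d)^[n] h
      have a1 := hK.abs_integral_horizontal_le hL (by positivity) ih hp
      have a2 := hK.abs_integral_vertical_le hL (by positivity) ih hp
      set R := M * (1 / 2) ^ n * Real.exp (L * w p)
      have hR : 0 ≤ R := by positivity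
      have b1 : |c p| ≤ |C₁| := (hC₁ p hp).trans (le_abs_self _)
      have b2 : |d p| ≤ |C₂| := (hC₂ p hp).trans (le_abs_self _)
      calc |volterraOp α β c d u p| ≤ |c p| * |∫ σ in α p.2..p.1, u (σ, p.2)| +
            |d p| * |∫ τ in β p.1..p.2, u (p.1, τ)| := by
            unfold volterraOp
            rw [← abs_mul, ← abs_mul]
            exact abs_add_le _ _
        _ ≤ |C₁| * (R / L) + |C₂| * (R / L) := by gcongr
        _ = C * R / L := by ring
        _ ≤ R / 2 := by
            rw [div_le_iff₀ hL]
            simp only [L]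
            nlinarith
        _ = _ := by simp only [R, pow_succ]; ring
  refine ⟨M * |E|, fun n p hp => (key n p hp).trans ?_⟩
  have h1 : Real.exp (L * w p) ≤ |E| :=
    (le_abs_self _).trans ((hE p hp).trans (le_abs_self _))
  calc M * (1 / 2) ^ n * Real.exp (L * w p) ≤ M * (1 / 2) ^ n * |E| := by gcongr
    _ = _ := by ring

/-- Existence for a Volterra integral equation of the second kind in two variables. -/
theorem exists_volterra {J₁ J₂ : Set ℝ} (h₁ : IsOpen J₁) (h₁' : J₁.OrdConnected)
    (h₂ : IsOpen J₂) (h₂' : J₂.OrdConnected) {α β : ℝ → ℝ} (hα : ContinuousOn α J₂)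
    (hα' : MapsTo α J₂ J₁) (hβ : ContinuousOn β J₁) (hβ' : MapsTo β J₁ J₂) {w : Plane → ℝ}
    (hw : Continuous w)
    (hK : ∀ p ∈ J₁ ×ˢ J₂, ∃ K ⊆ J₁ ×ˢ J₂, IsCompact K ∧ K ∈ 𝓝 p ∧ IsDependenceDomain α β w K)
    {c d h : Plane → ℝ} (hc : ContinuousOn c (J₁ ×ˢ J₂)) (hd : ContinuousOn d (J₁ ×ˢ J₂))
    (hh : ContinuousOn h (J₁ ×ˢ J₂)) :
    ∃ m : Plane → ℝ, ContinuousOn m (J₁ ×ˢ J₂) ∧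
      ∀ p ∈ J₁ ×ˢ J₂, m p = h p + volterraOp α β c d m p := by
  -- Terms of the Neumann series. They are summable with a geometric bound on a compact
  -- neighbourhood of each point that is closed under the segments of integration, so continuity and
  -- termwise integration are local matters.
  set u : ℕ → Plane → ℝ := fun n => (volterraOp α β c d)^[n] h
  have hu : ∀ n, ContinuousOn (u n) (J₁ ×ˢ J₂) := by
    intro n
    induction n with
    | zero => exact hh
    | succ n ih =>
      simp only [u, Function.iterate_succ_apply']
      exact continuousOn_volterraOp h₁ h₁' h₂ h₂' hα hα' hβ hβ' hc hd ih
  have hB : ∀ K ⊆ J₁ ×ˢ J₂, IsCompact K → IsDependenceDomain α β w K →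
      ∃ B : ℝ, ∀ n, ∀ p ∈ K, ‖u n p‖ ≤ B * (1 / 2) ^ n := fun K hs hKc hKd =>
    hKd.iterate_volterraOp_le hKc hw.continuousOn (hc.mono hs) (hd.mono hs) (hh.mono hs)
  have hgeo : ∀ B : ℝ, Summable fun n : ℕ => B * (1 / 2 : ℝ) ^ n :=
    fun B => (summable_geometric_two).mul_left B
  have hsum : ∀ p ∈ J₁ ×ˢ J₂, Summable fun n => u n p := by
    intro p hp
    obtain ⟨K, hs, hKc, hKn, hKd⟩ := hK p hp
    obtain ⟨B, hB⟩ := hB K hs hKc hKd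
    exact Summable.of_norm_bounded (hgeo B) fun n => hB n p (mem_of_mem_nhds hKn)
  set m : Plane → ℝ := fun p => ∑' n, u n p
  refine ⟨m, fun p hp => ?_, fun p hp => ?_⟩
  · obtain ⟨K, hs, hKc, hKn, hKd⟩ := hK p hp
    obtain ⟨B, hB⟩ := hB K hs hKc hKd
    have : ContinuousOn m K := continuousOn_tsum (fun n => (hu n).mono hs) (hgeo B) hB
    exact (this.continuousAt hKn).continuousWithinAt
  · obtain ⟨K, hs, hKc, hKn, hKd⟩ := hK p hp
    obtain ⟨B, hB⟩ := hB K hs hKc hKd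
    have hpK := mem_of_mem_nhds hKn
    have i1 : HasSum (fun n => ∫ σ in α p.2..p.1, u n (σ, p.2))
        (∫ σ in α p.2..p.1, m (σ, p.2)) := by
      have hin : ∀ σ ∈ uIcc (α p.2) p.1, (σ, p.2) ∈ K := fun σ hσ => (hKd.horizontal p hpK σ hσ).1
      refine intervalIntegral.hasSum_integral_of_dominated_convergence
        (fun n _ => B * (1 / 2) ^ n) (fun n => ?_) (fun n => ?_) ?_ ?_ ?_
      · refine ContinuousOn.aestronglyMeasurable (ContinuousOn.mono ?_ uIoc_subset_uIcc)
          measurableSet_uIoc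
        exact (hu n).comp (by fun_prop) fun σ hσ => hs (hin σ hσ)
      · exact ae_of_all _ fun σ hσ => hB n _ (hin σ (uIoc_subset_uIcc hσ))
      · exact ae_of_all _ fun σ hσ => hgeo B
      · exact intervalIntegrable_const
      · exact ae_of_all _ fun σ hσ => (hsum _ (hs (hin σ (uIoc_subset_uIcc hσ)))).hasSum
    have i2 : HasSum (fun n => ∫ τ in β p.1..p.2, u n (p.1, τ))
        (∫ τ in β p.1..p.2, m (p.1, τ)) := by
      have hin : ∀ τ ∈ uIcc (β p.1) p.2, (p.1, τ) ∈ K := fun σ hσ => (hKd.vertical p hpK σ hσ).1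
      refine intervalIntegral.hasSum_integral_of_dominated_convergence
        (fun n _ => B * (1 / 2) ^ n) (fun n => ?_) (fun n => ?_) ?_ ?_ ?_
      · refine ContinuousOn.aestronglyMeasurable (ContinuousOn.mono ?_ uIoc_subset_uIcc)
          measurableSet_uIoc
        exact (hu n).comp (by fun_prop) fun σ hσ => hs (hin σ hσ)
      · exact ae_of_all _ fun σ hσ => hB n _ (hin σ (uIoc_subset_uIcc hσ))
      · exact ae_of_all _ fun σ hσ => hgeo B
      · exact intervalIntegrable_const
      · exact ae_of_all _ fun σ hσ => (hsum _ (hs (hin σ (uIoc_subset_uIcc hσ)))).hasSum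
    have i3 : HasSum (fun n => u (n + 1) p) (volterraOp α β c d m p) := by
      simp only [u, Function.iterate_succ_apply']
      exact (i1.mul_left (c p)).add (i2.mul_left (d p))
    have i4 : HasSum (fun n => u n p) (m p) := (hsum p hp).hasSum
    -- Applying the operator shifts the series by one term, so its value at `m` is `m` minus the
    -- zeroth term `h`.
    have i5 := (hasSum_nat_add_iff' 1).2 i4
    rw [Finset.sum_range_one] at i5
    have := i5.unique i3
    have e0 : u 0 p = h p := rfl
    linarith

/-! ### Gradients and potentials on a box -/

/-- The linear form `(x, y) ↦ a x + b y`. -/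
noncomputable def linForm (a b : ℝ) : Plane →L[ℝ] ℝ :=
  a • ContinuousLinearMap.fst ℝ ℝ ℝ + b • ContinuousLinearMap.snd ℝ ℝ ℝ

@[simp] theorem linForm_apply (a b : ℝ) (v : Plane) : linForm a b v = a * v.1 + b * v.2 := by
  simp [linForm]

theorem eq_linForm (f : Plane →L[ℝ] ℝ) : f = linForm (f (1, 0)) (f (0, 1)) := by
  ext <;> simp

theorem hasDerivAt_comp_linForm {W : Plane → ℝ} {a b : ℝ} {c : ℝ → Plane} {c' : Plane} {τ : ℝ}
    (hW : HasFDerivAt W (linForm a b) (c τ)) (hc : HasDerivAt c c' τ) :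
    HasDerivAt (fun τ => W (c τ)) (a * c'.1 + b * c'.2) τ :=
  (hW.comp_hasDerivAt τ hc).congr_deriv (linForm_apply _ _ _)

theorem hasDerivAt_fst_linForm {W : Plane → ℝ} {a b : ℝ} {p : Plane}
    (hW : HasFDerivAt W (linForm a b) p) : HasDerivAt (fun σ => W (σ, p.2)) a p.1 := by
  have : HasDerivAt (fun σ : ℝ => (σ, p.2)) ((1, 0) : Plane) p.1 :=
    (hasDerivAt_id p.1).prodMk (hasDerivAt_const p.1 p.2)
  exact (hasDerivAt_comp_linForm (c := fun σ => (σ, p.2)) hW this).congr_deriv (by simp)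

theorem hasDerivAt_snd_linForm {W : Plane → ℝ} {a b : ℝ} {p : Plane}
    (hW : HasFDerivAt W (linForm a b) p) : HasDerivAt (fun τ => W (p.1, τ)) b p.2 := by
  have : HasDerivAt (fun τ : ℝ => (p.1, τ)) ((0, 1) : Plane) p.2 :=
    (hasDerivAt_const p.2 p.1).prodMk (hasDerivAt_id p.2)
  exact (hasDerivAt_comp_linForm (c := fun τ => (p.1, τ)) hW this).congr_deriv (by simp)

/-- A function with a continuous gradient is of class `C¹`. -/
theorem contDiffOn_of_linForm {D : Set Plane} (hD : IsOpen D) {W F G : Plane → ℝ}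
    (hW : ∀ p ∈ D, HasFDerivAt W (linForm (F p) (G p)) p) (hF : ContinuousOn F D)
    (hG : ContinuousOn G D) : ContDiffOn ℝ 1 W D := by
  have h1 : ContDiffOn ℝ (0 + 1) W D := by
    rw [contDiffOn_succ_iff_fderiv_of_isOpen hD]
    refine ⟨fun p hp => (hW p hp).differentiableAt.differentiableWithinAt, by simp, ?_⟩
    rw [contDiffOn_zero]
    have : ContinuousOn (fun p => linForm (F p) (G p)) D :=
      (hF.smul continuousOn_const).add (hG.smul continuousOn_const)
    exact this.congr fun p hp => (hW p hp).fderiv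
  simpa using h1

/-- A pair of continuous functions on an open box with equal continuous mixed partial derivatives
is a gradient. -/
theorem exists_potential {J₁ J₂ : Set ℝ} (h₁ : IsOpen J₁) (h₁' : J₁.OrdConnected)
    (h₂ : IsOpen J₂) (h₂' : J₂.OrdConnected) {F G m : Plane → ℝ} (hF : ContinuousOn F (J₁ ×ˢ J₂))
    (hG : ContinuousOn G (J₁ ×ˢ J₂)) (hm : ContinuousOn m (J₁ ×ˢ J₂))
    (hFm : ∀ s ∈ J₁, ∀ t ∈ J₂, HasDerivAt (fun τ => F (s, τ)) (m (s, t)) t)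
    (hGm : ∀ s ∈ J₁, ∀ t ∈ J₂, HasDerivAt (fun σ => G (σ, t)) (m (s, t)) s)
    {p₀ : Plane} (hp₀ : p₀ ∈ J₁ ×ˢ J₂) (W₀ : ℝ) :
    ∃ W : Plane → ℝ, W p₀ = W₀ ∧ ∀ p ∈ J₁ ×ˢ J₂, HasFDerivAt W (linForm (F p) (G p)) p := by
  obtain ⟨s₀, t₀⟩ := p₀
  have hs₀ : s₀ ∈ J₁ := hp₀.1
  have ht₀ : t₀ ∈ J₂ := hp₀.2
  have cF : ∀ t ∈ J₂, ContinuousOn (fun σ => F (σ, t)) J₁ := fun t ht =>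
    hF.comp (by fun_prop) fun σ hσ => ⟨hσ, ht⟩
  have cG : ∀ s ∈ J₁, ContinuousOn (fun τ => G (s, τ)) J₂ := fun t ht =>
    hG.comp (by fun_prop) fun σ hσ => ⟨ht, hσ⟩
  have cm : ∀ s ∈ J₁, ContinuousOn (fun τ => m (s, τ)) J₂ := fun t ht =>
    hm.comp (by fun_prop) fun σ hσ => ⟨ht, hσ⟩
  -- Integral of F ds + G dt along a horizontal and then a vertical segment. The t-derivative is
  -- immediate; the s-derivative comes from differentiation under the second integral, where ∫ m dτ
  -- = F(s, t) - F(s, t₀).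
  set W : ℝ → ℝ → ℝ := fun s t => W₀ + (∫ σ in s₀..s, F (σ, t₀)) + ∫ τ in t₀..t, G (s, τ)
  have dt : ∀ s ∈ J₁, ∀ t ∈ J₂, HasDerivAt (fun t => W s t) (G (s, t)) t := by
    intro s hs t ht
    exact (hasDerivAt_integral_of_ordConnected h₂ h₂' (cG s hs) ht₀ ht).const_add _
  have ds : ∀ s ∈ J₁, ∀ t ∈ J₂, HasDerivAt (fun s => W s t) (F (s, t)) s := by
    intro s hs t ht
    obtain ⟨c, d, hcd, hI, hn, -⟩ := exists_Icc_subset_nhds h₁ h₁' hs hs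
    have hu : uIcc t₀ t ⊆ J₂ := h₂'.uIcc_subset ht₀ ht
    obtain ⟨B, hB⟩ := (isCompact_Icc (a := c) (b := d)).prod (isCompact_uIcc (a := t₀) (b := t))
      |>.exists_bound_of_continuousOn (hm.mono (prod_mono hI hu))
    have e1 := (intervalIntegral.hasDerivAt_integral_of_dominated_loc_of_deriv_le
      (F := fun s τ => G (s, τ)) (F' := fun s τ => m (s, τ)) (μ := volume) (a := t₀) (b := t)
      (bound := fun _ => B) hn ?_ ?_ ?_ ?_ ?_ ?_).2
    · have e2 : ∫ τ in t₀..t, m (s, τ) = F (s, t) - F (s, t₀) :=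
        integral_eq_sub_of_hasDerivAt (fun τ hτ => hFm s hs τ (hu hτ))
          (((cm s hs).mono hu).intervalIntegrable)
      have e3 := ((hasDerivAt_integral_of_ordConnected h₁ h₁' (cF t₀ ht₀) hs₀ hs).const_add W₀).add e1
      refine e3.congr_deriv ?_
      rw [e2]; ring
    · filter_upwards [hn] with r hr
      exact (((cG r (hI hr)).mono hu).mono uIoc_subset_uIcc).aestronglyMeasurable measurableSet_uIoc
    · exact ((cG s hs).mono hu).intervalIntegrable
    · exact (((cm s hs).mono hu).mono uIoc_subset_uIcc).aestronglyMeasurable measurableSet_uIoc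
    · exact ae_of_all _ fun τ hτ r hr => hB (r, τ) ⟨hr, uIoc_subset_uIcc hτ⟩
    · exact intervalIntegrable_const
    · exact ae_of_all _ fun τ hτ r hr => hGm r (hI hr) τ (hu (uIoc_subset_uIcc hτ))
  refine ⟨Function.uncurry W, by simp [W], fun p hp => ?_⟩
  have hop : J₁ ×ˢ J₂ ∈ 𝓝 p := (h₁.prod h₂).mem_nhds hp
  -- Continuous partial derivatives give total differentiability.
  have key := hasStrictFDerivAt_uncurry_coprod (𝕜 := ℝ) (u := p) (f := W)
    (f₁ := fun s t => ContinuousLinearMap.toSpanSingleton ℝ (F (s, t)))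
    (f₂ := fun s t => ContinuousLinearMap.toSpanSingleton ℝ (G (s, t))) ?_ ?_ ?_ ?_
  · refine key.hasFDerivAt.congr_fderiv ?_
    ext <;> simp [Function.HasUncurry.uncurry]
  · filter_upwards [hop] with v hv
    exact (ds v.1 hv.1 v.2 hv.2).hasFDerivAt
  · filter_upwards [hop] with v hv
    exact (dt v.1 hv.1 v.2 hv.2).hasFDerivAt
  · exact (ContinuousLinearMap.toSpanSingletonCLE (𝕜 := ℝ) (E := ℝ)).continuous.continuousAt.comp
      (hF.continuousAt hop)
  · exact (ContinuousLinearMap.toSpanSingletonCLE (𝕜 := ℝ) (E := ℝ)).continuous.continuousAt.comp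
      (hG.continuousAt hop)

end QuasiHyp

namespace QuasiHyp

open Set Filter Topology MeasureTheory intervalIntegral

/-! ### Domains of dependence and the linear system for X, Y -/

theorem abs_sub_add_abs_sub_of_mem_uIcc {x y z : ℝ} (h : z ∈ uIcc x y) :
    |z - x| + |y - z| = |y - x| := by
  rcases mem_uIcc.1 h with ⟨h1, h2⟩ | ⟨h1, h2⟩
  · rw [abs_of_nonneg (sub_nonneg.2 h1), abs_of_nonneg (sub_nonneg.2 h2),
      abs_of_nonneg (by linarith)]
    ring
  · rw [abs_of_nonpos (sub_nonpos.2 h2), abs_of_nonpos (sub_nonpos.2 h1),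
      abs_of_nonpos (by linarith)]
    ring

/-- The weight is the ℓ¹ distance to the corner (s₀, t₀), and a move along either coordinate towards
the cross lowers it by exactly the length of the move. -/
theorem isDependenceDomain_cross {c d c' d' s₀ t₀ : ℝ} (hs : s₀ ∈ Icc c d) (ht : t₀ ∈ Icc c' d') :
    IsDependenceDomain (fun _ => s₀) (fun _ => t₀) (fun p => |p.1 - s₀| + |p.2 - t₀|)
      (Icc c d ×ˢ Icc c' d') where
  horizontal p hp σ hσ := by
    refine ⟨⟨ordConnected_Icc.uIcc_subset hs hp.1 hσ, hp.2⟩, ?_⟩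
    have := abs_sub_add_abs_sub_of_mem_uIcc hσ
    dsimp only; linarith
  vertical p hp τ hτ := by
    refine ⟨⟨hp.1, ordConnected_Icc.uIcc_subset ht hp.2 hτ⟩, ?_⟩
    have := abs_sub_add_abs_sub_of_mem_uIcc hτ
    dsimp only; linarith

/-- A move towards the diagonal along either coordinate shortens |s - t| by its own length. Both
factors must be the same interval, so that the diagonal is reached inside the square. -/
theorem isDependenceDomain_diagonal (c d : ℝ) :
    IsDependenceDomain (fun t => t) (fun s => s) (fun p => |p.1 - p.2|)
      (Icc c d ×ˢ Icc c d) where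
  horizontal p hp σ hσ := by
    refine ⟨⟨ordConnected_Icc.uIcc_subset hp.2 hp.1 hσ, hp.2⟩, ?_⟩
    exact (abs_sub_add_abs_sub_of_mem_uIcc hσ).le
  vertical p hp τ hτ := by
    refine ⟨⟨hp.1, ordConnected_Icc.uIcc_subset hp.1 hp.2 hτ⟩, ?_⟩
    have := abs_sub_add_abs_sub_of_mem_uIcc hτ
    rw [abs_sub_comm τ, abs_sub_comm p.2 p.1] at this
    exact this.le

theorem exists_dependenceDomain_cross {J₁ J₂ : Set ℝ} (h₁ : IsOpen J₁) (h₁' : J₁.OrdConnected)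
    (h₂ : IsOpen J₂) (h₂' : J₂.OrdConnected) {s₀ t₀ : ℝ} (hs : s₀ ∈ J₁) (ht : t₀ ∈ J₂) {p : Plane}
    (hp : p ∈ J₁ ×ˢ J₂) : ∃ K ⊆ J₁ ×ˢ J₂, IsCompact K ∧ K ∈ 𝓝 p ∧
      IsDependenceDomain (fun _ => s₀) (fun _ => t₀) (fun p => |p.1 - s₀| + |p.2 - t₀|) K := by
  obtain ⟨c, d, -, hI, hn, hn'⟩ := exists_Icc_subset_nhds h₁ h₁' hp.1 hs
  obtain ⟨c', d', -, hJ, hm, hm'⟩ := exists_Icc_subset_nhds h₂ h₂' hp.2 ht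
  exact ⟨Icc c d ×ˢ Icc c' d', prod_mono hI hJ, isCompact_Icc.prod isCompact_Icc,
    prod_mem_nhds hn hm, isDependenceDomain_cross (mem_of_mem_nhds hn') (mem_of_mem_nhds hm')⟩

theorem exists_dependenceDomain_diagonal {I : Set ℝ} (h : IsOpen I) (h' : I.OrdConnected)
    {p : Plane} (hp : p ∈ I ×ˢ I) : ∃ K ⊆ I ×ˢ I, IsCompact K ∧ K ∈ 𝓝 p ∧
      IsDependenceDomain (fun t => t) (fun s => s) (fun p => |p.1 - p.2|) K := by
  obtain ⟨c, d, -, hI, hn, hm⟩ := exists_Icc_subset_nhds h h' hp.1 hp.2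
  exact ⟨Icc c d ×ˢ Icc c d, prod_mono hI hI, isCompact_Icc.prod isCompact_Icc,
    prod_mem_nhds hn hm, isDependenceDomain_diagonal c d⟩

/-- A solution `X, Y` of the linear hyperbolic system `Y_s = μ₁ X_s`, `Y_t = μ₂ X_t`, together with
`ξ = X_s`, `η = X_t` and the mixed derivative `m = X_st`. -/
structure IsHodograph (μ₁ μ₂ : Plane → ℝ) (D : Set Plane) (ξ η m X Y : Plane → ℝ) : Prop where
  continuousOn_ξ : ContinuousOn ξ D
  continuousOn_η : ContinuousOn η D
  continuousOn_m : ContinuousOn m D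
  deriv_ξ : ∀ p ∈ D, HasDerivAt (fun τ => ξ (p.1, τ)) (m p) p.2
  deriv_η : ∀ p ∈ D, HasDerivAt (fun σ => η (σ, p.2)) (m p) p.1
  compat : ∀ p ∈ D, m p * (μ₁ p - μ₂ p) = fderiv ℝ μ₂ p (1, 0) * η p - fderiv ℝ μ₁ p (0, 1) * ξ p
  deriv_X : ∀ p ∈ D, HasFDerivAt X (linForm (ξ p) (η p)) p
  deriv_Y : ∀ p ∈ D, HasFDerivAt Y (linForm (μ₁ p * ξ p) (μ₂ p * η p)) p

theorem hasFDerivAt_of_contDiffOn {D : Set Plane} (hD : IsOpen D) {μ : Plane → ℝ}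
    (hμ : ContDiffOn ℝ 1 μ D) {p : Plane} (hp : p ∈ D) :
    HasFDerivAt μ (linForm (fderiv ℝ μ p (1, 0)) (fderiv ℝ μ p (0, 1))) p := by
  rw [← eq_linForm]
  exact ((hμ.differentiableOn one_ne_zero).differentiableAt (hD.mem_nhds hp)).hasFDerivAt

theorem continuousOn_fderiv_apply_of_contDiffOn {D : Set Plane} (hD : IsOpen D) {μ : Plane → ℝ}
    (hμ : ContDiffOn ℝ 1 μ D) (v : Plane) : ContinuousOn (fun p => fderiv ℝ μ p v) D :=
  (hμ.continuousOn_fderiv_of_isOpen hD le_rfl).clm_apply continuousOn_const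

/-- The unknown is reduced to the mixed derivative `m`: ξ is its data on t = β(s) plus an integral
of m in t, and η is its data on s = α(t) plus an integral of m in s. The compatibility relation then
becomes a Volterra equation. General α, β cover the cross of the Goursat problem and the diagonal of
the Cauchy problem at once. -/
theorem exists_hodograph {J₁ J₂ : Set ℝ} (h₁ : IsOpen J₁) (h₁' : J₁.OrdConnected)
    (h₂ : IsOpen J₂) (h₂' : J₂.OrdConnected) {α β : ℝ → ℝ} (hα : ContinuousOn α J₂)
    (hα' : MapsTo α J₂ J₁) (hβ : ContinuousOn β J₁) (hβ' : MapsTo β J₁ J₂) {w : Plane → ℝ}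
    (hw : Continuous w)
    (hK : ∀ p ∈ J₁ ×ˢ J₂, ∃ K ⊆ J₁ ×ˢ J₂, IsCompact K ∧ K ∈ 𝓝 p ∧ IsDependenceDomain α β w K)
    {μ₁ μ₂ : Plane → ℝ} (hμ₁ : ContDiffOn ℝ 1 μ₁ (J₁ ×ˢ J₂)) (hμ₂ : ContDiffOn ℝ 1 μ₂ (J₁ ×ˢ J₂))
    (hne : ∀ p ∈ J₁ ×ˢ J₂, μ₁ p ≠ μ₂ p) {ξ₀ η₀ : ℝ → ℝ} (hξ₀ : ContinuousOn ξ₀ J₁)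
    (hη₀ : ContinuousOn η₀ J₂) {p₀ : Plane} (hp₀ : p₀ ∈ J₁ ×ˢ J₂) (X₀ Y₀ : ℝ) :
    ∃ ξ η m X Y : Plane → ℝ, IsHodograph μ₁ μ₂ (J₁ ×ˢ J₂) ξ η m X Y ∧ X p₀ = X₀ ∧ Y p₀ = Y₀ ∧
      (∀ s ∈ J₁, ξ (s, β s) = ξ₀ s) ∧ ∀ t ∈ J₂, η (α t, t) = η₀ t := by
  have hD : IsOpen (J₁ ×ˢ J₂) := h₁.prod h₂
  -- The compatibility relation solved for m: m = c η + d ξ. Strict hyperbolicity permits the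
  -- division.
  set c : Plane → ℝ := fun p => fderiv ℝ μ₂ p (1, 0) / (μ₁ p - μ₂ p)
  set d : Plane → ℝ := fun p => -fderiv ℝ μ₁ p (0, 1) / (μ₁ p - μ₂ p)
  have hne' : ∀ p ∈ J₁ ×ˢ J₂, μ₁ p - μ₂ p ≠ 0 := fun p hp => sub_ne_zero.2 (hne p hp)
  have hc : ContinuousOn c (J₁ ×ˢ J₂) := (continuousOn_fderiv_apply_of_contDiffOn hD hμ₂ _).div
    (hμ₁.continuousOn.sub hμ₂.continuousOn) hne'
  have hd : ContinuousOn d (J₁ ×ˢ J₂) := (continuousOn_fderiv_apply_of_contDiffOn hD hμ₁ _).neg.div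
    (hμ₁.continuousOn.sub hμ₂.continuousOn) hne'
  have hξ₀' : ContinuousOn (fun p : Plane => ξ₀ p.1) (J₁ ×ˢ J₂) :=
    hξ₀.comp continuousOn_fst fun p hp => hp.1
  have hη₀' : ContinuousOn (fun p : Plane => η₀ p.2) (J₁ ×ˢ J₂) :=
    hη₀.comp continuousOn_snd fun p hp => hp.2
  obtain ⟨m, hm, hmeq⟩ := exists_volterra h₁ h₁' h₂ h₂' hα hα' hβ hβ' hw hK hc hd
    (h := fun p => c p * η₀ p.2 + d p * ξ₀ p.1) ((hc.mul hη₀').add (hd.mul hξ₀'))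
  set ξ : Plane → ℝ := fun p => ξ₀ p.1 + ∫ τ in β p.1..p.2, m (p.1, τ)
  set η : Plane → ℝ := fun p => η₀ p.2 + ∫ σ in α p.2..p.1, m (σ, p.2)
  have hξ : ContinuousOn ξ (J₁ ×ˢ J₂) := hξ₀'.add <|
    continuousOn_integral_of_box' h₁ h₁' h₂ h₂' hm
      (hβ.comp continuousOn_fst fun _ hp => hp.1) continuousOn_snd continuousOn_fst
      (fun _ hp => hβ' hp.1) (fun _ hp => hp.2) fun _ hp => hp.1
  have hη : ContinuousOn η (J₁ ×ˢ J₂) := hη₀'.add <|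
    continuousOn_integral_of_box h₁ h₁' h₂ h₂' hm
      (hα.comp continuousOn_snd fun _ hp => hp.2) continuousOn_fst continuousOn_snd
      (fun _ hp => hα' hp.2) (fun _ hp => hp.1) fun _ hp => hp.2
  have dξ : ∀ p ∈ J₁ ×ˢ J₂, HasDerivAt (fun τ => ξ (p.1, τ)) (m p) p.2 := fun p hp =>
    (hasDerivAt_integral_of_ordConnected h₂ h₂' (f := fun τ => m (p.1, τ)) (hm.comp (by fun_prop) fun σ hσ => ⟨hp.1, hσ⟩)
      (hβ' hp.1) hp.2).const_add (ξ₀ p.1)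
  have dη : ∀ p ∈ J₁ ×ˢ J₂, HasDerivAt (fun σ => η (σ, p.2)) (m p) p.1 := fun p hp =>
    (hasDerivAt_integral_of_ordConnected h₁ h₁' (f := fun σ => m (σ, p.2)) (hm.comp (by fun_prop) fun σ hσ => ⟨hσ, hp.2⟩)
      (hα' hp.2) hp.1).const_add (η₀ p.2)
  have hcomp : ∀ p ∈ J₁ ×ˢ J₂,
      m p * (μ₁ p - μ₂ p) = fderiv ℝ μ₂ p (1, 0) * η p - fderiv ℝ μ₁ p (0, 1) * ξ p := by
    intro p hp
    have e : m p = c p * η p + d p * ξ p := by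
      rw [hmeq p hp]; simp only [volterraOp, ξ, η]; ring
    have := hne' p hp
    rw [e]
    simp only [c, d]
    field_simp
    ring
  obtain ⟨X, hX0, hX⟩ := exists_potential h₁ h₁' h₂ h₂' hξ hη hm
    (fun s hs t ht => dξ (s, t) ⟨hs, ht⟩) (fun s hs t ht => dη (s, t) ⟨hs, ht⟩) hp₀ X₀
  obtain ⟨Y, hY0, hY⟩ := exists_potential h₁ h₁' h₂ h₂' (hμ₁.continuousOn.mul hξ)
    (hμ₂.continuousOn.mul hη)
    (m := fun p => fderiv ℝ μ₁ p (0, 1) * ξ p + μ₁ p * m p)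
    (((continuousOn_fderiv_apply_of_contDiffOn hD hμ₁ _).mul hξ).add (hμ₁.continuousOn.mul hm))
    (fun s hs t ht => (hasDerivAt_snd_linForm
      (hasFDerivAt_of_contDiffOn hD hμ₁ (p := (s, t)) ⟨hs, ht⟩)).mul (dξ (s, t) ⟨hs, ht⟩))
    (fun s hs t ht => ((hasDerivAt_fst_linForm
      (hasFDerivAt_of_contDiffOn hD hμ₂ (p := (s, t)) ⟨hs, ht⟩)).mul
        (dη (s, t) ⟨hs, ht⟩)).congr_deriv (by have := hcomp (s, t) ⟨hs, ht⟩; linarith)) hp₀ Y₀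
  exact ⟨ξ, η, m, X, Y, ⟨hξ, hη, hm, dξ, dη, hcomp, hX, hY⟩, hX0, hY0,
    fun s _ => by simp [ξ], fun t _ => by simp [η]⟩

end QuasiHyp

namespace QuasiHyp

open Set Filter Topology MeasureTheory intervalIntegral

/-! ### The Goursat problem -/

theorem eqOn_of_hasDerivAt_eq {J : Set ℝ} (hJ : IsOpen J) (hJ' : J.OrdConnected) {f g h : ℝ → ℝ}
    (hf : ∀ x ∈ J, HasDerivAt f (h x) x) (hg : ∀ x ∈ J, HasDerivAt g (h x) x) {x₀ : ℝ}
    (hx₀ : x₀ ∈ J) (he : f x₀ = g x₀) : EqOn f g J :=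
  hJ.eqOn_of_deriv_eq hJ'.isPreconnected
    (fun x hx => (hf x hx).differentiableAt.differentiableWithinAt)
    (fun x hx => (hg x hx).differentiableAt.differentiableWithinAt)
    (fun x hx => by rw [(hf x hx).deriv, (hg x hx).deriv]) hx₀ he

/-- The scalar linear differential equation `y' = a y + g`. -/
theorem exists_linear_ode {J : Set ℝ} (hJ : IsOpen J) (hJ' : J.OrdConnected) {a g : ℝ → ℝ}
    (ha : ContinuousOn a J) (hg : ContinuousOn g J) {x₀ : ℝ} (hx₀ : x₀ ∈ J) (y₀ : ℝ) :
    ∃ y : ℝ → ℝ, y x₀ = y₀ ∧ ∀ x ∈ J, HasDerivAt y (a x * y x + g x) x := by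
  set A : ℝ → ℝ := fun x => ∫ z in x₀..x, a z
  have hA : ∀ x ∈ J, HasDerivAt A (a x) x := fun x hx =>
    hasDerivAt_integral_of_ordConnected hJ hJ' ha hx₀ hx
  have hAc : ContinuousOn A J := fun x hx => (hA x hx).continuousAt.continuousWithinAt
  have hG : ContinuousOn (fun z => Real.exp (-A z) * g z) J := hAc.neg.rexp.mul hg
  -- Variation of constants.
  refine ⟨fun x => Real.exp (A x) * (y₀ + ∫ z in x₀..x, Real.exp (-A z) * g z), by simp [A],
    fun x hx => ?_⟩
  have h1 := (hA x hx).exp.mul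
    ((hasDerivAt_integral_of_ordConnected hJ hJ' hG hx₀ hx).const_add y₀)
  refine h1.congr_deriv ?_
  have : Real.exp (A x) * Real.exp (-A x) = 1 := by rw [← Real.exp_add]; simp
  linear_combination g x * this

/-- `φ`, `ψ` are of class `C¹` and satisfy `μ₁ φ_s = ψ_s`, `μ₂ φ_t = ψ_t`. -/
structure IsDiagonalSolution (μ₁ μ₂ : Plane → ℝ) (D : Set Plane) (φ ψ : Plane → ℝ) : Prop where
  smooth_fst : ContDiffOn ℝ 1 φ D
  smooth_snd : ContDiffOn ℝ 1 ψ D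
  eq_one : ∀ p ∈ D, μ₁ p * fderiv ℝ φ p (1, 0) = fderiv ℝ ψ p (1, 0)
  eq_two : ∀ p ∈ D, μ₂ p * fderiv ℝ φ p (0, 1) = fderiv ℝ ψ p (0, 1)

theorem IsHodograph.isDiagonalSolution {μ₁ μ₂ : Plane → ℝ} {D : Set Plane} {ξ η m X Y : Plane → ℝ}
    (h : IsHodograph μ₁ μ₂ D ξ η m X Y) (hD : IsOpen D) (hμ₁ : ContinuousOn μ₁ D)
    (hμ₂ : ContinuousOn μ₂ D) : IsDiagonalSolution μ₁ μ₂ D X Y where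
  smooth_fst := contDiffOn_of_linForm hD h.deriv_X h.continuousOn_ξ h.continuousOn_η
  smooth_snd := contDiffOn_of_linForm hD h.deriv_Y (hμ₁.mul h.continuousOn_ξ)
    (hμ₂.mul h.continuousOn_η)
  eq_one p hp := by rw [(h.deriv_X p hp).fderiv, (h.deriv_Y p hp).fderiv]; simp
  eq_two p hp := by rw [(h.deriv_X p hp).fderiv, (h.deriv_Y p hp).fderiv]; simp

/-- Existence for the Goursat problem. -/
theorem exists_goursat {J₁ J₂ : Set ℝ} (h₁ : IsOpen J₁) (h₁' : J₁.OrdConnected)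
    (h₂ : IsOpen J₂) (h₂' : J₂.OrdConnected)
    {μ₁ μ₂ : Plane → ℝ} (hμ₁ : ContDiffOn ℝ 1 μ₁ (J₁ ×ˢ J₂)) (hμ₂ : ContDiffOn ℝ 1 μ₂ (J₁ ×ˢ J₂))
    (hne : ∀ p ∈ J₁ ×ˢ J₂, μ₁ p ≠ μ₂ p) {s₀ t₀ : ℝ} (hs₀ : s₀ ∈ J₁) (ht₀ : t₀ ∈ J₂)
    {f f' : ℝ → ℝ} (hf : ∀ t ∈ J₂, HasDerivAt f (f' t) t) (hf' : ContinuousOn f' J₂) :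
    ∃ φ ψ : Plane → ℝ, IsDiagonalSolution μ₁ μ₂ (J₁ ×ˢ J₂) φ ψ ∧
      (∀ t ∈ J₂, ψ (s₀, t) - μ₁ (s₀, t) * φ (s₀, t) = f t) ∧
      ∀ s ∈ J₁, ψ (s, t₀) - μ₂ (s, t₀) * φ (s, t₀) = 0 := by
  have hD : IsOpen (J₁ ×ˢ J₂) := h₁.prod h₂
  have hp₀ : (s₀, t₀) ∈ J₁ ×ˢ J₂ := ⟨hs₀, ht₀⟩
  have m₁ : MapsTo (fun s : ℝ => (s, t₀)) J₁ (J₁ ×ˢ J₂) := fun s hs => ⟨hs, ht₀⟩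
  have m₂ : MapsTo (fun t : ℝ => (s₀, t)) J₂ (J₁ ×ˢ J₂) := fun t ht => ⟨hs₀, ht⟩
  have hdiff : ∀ p ∈ J₁ ×ˢ J₂, μ₂ p - μ₁ p ≠ 0 := fun p hp => sub_ne_zero.2 (hne p hp).symm
  have hgap : ContinuousOn (fun p => μ₂ p - μ₁ p) (J₁ ×ˢ J₂) :=
    hμ₂.continuousOn.sub hμ₁.continuousOn
  have hdμ₁ := continuousOn_fderiv_apply_of_contDiffOn hD hμ₁ (0, 1)
  have hdμ₂ := continuousOn_fderiv_apply_of_contDiffOn hD hμ₂ (1, 0)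
  -- At the corner both conditions hold, and subtracting them gives (μ₂ - μ₁) φ = f.
  set X₀ : ℝ := f t₀ / (μ₂ (s₀, t₀) - μ₁ (s₀, t₀)) with hX₀
  -- Differentiate ψ - μ₁ φ = f along s = s₀ and use ψ_t = μ₂ φ_t: (μ₂ - μ₁) φ_t = (μ₁)_t φ + f'. On
  -- t = t₀ the other condition likewise gives a linear equation for φ. Thus φ is known on the
  -- cross, and its tangential derivatives there are the data for the hodograph system.
  set a₂ : ℝ → ℝ := fun t => fderiv ℝ μ₁ (s₀, t) (0, 1) / (μ₂ (s₀, t) - μ₁ (s₀, t))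
  set g₂ : ℝ → ℝ := fun t => f' t / (μ₂ (s₀, t) - μ₁ (s₀, t))
  set a₁ : ℝ → ℝ := fun s => -fderiv ℝ μ₂ (s, t₀) (1, 0) / (μ₂ (s, t₀) - μ₁ (s, t₀))
  have ha₂ : ContinuousOn a₂ J₂ := (hdμ₁.div hgap hdiff).comp (by fun_prop) m₂
  have hg₂ : ContinuousOn g₂ J₂ :=
    hf'.div (hgap.comp (by fun_prop) m₂) fun t ht => hdiff _ (m₂ ht)
  have ha₁ : ContinuousOn a₁ J₁ := (hdμ₂.neg.div hgap hdiff).comp (by fun_prop) m₁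
  obtain ⟨y₂, hy₂0, hy₂⟩ := exists_linear_ode h₂ h₂' ha₂ hg₂ ht₀ X₀
  obtain ⟨y₁, hy₁0, hy₁⟩ := exists_linear_ode h₁ h₁' ha₁ (g := fun _ => 0) continuousOn_const hs₀ X₀
  have cy₂ : ContinuousOn y₂ J₂ := fun x hx => (hy₂ x hx).continuousAt.continuousWithinAt
  have cy₁ : ContinuousOn y₁ J₁ := fun x hx => (hy₁ x hx).continuousAt.continuousWithinAt
  obtain ⟨ξ, η, m, X, Y, hXY, hX, hY, hξ, hη⟩ := exists_hodograph h₁ h₁' h₂ h₂'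
    (α := fun _ => s₀) (β := fun _ => t₀) continuousOn_const (fun _ _ => hs₀) continuousOn_const
    (fun _ _ => ht₀) (w := fun p => |p.1 - s₀| + |p.2 - t₀|) (by fun_prop)
    (fun p hp => exists_dependenceDomain_cross h₁ h₁' h₂ h₂' hs₀ ht₀ hp) hμ₁ hμ₂ hne
    (ξ₀ := fun s => a₁ s * y₁ s + 0) ((ha₁.mul cy₁).add continuousOn_const)
    (η₀ := fun t => a₂ t * y₂ t + g₂ t) ((ha₂.mul cy₂).add hg₂) hp₀ X₀ (μ₂ (s₀, t₀) * X₀)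
  -- The data η₀ was built from y₂ and not from X, so the two must be identified before the
  -- differential equation can be used for X.
  have eX₂ : EqOn (fun t => X (s₀, t)) y₂ J₂ := by
    refine eqOn_of_hasDerivAt_eq h₂ h₂' (fun t ht => ?_) hy₂ ht₀ (hX.trans hy₂0.symm)
    exact (hasDerivAt_snd_linForm (hXY.deriv_X (s₀, t) (m₂ ht))).congr_deriv (hη t ht)
  have eX₁ : EqOn (fun s => X (s, t₀)) y₁ J₁ := by
    refine eqOn_of_hasDerivAt_eq h₁ h₁' (fun t ht => ?_) hy₁ hs₀ (hX.trans hy₁0.symm)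
    exact (hasDerivAt_fst_linForm (hXY.deriv_X (t, t₀) (m₁ ht))).congr_deriv (hξ t ht)
  refine ⟨X, Y, hXY.isDiagonalSolution hD hμ₁.continuousOn hμ₂.continuousOn, ?_, ?_⟩
  · refine eqOn_of_hasDerivAt_eq h₂ h₂' (fun t ht => ?_) hf ht₀ ?_
    · have d1 := (hasDerivAt_snd_linForm (hXY.deriv_Y (s₀, t) (m₂ ht))).sub
        ((hasDerivAt_snd_linForm (hasFDerivAt_of_contDiffOn hD hμ₁ (m₂ ht))).mul
          (hasDerivAt_snd_linForm (hXY.deriv_X (s₀, t) (m₂ ht))))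
      refine d1.congr_deriv ?_
      have e1 : η (s₀, t) = _ := hη t ht
      have e2 : X (s₀, t) = _ := eX₂ ht
      have e3 := hdiff _ (m₂ ht)
      simp only at e3 ⊢
      rw [e1, e2]
      simp only [a₂, g₂]
      field_simp
      ring
    · have e3 := hdiff _ hp₀
      rw [hX, hY, hX₀]
      field_simp
  · refine eqOn_of_hasDerivAt_eq h₁ h₁' (fun s hs => ?_) (g := fun _ => (0 : ℝ))
      (fun s _ => hasDerivAt_const s 0) hs₀ ?_
    · have d1 := (hasDerivAt_fst_linForm (hXY.deriv_Y (s, t₀) (m₁ hs))).sub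
        ((hasDerivAt_fst_linForm (hasFDerivAt_of_contDiffOn hD hμ₂ (m₁ hs))).mul
          (hasDerivAt_fst_linForm (hXY.deriv_X (s, t₀) (m₁ hs))))
      refine d1.congr_deriv ?_
      have e1 : ξ (s, t₀) = _ := hξ s hs
      have e2 : X (s, t₀) = _ := eX₁ hs
      have e3 := hdiff _ (m₁ hs)
      simp only at e3 ⊢
      rw [e1, e2]
      simp only [a₁]
      field_simp
      ring
    · simp only [hX, hY]; ring

theorem IsDiagonalSolution.hasFDerivAt {μ₁ μ₂ : Plane → ℝ} {D : Set Plane} {φ ψ : Plane → ℝ}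
    (h : IsDiagonalSolution μ₁ μ₂ D φ ψ) (hD : IsOpen D) {p : Plane} (hp : p ∈ D) :
    HasFDerivAt φ (linForm (fderiv ℝ φ p (1, 0)) (fderiv ℝ φ p (0, 1))) p ∧
    HasFDerivAt ψ (linForm (μ₁ p * fderiv ℝ φ p (1, 0)) (μ₂ p * fderiv ℝ φ p (0, 1))) p := by
  refine ⟨hasFDerivAt_of_contDiffOn hD h.smooth_fst hp, ?_⟩
  rw [h.eq_one p hp, h.eq_two p hp]
  exact hasFDerivAt_of_contDiffOn hD h.smooth_snd hp

/-- The quantity `ψ - μ₁ φ` has the derivative `-∂₁μ₁ φ` in the first direction. -/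
theorem IsDiagonalSolution.hasDerivAt_fst {μ₁ μ₂ : Plane → ℝ} {D : Set Plane} {φ ψ : Plane → ℝ}
    (h : IsDiagonalSolution μ₁ μ₂ D φ ψ) (hD : IsOpen D) (hμ₁ : ContDiffOn ℝ 1 μ₁ D) {p : Plane}
    (hp : p ∈ D) : HasDerivAt (fun σ => ψ (σ, p.2) - μ₁ (σ, p.2) * φ (σ, p.2))
      (-fderiv ℝ μ₁ p (1, 0) * φ p) p.1 := by
  obtain ⟨h1, h2⟩ := h.hasFDerivAt hD hp
  refine ((hasDerivAt_fst_linForm h2).sub ((hasDerivAt_fst_linForm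
    (hasFDerivAt_of_contDiffOn hD hμ₁ hp)).mul (hasDerivAt_fst_linForm h1))).congr_deriv ?_
  simp only [Prod.mk.eta]
  ring

/-- The quantity `ψ - μ₂ φ` has the derivative `-∂₂μ₂ φ` in the second direction. -/
theorem IsDiagonalSolution.hasDerivAt_snd {μ₁ μ₂ : Plane → ℝ} {D : Set Plane} {φ ψ : Plane → ℝ}
    (h : IsDiagonalSolution μ₁ μ₂ D φ ψ) (hD : IsOpen D) (hμ₂ : ContDiffOn ℝ 1 μ₂ D) {p : Plane}
    (hp : p ∈ D) : HasDerivAt (fun τ => ψ (p.1, τ) - μ₂ (p.1, τ) * φ (p.1, τ))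
      (-fderiv ℝ μ₂ p (0, 1) * φ p) p.2 := by
  obtain ⟨h1, h2⟩ := h.hasFDerivAt hD hp
  refine ((hasDerivAt_snd_linForm h2).sub ((hasDerivAt_snd_linForm
    (hasFDerivAt_of_contDiffOn hD hμ₂ hp)).mul (hasDerivAt_snd_linForm h1))).congr_deriv ?_
  simp only [Prod.mk.eta]
  ring

theorem IsDiagonalSolution.sub {μ₁ μ₂ : Plane → ℝ} {D : Set Plane} {φ ψ φ' ψ' : Plane → ℝ}
    (h : IsDiagonalSolution μ₁ μ₂ D φ ψ) (h' : IsDiagonalSolution μ₁ μ₂ D φ' ψ') (hD : IsOpen D) :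
    IsDiagonalSolution μ₁ μ₂ D (φ - φ') (ψ - ψ') where
  smooth_fst := h.smooth_fst.sub h'.smooth_fst
  smooth_snd := h.smooth_snd.sub h'.smooth_snd
  eq_one p hp := by
    obtain ⟨h1, h2⟩ := h.hasFDerivAt hD hp
    obtain ⟨h3, h4⟩ := h'.hasFDerivAt hD hp
    rw [(h1.sub h3).fderiv, (h2.sub h4).fderiv]
    simp only [sub_apply, linForm_apply]
    ring
  eq_two p hp := by
    obtain ⟨h1, h2⟩ := h.hasFDerivAt hD hp
    obtain ⟨h3, h4⟩ := h'.hasFDerivAt hD hp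
    rw [(h1.sub h3).fderiv, (h2.sub h4).fderiv]
    simp only [sub_apply, linForm_apply]
    ring

theorem abs_integral_mul_le {a e : ℝ → ℝ} {x y B : ℝ} (ha : ∀ z ∈ uIcc x y, |a z| ≤ B)
    (he : ContinuousOn e (uIcc x y)) : |∫ z in x..y, a z * e z| ≤ B * |(∫ z in x..y, |e z|)| := by
  have h1 : ‖∫ z in x..y, a z * e z‖ ≤ |(∫ z in x..y, B * |e z|)| := by
    refine norm_integral_le_abs_of_norm_le ?_
      ((he.abs.const_smul B).intervalIntegrable)
    refine (ae_restrict_iff' measurableSet_uIoc).2 (ae_of_all _ fun z hz => ?_)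
    rw [Real.norm_eq_abs, abs_mul]
    exact mul_le_mul_of_nonneg_right (ha z (uIoc_subset_uIcc hz)) (abs_nonneg _)
  have hB : 0 ≤ B := (abs_nonneg _).trans (ha x left_mem_uIcc)
  rwa [intervalIntegral.integral_const_mul, abs_mul, abs_of_nonneg hB] at h1

/-- Uniqueness for the homogeneous Goursat problem. -/
theorem IsDiagonalSolution.eqOn_zero {J₁ J₂ : Set ℝ} (h₁ : IsOpen J₁) (h₁' : J₁.OrdConnected)
    (h₂ : IsOpen J₂) (h₂' : J₂.OrdConnected)
    {μ₁ μ₂ : Plane → ℝ} (hμ₁ : ContDiffOn ℝ 1 μ₁ (J₁ ×ˢ J₂)) (hμ₂ : ContDiffOn ℝ 1 μ₂ (J₁ ×ˢ J₂))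
    (hne : ∀ p ∈ J₁ ×ˢ J₂, μ₁ p ≠ μ₂ p) {s₀ t₀ : ℝ} (hs₀ : s₀ ∈ J₁) (ht₀ : t₀ ∈ J₂)
    {φ ψ : Plane → ℝ} (h : IsDiagonalSolution μ₁ μ₂ (J₁ ×ˢ J₂) φ ψ)
    (hφ : ∀ t ∈ J₂, ψ (s₀, t) - μ₁ (s₀, t) * φ (s₀, t) = 0)
    (hψ : ∀ s ∈ J₁, ψ (s, t₀) - μ₂ (s, t₀) * φ (s, t₀) = 0) :
    ∀ p ∈ J₁ ×ˢ J₂, φ p = 0 ∧ ψ p = 0 := by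
  have hD : IsOpen (J₁ ×ˢ J₂) := h₁.prod h₂
  have cφ := h.smooth_fst.continuousOn
  have cμ₁ := continuousOn_fderiv_apply_of_contDiffOn hD hμ₁ (1, 0)
  have cμ₂ := continuousOn_fderiv_apply_of_contDiffOn hD hμ₂ (0, 1)
  -- Both combinations have derivatives that involve φ without derivatives of φ. With zero data they
  -- are integrals of φ, and their difference is (μ₂ - μ₁) φ; this closes a Gronwall estimate for φ
  -- alone.
  have i₁ : ∀ p ∈ J₁ ×ˢ J₂, ψ p - μ₁ p * φ p =
      ∫ σ in s₀..p.1, -fderiv ℝ μ₁ (σ, p.2) (1, 0) * φ (σ, p.2) := by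
    intro p hp
    have hu : ∀ σ ∈ uIcc s₀ p.1, (σ, p.2) ∈ J₁ ×ˢ J₂ := fun σ hσ =>
      ⟨h₁'.uIcc_subset hs₀ hp.1 hσ, hp.2⟩
    rw [integral_eq_sub_of_hasDerivAt
      (f := fun σ => ψ (σ, p.2) - μ₁ (σ, p.2) * φ (σ, p.2)) (fun σ hσ => h.hasDerivAt_fst hD hμ₁ (hu σ hσ)), hφ _ hp.2, sub_zero]
    exact ((cμ₁.neg.mul cφ).comp (by fun_prop) hu).intervalIntegrable
  have i₂ : ∀ p ∈ J₁ ×ˢ J₂, ψ p - μ₂ p * φ p =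
      ∫ τ in t₀..p.2, -fderiv ℝ μ₂ (p.1, τ) (0, 1) * φ (p.1, τ) := by
    intro p hp
    have hu : ∀ τ ∈ uIcc t₀ p.2, (p.1, τ) ∈ J₁ ×ˢ J₂ := fun σ hσ =>
      ⟨hp.1, h₂'.uIcc_subset ht₀ hp.2 hσ⟩
    rw [integral_eq_sub_of_hasDerivAt
      (f := fun τ => ψ (p.1, τ) - μ₂ (p.1, τ) * φ (p.1, τ)) (fun σ hσ => h.hasDerivAt_snd hD hμ₂ (hu σ hσ)), hψ _ hp.1, sub_zero]
    exact ((cμ₂.neg.mul cφ).comp (by fun_prop) hu).intervalIntegrable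
  have zero : ∀ p ∈ J₁ ×ˢ J₂, φ p = 0 := by
    intro p hp
    obtain ⟨K, hs, hKc, hKn, hKd⟩ := exists_dependenceDomain_cross h₁ h₁' h₂ h₂' hs₀ ht₀ hp
    obtain ⟨B₁, hB₁⟩ := hKc.exists_bound_of_continuousOn (cμ₁.neg.mono hs)
    obtain ⟨B₂, hB₂⟩ := hKc.exists_bound_of_continuousOn (cμ₂.neg.mono hs)
    obtain ⟨B₃, hB₃⟩ := hKc.exists_bound_of_continuousOn (f := fun p => (μ₂ p - μ₁ p)⁻¹)
      (((hμ₂.continuousOn.sub hμ₁.continuousOn).mono hs).inv₀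
        fun p hp => sub_ne_zero.2 (hne p (hs hp)).symm)
    refine hKd.eq_zero_of_le hKc (by fun_prop) (cφ.mono hs) (C := |B₃| * (|B₁| + |B₂|))
      (fun q hq => ?_) (mem_of_mem_nhds hKn)
    have hqD := hs hq
    have e1 : φ q = (μ₂ q - μ₁ q)⁻¹ * ((ψ q - μ₁ q * φ q) - (ψ q - μ₂ q * φ q)) := by
      have : μ₂ q - μ₁ q ≠ 0 := sub_ne_zero.2 (hne q hqD).symm
      field_simp
      ring
    have b1 := abs_integral_mul_le (a := fun σ => -fderiv ℝ μ₁ (σ, q.2) (1, 0))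
      (e := fun σ => φ (σ, q.2)) (x := s₀) (y := q.1) (B := |B₁|)
      (fun σ hσ => (hB₁ _ (hKd.horizontal q hq σ hσ).1).trans (le_abs_self _))
      (cφ.comp (by fun_prop) fun σ hσ => hs (hKd.horizontal q hq σ hσ).1)
    have b2 := abs_integral_mul_le (a := fun τ => -fderiv ℝ μ₂ (q.1, τ) (0, 1))
      (e := fun τ => φ (q.1, τ)) (x := t₀) (y := q.2) (B := |B₂|)
      (fun σ hσ => (hB₂ _ (hKd.vertical q hq σ hσ).1).trans (le_abs_self _))
      (cφ.comp (by fun_prop) fun σ hσ => hs (hKd.vertical q hq σ hσ).1)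
    rw [← i₁ q hqD] at b1
    rw [← i₂ q hqD] at b2
    have b3 : |(μ₂ q - μ₁ q)⁻¹| ≤ |B₃| := (hB₃ q hq).trans (le_abs_self _)
    rw [e1, abs_mul]
    set x := |(∫ σ in s₀..q.1, |φ (σ, q.2)|)|
    set y := |(∫ τ in t₀..q.2, |φ (q.1, τ)|)|
    calc _ ≤ |B₃| * (|B₁| * x + |B₂| * y) := by
          refine mul_le_mul b3 ((abs_sub _ _).trans (add_le_add b1 b2)) (abs_nonneg _)
            (abs_nonneg _)
      _ ≤ |B₃| * ((|B₁| + |B₂|) * (x + y)) := by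
          refine mul_le_mul_of_nonneg_left ?_ (abs_nonneg _)
          have : 0 ≤ |B₁| * y + |B₂| * x := by positivity
          linarith
      _ = _ := by ring
  intro p hp
  refine ⟨zero p hp, ?_⟩
  have e1 := i₁ p hp
  rw [integral_congr (g := fun _ => (0 : ℝ)) fun σ hσ => by
    simp only [zero (σ, p.2) ⟨h₁'.uIcc_subset hs₀ hp.1 hσ, hp.2⟩, mul_zero], zero p hp] at e1
  simpa using e1

/-- Uniqueness for the Goursat problem. -/
theorem IsDiagonalSolution.eqOn {J₁ J₂ : Set ℝ} (h₁ : IsOpen J₁) (h₁' : J₁.OrdConnected)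
    (h₂ : IsOpen J₂) (h₂' : J₂.OrdConnected)
    {μ₁ μ₂ : Plane → ℝ} (hμ₁ : ContDiffOn ℝ 1 μ₁ (J₁ ×ˢ J₂)) (hμ₂ : ContDiffOn ℝ 1 μ₂ (J₁ ×ˢ J₂))
    (hne : ∀ p ∈ J₁ ×ˢ J₂, μ₁ p ≠ μ₂ p) {s₀ t₀ : ℝ} (hs₀ : s₀ ∈ J₁) (ht₀ : t₀ ∈ J₂)
    {φ ψ φ' ψ' : Plane → ℝ} (h : IsDiagonalSolution μ₁ μ₂ (J₁ ×ˢ J₂) φ ψ)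
    (h' : IsDiagonalSolution μ₁ μ₂ (J₁ ×ˢ J₂) φ' ψ')
    (hφ : ∀ t ∈ J₂, ψ (s₀, t) - μ₁ (s₀, t) * φ (s₀, t) =
      ψ' (s₀, t) - μ₁ (s₀, t) * φ' (s₀, t))
    (hψ : ∀ s ∈ J₁, ψ (s, t₀) - μ₂ (s, t₀) * φ (s, t₀) =
      ψ' (s, t₀) - μ₂ (s, t₀) * φ' (s, t₀)) :
    EqOn φ φ' (J₁ ×ˢ J₂) ∧ EqOn ψ ψ' (J₁ ×ˢ J₂) := by
  have := (h.sub h' (h₁.prod h₂)).eqOn_zero h₁ h₁' h₂ h₂' hμ₁ hμ₂ hne hs₀ ht₀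
    (fun t ht => by have := hφ t ht; simp only [Pi.sub_apply]; linarith)
    (fun s hs => by have := hψ s hs; simp only [Pi.sub_apply]; linarith)
  exact ⟨fun p hp => sub_eq_zero.1 (this p hp).1, fun p hp => sub_eq_zero.1 (this p hp).2⟩

end QuasiHyp

namespace QuasiHyp

open Set Filter Topology MeasureTheory intervalIntegral

/-! ### The linear Cauchy problem and Riemann's representation -/

/-- A function of `(r₁, r₂)` along `r₁ = r₁(t)`, `r₂ = r₂(s)`, as a function of `(s, t)`. -/
def pullback (r₁ r₂ : ℝ → ℝ) (Λ : Plane → ℝ) (p : Plane) : ℝ := Λ (r₁ p.2, r₂ p.1)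

section Pullback

variable {I J₁ J₂ : Set ℝ} {r₁ r₂ : ℝ → ℝ} {Λ : Plane → ℝ}

theorem hasDerivAt_of_contDiffOn {E : Type*} [NormedAddCommGroup E] [NormedSpace ℝ E] {r : ℝ → E}
    (hI : IsOpen I) (hr : ContDiffOn ℝ 1 r I) {t : ℝ} (ht : t ∈ I) : HasDerivAt r (deriv r t) t :=
  ((hr.differentiableOn one_ne_zero).differentiableAt (hI.mem_nhds ht)).hasDerivAt

theorem mapsTo_pullback (hm₁ : MapsTo r₁ I J₁) (hm₂ : MapsTo r₂ I J₂) :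
    MapsTo (fun p : Plane => (r₁ p.2, r₂ p.1)) (I ×ˢ I) (J₁ ×ˢ J₂) :=
  fun _ hp => ⟨hm₁ hp.2, hm₂ hp.1⟩

theorem contDiffOn_pullback (hr₁ : ContDiffOn ℝ 1 r₁ I) (hr₂ : ContDiffOn ℝ 1 r₂ I)
    (hm₁ : MapsTo r₁ I J₁) (hm₂ : MapsTo r₂ I J₂) (hΛ : ContDiffOn ℝ 1 Λ (J₁ ×ˢ J₂)) :
    ContDiffOn ℝ 1 (pullback r₁ r₂ Λ) (I ×ˢ I) := by
  refine hΛ.comp (f := fun p : Plane => (r₁ p.2, r₂ p.1)) ?_ (mapsTo_pullback hm₁ hm₂)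
  exact (hr₁.comp contDiff_snd.contDiffOn fun p hp => hp.2).prodMk
    (hr₂.comp contDiff_fst.contDiffOn fun p hp => hp.1)

/-- The order of the variables is exchanged: r₁ depends on the second parameter, so the t-derivative
meets ∂/∂r₁. The factor `deriv r₁` may vanish. -/
theorem fderiv_pullback_snd (hI : IsOpen I) (h₁ : IsOpen J₁) (h₂ : IsOpen J₂)
    (hr₁ : ContDiffOn ℝ 1 r₁ I) (hr₂ : ContDiffOn ℝ 1 r₂ I)
    (hm₁ : MapsTo r₁ I J₁) (hm₂ : MapsTo r₂ I J₂) (hΛ : ContDiffOn ℝ 1 Λ (J₁ ×ˢ J₂)) {p : Plane}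
    (hp : p ∈ I ×ˢ I) : fderiv ℝ (pullback r₁ r₂ Λ) p (0, 1) =
      fderiv ℝ Λ (r₁ p.2, r₂ p.1) (1, 0) * deriv r₁ p.2 := by
  have e1 := hasDerivAt_snd_linForm (hasFDerivAt_of_contDiffOn (hI.prod hI)
    (contDiffOn_pullback hr₁ hr₂ hm₁ hm₂ hΛ) hp)
  have e2 := hasDerivAt_fst_linForm (hasFDerivAt_of_contDiffOn (h₁.prod h₂) hΛ
    (mapsTo_pullback hm₁ hm₂ hp))
  exact e1.unique (e2.comp p.2 (hasDerivAt_of_contDiffOn hI hr₁ hp.2))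

theorem fderiv_pullback_fst (hI : IsOpen I) (h₁ : IsOpen J₁) (h₂ : IsOpen J₂)
    (hr₁ : ContDiffOn ℝ 1 r₁ I) (hr₂ : ContDiffOn ℝ 1 r₂ I)
    (hm₁ : MapsTo r₁ I J₁) (hm₂ : MapsTo r₂ I J₂) (hΛ : ContDiffOn ℝ 1 Λ (J₁ ×ˢ J₂)) {p : Plane}
    (hp : p ∈ I ×ˢ I) : fderiv ℝ (pullback r₁ r₂ Λ) p (1, 0) =
      fderiv ℝ Λ (r₁ p.2, r₂ p.1) (0, 1) * deriv r₂ p.1 := by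
  have e1 := hasDerivAt_fst_linForm (hasFDerivAt_of_contDiffOn (hI.prod hI)
    (contDiffOn_pullback hr₁ hr₂ hm₁ hm₂ hΛ) hp)
  have e2 := hasDerivAt_snd_linForm (hasFDerivAt_of_contDiffOn (h₁.prod h₂) hΛ
    (mapsTo_pullback hm₁ hm₂ hp))
  exact e1.unique (e2.comp p.1 (hasDerivAt_of_contDiffOn hI hr₂ hp.1))

end Pullback

/-- Existence for the Cauchy problem with data on the diagonal. -/
theorem exists_cauchy {I : Set ℝ} (hI : IsOpen I) (hI' : I.OrdConnected) {μ₁ μ₂ : Plane → ℝ}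
    (hμ₁ : ContDiffOn ℝ 1 μ₁ (I ×ˢ I)) (hμ₂ : ContDiffOn ℝ 1 μ₂ (I ×ˢ I))
    (hne : ∀ p ∈ I ×ˢ I, μ₁ p ≠ μ₂ p) {γ : ℝ → Plane} (hγ : ContDiffOn ℝ 1 γ I)
    (hn₁ : ∀ τ ∈ I, (deriv γ τ).2 ≠ μ₁ (τ, τ) * (deriv γ τ).1)
    (hn₂ : ∀ τ ∈ I, (deriv γ τ).2 ≠ μ₂ (τ, τ) * (deriv γ τ).1) {τ₀ : ℝ} (hτ₀ : τ₀ ∈ I) :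
    ∃ ξ η m X Y : Plane → ℝ, IsHodograph μ₁ μ₂ (I ×ˢ I) ξ η m X Y ∧
      ∀ τ ∈ I, (X (τ, τ), Y (τ, τ)) = γ τ ∧ ξ (τ, τ) ≠ 0 ∧ η (τ, τ) ≠ 0 := by
  have cγ : ContinuousOn (deriv γ) I := hγ.continuousOn_deriv_of_isOpen hI le_rfl
  have diag : MapsTo (fun τ : ℝ => (τ, τ)) I (I ×ˢ I) := fun τ hτ => ⟨hτ, hτ⟩
  have c₁ : ContinuousOn (fun τ => μ₁ (τ, τ)) I := hμ₁.continuousOn.comp (by fun_prop) diag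
  have c₂ : ContinuousOn (fun τ => μ₂ (τ, τ)) I := hμ₂.continuousOn.comp (by fun_prop) diag
  have hd : ∀ τ ∈ I, μ₁ (τ, τ) - μ₂ (τ, τ) ≠ 0 := fun τ hτ => sub_ne_zero.2 (hne _ (diag hτ))
  -- On the diagonal ξ + η = x' and μ₁ ξ + μ₂ η = y'; the data are the solution of these two
  -- equations. Their numerators are nonzero exactly because the curve is noncharacteristic.
  obtain ⟨ξ, η, m, X, Y, h, hX, hY, hξ, hη⟩ := exists_hodograph hI hI' hI hI'
    (α := fun t => t) (β := fun s => s) continuousOn_id (mapsTo_id _) continuousOn_id (mapsTo_id _)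
    (w := fun p => |p.1 - p.2|) (by fun_prop)
    (fun p hp => exists_dependenceDomain_diagonal hI hI' hp) hμ₁ hμ₂ hne
    (ξ₀ := fun τ => ((deriv γ τ).2 - μ₂ (τ, τ) * (deriv γ τ).1) / (μ₁ (τ, τ) - μ₂ (τ, τ)))
    ((cγ.snd.sub (c₂.mul cγ.fst)).div (c₁.sub c₂) hd)
    (η₀ := fun τ => -((deriv γ τ).2 - μ₁ (τ, τ) * (deriv γ τ).1) / (μ₁ (τ, τ) - μ₂ (τ, τ)))
    ((cγ.snd.sub (c₁.mul cγ.fst)).neg.div (c₁.sub c₂) hd) (p₀ := (τ₀, τ₀)) (diag hτ₀)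
    (γ τ₀).1 (γ τ₀).2
  have hdiag : ∀ τ : ℝ, HasDerivAt (fun τ : ℝ => (τ, τ)) ((1, 1) : Plane) τ := fun τ =>
    (hasDerivAt_id τ).prodMk (hasDerivAt_id τ)
  have eX : EqOn (fun τ => X (τ, τ)) (fun τ => (γ τ).1) I := by
    refine eqOn_of_hasDerivAt_eq hI hI' (fun τ hτ => ?_)
      (fun τ hτ => (hasDerivAt_of_contDiffOn hI hγ hτ).fst) hτ₀ hX
    refine (hasDerivAt_comp_linForm (c := fun τ => (τ, τ)) (h.deriv_X _ (diag hτ))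
      (hdiag τ)).congr_deriv ?_
    have := hd τ hτ
    rw [hξ τ hτ, hη τ hτ]
    field_simp
    ring
  have eY : EqOn (fun τ => Y (τ, τ)) (fun τ => (γ τ).2) I := by
    refine eqOn_of_hasDerivAt_eq hI hI' (fun τ hτ => ?_)
      (fun τ hτ => (hasDerivAt_of_contDiffOn hI hγ hτ).snd) hτ₀ hY
    refine (hasDerivAt_comp_linForm (c := fun τ => (τ, τ)) (h.deriv_Y _ (diag hτ))
      (hdiag τ)).congr_deriv ?_
    have := hd τ hτ
    rw [hξ τ hτ, hη τ hτ]
    field_simp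
    ring
  refine ⟨ξ, η, m, X, Y, h, fun τ hτ => ⟨Prod.ext (eX hτ) (eY hτ), ?_, ?_⟩⟩
  · rw [hξ τ hτ]
    exact div_ne_zero (sub_ne_zero.2 (hn₂ τ hτ)) (hd τ hτ)
  · rw [hη τ hτ]
    exact div_ne_zero (neg_ne_zero.2 (sub_ne_zero.2 (hn₁ τ hτ))) (hd τ hτ)

/-- Riemann's representation of the solution of the Cauchy problem by solutions of Goursat
problems. -/
theorem IsHodograph.eq_sub_integral {I J₁ J₂ : Set ℝ} (hI : IsOpen I) (hI' : I.OrdConnected)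
    (h₁ : IsOpen J₁) (h₂ : IsOpen J₂) {r₁ r₂ : ℝ → ℝ} {Λ₁ Λ₂ : Plane → ℝ}
    (hr₁ : ContDiffOn ℝ 1 r₁ I) (hr₂ : ContDiffOn ℝ 1 r₂ I)
    (hm₁ : MapsTo r₁ I J₁) (hm₂ : MapsTo r₂ I J₂) (hΛ₁ : ContDiffOn ℝ 1 Λ₁ (J₁ ×ˢ J₂))
    (hΛ₂ : ContDiffOn ℝ 1 Λ₂ (J₁ ×ˢ J₂)) {ξ η m X Y : Plane → ℝ}
    (h : IsHodograph (pullback r₁ r₂ Λ₁) (pullback r₁ r₂ Λ₂) (I ×ˢ I) ξ η m X Y)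
    {γ : ℝ → Plane} (hγ : ContDiffOn ℝ 1 γ I) (hdiag : ∀ τ ∈ I, (X (τ, τ), Y (τ, τ)) = γ τ)
    {φ ψ : Plane → ℝ} (hφψ : IsDiagonalSolution Λ₁ Λ₂ (J₁ ×ˢ J₂) φ ψ) {s t : ℝ} (hs : s ∈ I)
    (ht : t ∈ I) {Z : ℝ → ℝ}
    (hZ : ∀ σ ∈ I, HasDerivAt Z
      ((ψ (r₁ t, r₂ σ) - Λ₁ (r₁ t, r₂ σ) * φ (r₁ t, r₂ σ)) * ξ (σ, t)) σ)
    (hq : ∀ τ ∈ I, ψ (r₁ τ, r₂ s) - Λ₂ (r₁ τ, r₂ s) * φ (r₁ τ, r₂ s) = 0) :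
    Z s = Z t - ∫ τ in s..t, (ψ (r₁ τ, r₂ τ) * (deriv γ τ).1 - φ (r₁ τ, r₂ τ) * (deriv γ τ).2) := by
  have hD : IsOpen (J₁ ×ˢ J₂) := h₁.prod h₂
  have mp := mapsTo_pullback hm₁ hm₂
  -- In the variables (s, t) the form ψ dX - φ dY is P ξ ds + Q η dt.
  set P : Plane → ℝ := pullback r₁ r₂ fun r => ψ r - Λ₁ r * φ r
  set Q : Plane → ℝ := pullback r₁ r₂ fun r => ψ r - Λ₂ r * φ r
  have cp : ContinuousOn P (I ×ˢ I) := (contDiffOn_pullback hr₁ hr₂ hm₁ hm₂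
    (hφψ.smooth_snd.sub (hΛ₁.mul hφψ.smooth_fst))).continuousOn
  have cq : ContinuousOn Q (I ×ˢ I) := (contDiffOn_pullback hr₁ hr₂ hm₁ hm₂
    (hφψ.smooth_snd.sub (hΛ₂.mul hφψ.smooth_fst))).continuousOn
  have cφ : ContinuousOn (pullback r₁ r₂ φ) (I ×ˢ I) :=
    (contDiffOn_pullback hr₁ hr₂ hm₁ hm₂ hφψ.smooth_fst).continuousOn
  have dp : ∀ p ∈ I ×ˢ I, HasDerivAt (fun τ => P (p.1, τ))
      (-fderiv ℝ (pullback r₁ r₂ Λ₁) p (0, 1) * pullback r₁ r₂ φ p) p.2 := by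
    intro p hp
    refine ((hφψ.hasDerivAt_fst hD hΛ₁ (mp hp)).comp p.2
      (hasDerivAt_of_contDiffOn hI hr₁ hp.2)).congr_deriv ?_
    rw [fderiv_pullback_snd hI h₁ h₂ hr₁ hr₂ hm₁ hm₂ hΛ₁ hp, pullback]
    ring
  have dq : ∀ p ∈ I ×ˢ I, HasDerivAt (fun σ => Q (σ, p.2))
      (-fderiv ℝ (pullback r₁ r₂ Λ₂) p (1, 0) * pullback r₁ r₂ φ p) p.1 := by
    intro p hp
    refine ((hφψ.hasDerivAt_snd hD hΛ₂ (mp hp)).comp p.1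
      (hasDerivAt_of_contDiffOn hI hr₂ hp.1)).congr_deriv ?_
    rw [fderiv_pullback_fst hI h₁ h₂ hr₁ hr₂ hm₁ hm₂ hΛ₂ hp, pullback]
    ring
  have cμ := continuousOn_fderiv_apply_of_contDiffOn (hI.prod hI)
    (contDiffOn_pullback hr₁ hr₂ hm₁ hm₂ hΛ₁) (0, 1)
  -- The form is closed: in (P ξ)_t = (Q η)_s the terms with m differ by (Q - P) m = (μ₁ - μ₂) φ m,
  -- which is φ times the compatibility relation.
  obtain ⟨W, -, hW⟩ := exists_potential hI hI' hI hI' (F := fun p => P p * ξ p)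
    (G := fun p => Q p * η p)
    (m := fun p => -fderiv ℝ (pullback r₁ r₂ Λ₁) p (0, 1) * pullback r₁ r₂ φ p * ξ p + P p * m p)
    (cp.mul h.continuousOn_ξ) (cq.mul h.continuousOn_η)
    (((cμ.neg.mul cφ).mul h.continuousOn_ξ).add (cp.mul h.continuousOn_m))
    (fun s hs t ht => (dp (s, t) ⟨hs, ht⟩).mul (h.deriv_ξ (s, t) ⟨hs, ht⟩))
    (fun s hs t ht => ((dq (s, t) ⟨hs, ht⟩).mul (h.deriv_η (s, t) ⟨hs, ht⟩)).congr_deriv (by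
      have e := h.compat (s, t) ⟨hs, ht⟩
      simp only [P, Q, pullback] at e ⊢
      linear_combination φ (r₁ t, r₂ s) * e)) (p₀ := (s, t)) ⟨hs, ht⟩ 0
  -- The triangle (s, s), (s, t), (t, t): on the horizontal side dW is dZ by hypothesis, on the
  -- vertical side Q vanishes, and on the diagonal dW is the integrand over the initial curve.
  have e1 : W (t, t) - W (s, t) = Z t - Z s := by
    have : EqOn (fun σ => W (σ, t) - W (s, t)) (fun σ => Z σ - Z s) I :=
      eqOn_of_hasDerivAt_eq hI hI'
        (fun σ hσ => (hasDerivAt_fst_linForm (hW (σ, t) ⟨hσ, ht⟩)).sub_const _)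
        (fun σ hσ => (hZ σ hσ).sub_const _) hs (by simp)
    exact this ht
  have e2 : W (s, t) = W (s, s) := by
    have : EqOn (fun τ => W (s, τ)) (fun _ => W (s, s)) I :=
      eqOn_of_hasDerivAt_eq hI hI' (fun τ hτ => hasDerivAt_snd_linForm (hW (s, τ) ⟨hs, hτ⟩))
        (fun τ hτ => (hasDerivAt_const τ _).congr_deriv (by
          simp only [Q, pullback, hq τ hτ, zero_mul])) hs rfl
    exact this ht
  have hdg : ∀ τ : ℝ, HasDerivAt (fun τ : ℝ => (τ, τ)) ((1, 1) : Plane) τ := fun τ =>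
    (hasDerivAt_id τ).prodMk (hasDerivAt_id τ)
  have e3 : ∫ τ in s..t, (ψ (r₁ τ, r₂ τ) * (deriv γ τ).1 - φ (r₁ τ, r₂ τ) * (deriv γ τ).2) =
      W (t, t) - W (s, s) := by
    refine integral_eq_sub_of_hasDerivAt (f := fun τ => W (τ, τ)) (fun τ hτ => ?_) ?_
    · have hτI := hI'.uIcc_subset hs ht hτ
      have hp : (τ, τ) ∈ I ×ˢ I := ⟨hτI, hτI⟩
      refine (hasDerivAt_comp_linForm (c := fun τ => (τ, τ)) (hW _ hp) (hdg τ)).congr_deriv ?_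
      have d0 := hasDerivAt_of_contDiffOn hI hγ hτI
      have ev : ∀ᶠ z in 𝓝 τ, γ z = (X (z, z), Y (z, z)) := by
        filter_upwards [hI.mem_nhds hτI] with z hz using (hdiag z hz).symm
      have d1 : HasDerivAt (fun z => X (z, z)) (deriv γ τ).1 τ :=
        HasDerivAt.congr_of_eventuallyEq d0.fst (ev.mono fun z hz => by simp only [hz])
      have d2 : HasDerivAt (fun z => Y (z, z)) (deriv γ τ).2 τ :=
        HasDerivAt.congr_of_eventuallyEq d0.snd (ev.mono fun z hz => by simp only [hz])
      have d3 := d1.unique (hasDerivAt_comp_linForm (c := fun τ => (τ, τ)) (h.deriv_X _ hp) (hdg τ))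
      have d4 := d2.unique (hasDerivAt_comp_linForm (c := fun τ => (τ, τ)) (h.deriv_Y _ hp) (hdg τ))
      rw [d3, d4]
      simp only [P, Q, pullback]
      ring
    · have cγ : ContinuousOn (deriv γ) I := hγ.continuousOn_deriv_of_isOpen hI le_rfl
      have mr : MapsTo (fun τ => (r₁ τ, r₂ τ)) I (J₁ ×ˢ J₂) := fun τ hτ => ⟨hm₁ hτ, hm₂ hτ⟩
      have cr : ContinuousOn (fun τ => (r₁ τ, r₂ τ)) I :=
        hr₁.continuousOn.prodMk hr₂.continuousOn
      refine ContinuousOn.intervalIntegrable (ContinuousOn.mono ?_ (hI'.uIcc_subset hs ht))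
      exact ((hφψ.smooth_snd.continuousOn.comp cr mr).mul cγ.fst).sub
        ((hφψ.smooth_fst.continuousOn.comp cr mr).mul cγ.snd)
  rw [e3, ← e2, e1]
  ring

end QuasiHyp

namespace QuasiHyp

open Set Filter Topology

/-! ### Closed forms on simply connected sets -/

/-- Data for the covering of `B` by the germs of local primitives `f i` on the open sets `S i`. -/
noncomputable def primitiveCore {B ι A : Type*} [TopologicalSpace B] [AddCommGroup A]
    [TopologicalSpace A]
    (S : ι → Set B) (hS : ∀ i, IsOpen (S i)) (ix : B → ι) (hix : ∀ x, x ∈ S (ix x))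
    (f : ι → B → A)
    (hf : ∀ i j, ContinuousOn (fun p : B × A => p.2 + (f i p.1 - f j p.1)) ((S i ∩ S j) ×ˢ univ)) :
    FiberBundleCore ι B A where
  baseSet := S
  isOpen_baseSet := hS
  indexAt := ix
  mem_baseSet_at := hix
  coordChange i j x v := v + (f i x - f j x)
  coordChange_self i x _ v := by simp
  continuousOn_coordChange := hf
  coordChange_comp i j k x _ v := by abel

/-- On a simply connected space, local functions that differ by locally constant functions can be
corrected by locally constant functions to a global function. -/
theorem exists_global_of_local {B : Type*} [TopologicalSpace B] [SimplyConnectedSpace B]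
    [LocallyPathConnectedSpace B] {ι A : Type*} [AddCommGroup A]
    (S : ι → Set B) (hS : ∀ i, IsOpen (S i))
    (hcov : ∀ x, ∃ i, x ∈ S i) (f : ι → B → A)
    (hf : ∀ i j, ∀ x ∈ S i ∩ S j, ∀ᶠ y in 𝓝 x, f i y - f j y = f i x - f j x) :
    ∃ W : B → A, ∀ i, ∀ x ∈ S i, ∀ᶠ y in 𝓝 x, W y - f i y = W x - f i x := by
  choose ix hix using hcov
  -- With discrete fibres the bundle is a covering, and continuity of a fibre coordinate means local
  -- constancy.
  let _ : TopologicalSpace A := ⊥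
  have : DiscreteTopology A := ⟨rfl⟩
  have hloc : ∀ i j, ContinuousOn (fun p : B × A => p.2 + (f i p.1 - f j p.1))
      ((S i ∩ S j) ×ˢ univ) := by
    intro i j p hp
    refine ContinuousAt.continuousWithinAt ?_
    have e : (fun q : B × A => q.2 + (f i q.1 - f j q.1)) =ᶠ[𝓝 p]
        fun q => (fun v => v + (f i p.1 - f j p.1)) q.2 := by
      have := (continuous_fst (X := B) (Y := A)).continuousAt.eventually (hf i j p.1 hp.1)
      filter_upwards [this] with q hq
      rw [hq]
    refine ContinuousAt.congr ?_ e.symm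
    exact (Continuous.comp (g := fun v : A => v + (f i p.1 - f j p.1))
      continuous_of_discreteTopology continuous_snd).continuousAt
  -- A point over x with coordinate v in chart i stands for the germ of f i + v. The identity lifts
  -- to this covering since the base is simply connected; evaluating the germs of the lift gives W.
  let Z := primitiveCore S hS ix hix f hloc
  have cov : IsCoveringMap Z.proj :=
    IsCoveringMap.mk _ (fun _ => A) (fun x => Z.localTriv (ix x)) fun x => hix x
  obtain ⟨b₀⟩ : Nonempty B := inferInstance
  obtain ⟨F, ⟨-, hF⟩, -⟩ := cov.existsUnique_continuousMap_lifts (ContinuousMap.id B) b₀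
    (⟨b₀, (0 : A)⟩ : Z.TotalSpace) rfl
  have hF' : ∀ x, (F x).1 = x := fun x => congrFun hF x
  refine ⟨fun x => (Z.localTriv (ix x) (F x)).2 + f (ix x) x, fun i x hx => ?_⟩
  have key : ∀ y ∈ S i, (Z.localTriv (ix y) (F y)).2 + f (ix y) y - f i y =
      (Z.localTriv i (F y)).2 := by
    intro y hy
    have h1 : (Z.localTriv i (F y)).2 =
        (show A from (F y).2) + (f (ix (F y).1) (F y).1 - f i (F y).1) := rfl
    have h2 : (Z.localTriv (ix y) (F y)).2 =
        (show A from (F y).2) + (f (ix (F y).1) (F y).1 - f (ix y) (F y).1) := rfl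
    rw [h1, h2, hF']
    abel
  have hc : ContinuousAt (fun y => (Z.localTriv i (F y)).2) x := by
    have : ContinuousAt (Z.localTriv i) (F x) := by
      refine (Z.localTriv i).continuousAt ?_
      rw [FiberBundleCore.mem_localTriv_source, hF']
      exact hx
    exact (this.comp F.continuous.continuousAt).snd
  have hc' : ∀ᶠ y in 𝓝 x, (Z.localTriv i (F y)).2 = (Z.localTriv i (F x)).2 := by
    have := hc.eventually (IsOpen.mem_nhds (isOpen_discrete {(Z.localTriv i (F x)).2}) rfl)
    exact this
  filter_upwards [hc', (hS i).mem_nhds hx] with y hy hyS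
  rw [key y hyS, key x hx, hy]

/-- The Poincaré lemma for `1`-forms on a simply connected open set. -/
theorem exists_primitive_of_simplyConnected {G : Set Plane} (hG : IsOpen G)
    [SimplyConnectedSpace G] {ω : Plane → Plane →L[ℝ] ℝ} (hω : DifferentiableOn ℝ ω G)
    (hcl : ∀ a ∈ G, ∀ x y, fderiv ℝ ω a x y = fderiv ℝ ω a y x) :
    ∃ W : Plane → ℝ, ∀ a ∈ G, HasFDerivAt W (ω a) a := by
  have hball : ∀ x : G, ∃ ε > 0, Metric.ball (x : Plane) ε ⊆ G :=
    fun x => Metric.isOpen_iff.1 hG x x.2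
  choose ε hε hεG using hball
  have hloc : ∀ x : G, ∃ f : Plane → ℝ, ∀ a ∈ Metric.ball (x : Plane) (ε x),
      HasFDerivAt f (ω a) a := fun x =>
    (convex_ball _ _).exists_forall_hasFDerivAt_of_fderiv_symmetric Metric.isOpen_ball
      (hω.mono (hεG x)) fun a ha => hcl a (hεG x ha)
  choose f hf using hloc
  have : LocallyPathConnectedSpace G := hG.locallyPathConnectedSpace
  obtain ⟨W, hW⟩ := exists_global_of_local (B := G)
    (fun x : G => Subtype.val ⁻¹' Metric.ball (x : Plane) (ε x))
    (fun x => Metric.isOpen_ball.preimage continuous_subtype_val)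
    (fun x => ⟨x, Metric.mem_ball_self (hε x)⟩) (fun x y => f x y) (by
      intro i j x hx
      have hmem : Metric.ball (i : Plane) (ε i) ∩ Metric.ball (j : Plane) (ε j) ∈ 𝓝 (x : Plane) :=
        (Metric.isOpen_ball.inter Metric.isOpen_ball).mem_nhds hx
      obtain ⟨δ, hδ, hδs⟩ := Metric.mem_nhds_iff.1 hmem
      have hconst : ∀ y ∈ Metric.ball (x : Plane) δ, f i y - f j y = f i x - f j x := by
        intro y hy
        refine Metric.isOpen_ball.is_const_of_fderiv_eq_zero (𝕜 := ℝ) (f := fun z => f i z - f j z)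
          (convex_ball (x : Plane) δ).isPreconnected (fun z hz => ?_) (fun z hz => ?_) hy
          (Metric.mem_ball_self hδ)
        · exact ((hf i z (hδs hz).1).sub (hf j z (hδs hz).2)).differentiableAt.differentiableWithinAt
        · exact ((hf i z (hδs hz).1).sub (hf j z (hδs hz).2)).fderiv.trans (sub_self _)
      exact continuous_subtype_val.continuousAt.eventually
        (p := fun y : Plane => f i y - f j y = f i x - f j x)
        (by filter_upwards [Metric.ball_mem_nhds (x : Plane) hδ] with y hy using hconst y hy))
  classical
  refine ⟨fun a => if h : a ∈ G then W ⟨a, h⟩ else 0, fun a ha => ?_⟩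
  have h1 := hW ⟨a, ha⟩ ⟨a, ha⟩ (Metric.mem_ball_self (hε _))
  have h2 : ∀ᶠ y in 𝓝 a, (if h : y ∈ G then W ⟨y, h⟩ else 0) =
      f ⟨a, ha⟩ y + (W ⟨a, ha⟩ - f ⟨a, ha⟩ a) := by
    -- Neighbourhoods in the subtype are neighbourhoods in the plane, because G is open.
    have h3 := (IsOpenEmbedding.map_nhds_eq hG.isOpenEmbedding_subtypeVal ⟨a, ha⟩)
    have h4 : ∀ᶠ y in 𝓝 a, ∀ h : y ∈ G, W ⟨y, h⟩ - f ⟨a, ha⟩ y = W ⟨a, ha⟩ - f ⟨a, ha⟩ a := by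
      rw [← h3, eventually_map]
      exact h1.mono fun y hy h => hy
    filter_upwards [h4, hG.mem_nhds ha] with y hy hyG
    rw [dif_pos hyG, ← hy hyG]
    ring
  exact ((hf ⟨a, ha⟩ a (Metric.mem_ball_self (hε _))).add_const _).congr_of_eventuallyEq h2

end QuasiHyp

namespace QuasiHyp

open Set Filter Topology

/-! ### Riemann invariants as coordinates on the states -/

/-- An injective `C¹` map with invertible derivative has an open image and a `C¹` inverse. -/
theorem exists_contDiffOn_inverse {E F : Type*} [NormedAddCommGroup E] [NormedSpace ℝ E]
    [CompleteSpace E] [Nonempty E] [NormedAddCommGroup F] [NormedSpace ℝ F] {f : E → F} {Ω : Set E}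
    (hΩ : IsOpen Ω)
    (hf : ContDiffOn ℝ 1 f Ω) (hf' : ∀ u ∈ Ω, ∃ e : E ≃L[ℝ] F, HasFDerivAt f (e : E →L[ℝ] F) u)
    (hinj : InjOn f Ω) :
    IsOpen (f '' Ω) ∧ ∃ g : F → E, ContDiffOn ℝ 1 g (f '' Ω) ∧ ∀ u ∈ Ω, g (f u) = u := by
  set g := Function.invFunOn f Ω
  have hg : ∀ u ∈ Ω, g (f u) = u := fun u hu => hinj.leftInvOn_invFunOn hu
  have key : ∀ u ∈ Ω, f '' Ω ∈ 𝓝 (f u) ∧ ContDiffAt ℝ 1 g (f u) := by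
    intro u hu
    obtain ⟨e, he⟩ := hf' u hu
    have hfa : ContDiffAt ℝ 1 f u := hf.contDiffAt (hΩ.mem_nhds hu)
    set T := hfa.toOpenPartialHomeomorph f he one_ne_zero
    have hsrc : u ∈ T.source := hfa.mem_toOpenPartialHomeomorph_source he one_ne_zero
    have htgt : f u ∈ T.target := hfa.image_mem_toOpenPartialHomeomorph_target he one_ne_zero
    have hinv : ContDiffAt ℝ 1 (hfa.localInverse he one_ne_zero) (f u) :=
      hfa.to_localInverse he one_ne_zero
    have hval : hfa.localInverse he one_ne_zero (f u) = u :=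
      hfa.localInverse_apply_image he one_ne_zero
    have hmem : ∀ᶠ y in 𝓝 (f u), hfa.localInverse he one_ne_zero y ∈ Ω :=
      hinv.continuousAt.eventually (by rw [hval]; exact hΩ.mem_nhds hu)
    have hright : ∀ᶠ y in 𝓝 (f u), f (hfa.localInverse he one_ne_zero y) = y := by
      filter_upwards [T.open_target.mem_nhds htgt] with y hy
      exact T.right_inv hy
    refine ⟨?_, hinv.congr_of_eventuallyEq ?_⟩
    · filter_upwards [hmem, hright] with y h1 h2 using ⟨_, h1, h2⟩
    -- By injectivity the global inverse agrees near `f u` with the local one, and inherits its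
    -- smoothness.
    · filter_upwards [hmem, hright] with y h1 h2
      rw [← hg _ h1, h2]
  refine ⟨isOpen_iff_mem_nhds.2 ?_, g, ?_, hg⟩
  · rintro _ ⟨u, hu, rfl⟩
    exact (key u hu).1
  · rintro _ ⟨u, hu, rfl⟩
    exact (key u hu).2.contDiffWithinAt

section StateSpace

variable {A : State → Matrix (Fin 2) (Fin 2) ℝ} {lam : Fin 2 → State → ℝ} {Ω : Set State}
  {Φ : Fin 2 → State → ℝ} {J : Fin 2 → Set ℝ}

/-- The differentials of the two Riemann invariants are linearly independent. -/
theorem IsRiemannInvariants.eq_zero (hΦ : IsRiemannInvariants A lam Ω Φ J)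
    (hyp : StrictlyHyperbolic A lam Ω) {u : State} (hu : u ∈ Ω) {w : State}
    (h₀ : fderiv ℝ (Φ 0) u w = 0) (h₁ : fderiv ℝ (Φ 1) u w = 0) : w = 0 := by
  have expand : ∀ (f : State →L[ℝ] ℝ) (v : State),
      f v = f (Pi.single 0 1) * v 0 + f (Pi.single 1 1) * v 1 := by
    intro f v
    have : v = v 0 • (Pi.single 0 1 : State) + v 1 • (Pi.single 1 1 : State) := by
      ext i; fin_cases i <;> simp
    conv_lhs => rw [this]
    simp only [map_add, map_smul, smul_eq_mul]
    ring
  set f := fderiv ℝ (Φ 0) u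
  set g := fderiv ℝ (Φ 1) u
  by_contra hw
  -- A nonzero common null vector makes the two differentials proportional; two nonzero proportional
  -- left eigenvectors cannot belong to different eigenvalues.
  have hdet : f (Pi.single 0 1) * g (Pi.single 1 1) = f (Pi.single 1 1) * g (Pi.single 0 1) := by
    rw [expand f w] at h₀
    rw [expand g w] at h₁
    by_cases h : w 0 = 0
    · have h' : w 1 ≠ 0 := fun h' => hw (by ext i; fin_cases i <;> simpa)
      refine mul_right_cancel₀ h' ?_
      linear_combination f (Pi.single 0 1) * h₁ - g (Pi.single 0 1) * h₀
    · refine mul_right_cancel₀ h ?_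
      linear_combination g (Pi.single 1 1) * h₀ - f (Pi.single 1 1) * h₁
  have hprop : ∀ i, ∀ v, g (Pi.single i 1) * f v = f (Pi.single i 1) * g v := by
    intro i v
    rw [expand f v, expand g v]
    fin_cases i
    · simp only [Fin.zero_eta]
      linear_combination -(v 1) * hdet
    · simp only [Fin.mk_one]
      linear_combination (v 0) * hdet
  have hz : ∀ i, f (Pi.single i 1) * g (Pi.single i 1) = 0 := by
    intro i
    have e1 := hprop i ((A u).mulVec (Pi.single i 1))
    rw [hΦ.left_eigenvector 0 u hu, hΦ.left_eigenvector 1 u hu] at e1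
    have e2 : (lam 0 u - lam 1 u) * (f (Pi.single i 1) * g (Pi.single i 1)) = 0 := by
      simp only [f, g] at e1 ⊢
      linear_combination e1
    exact (mul_eq_zero.1 e2).resolve_left (sub_ne_zero.2 (hyp u hu).1)
  have hf0 : ∃ i, f (Pi.single i 1) ≠ 0 := by
    by_contra! h
    exact hΦ.ne_zero 0 u hu (by ext v; simp only [f] at h expand ⊢; rw [expand]; simp [h])
  obtain ⟨i, hi⟩ := hf0
  have hgi := (mul_eq_zero.1 (hz i)).resolve_left hi
  refine hΦ.ne_zero 1 u hu ?_
  ext v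
  have := hprop i v
  rw [hgi, zero_mul] at this
  exact (mul_eq_zero.1 this.symm).resolve_left hi

theorem IsRiemannInvariants.contDiffOn_one (hΦ : IsRiemannInvariants A lam Ω Φ J) (k : Fin 2) :
    ContDiffOn ℝ 1 (Φ k) Ω := (hΦ.smooth k).of_le (by norm_num)

theorem IsRiemannInvariants.hasFDerivAt (hΦ : IsRiemannInvariants A lam Ω Φ J) (hΩ : IsOpen Ω)
    (k : Fin 2) {u : State} (hu : u ∈ Ω) : HasFDerivAt (Φ k) (fderiv ℝ (Φ k) u) u :=
  (((hΦ.smooth k).differentiableOn two_ne_zero).differentiableAt (hΩ.mem_nhds hu)).hasFDerivAt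

/-- The eigenvalues are of class `C¹`. -/
theorem IsRiemannInvariants.contDiffOn_eigenvalue (hΦ : IsRiemannInvariants A lam Ω Φ J)
    (hΩ : IsOpen Ω) (hA : ∀ i j, ContDiffOn ℝ 2 (fun u => A u i j) Ω) (k : Fin 2) :
    ContDiffOn ℝ 1 (lam k) Ω := by
  have hd : ContDiffOn ℝ 1 (fun u => fderiv ℝ (Φ k) u) Ω :=
    (hΦ.smooth k).fderiv_of_isOpen hΩ (by norm_num)
  intro u hu
  -- Near `u` the eigenvalue is the quotient dΦ(A eᵢ) / dΦ(eᵢ) for an i with nonzero denominator.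
  have hex : ∃ i, fderiv ℝ (Φ k) u (Pi.single i 1) ≠ 0 := by
    by_contra! h
    refine hΦ.ne_zero k u hu ?_
    ext v
    have : v = v 0 • (Pi.single 0 1 : State) + v 1 • (Pi.single 1 1 : State) := by
      ext i; fin_cases i <;> simp
    rw [this, map_add, map_smul, map_smul, h, h]
    simp
  obtain ⟨i, hi⟩ := hex
  have hAi : ContDiffOn ℝ 1 (fun u => (A u).mulVec (Pi.single i 1)) Ω := by
    rw [contDiffOn_pi]
    intro j
    refine ((hA j i).of_le (by norm_num)).congr fun u _ => ?_
    rw [Matrix.mulVec_single_one]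
    rfl
  have hnum := (hd.clm_apply hAi).contDiffAt (hΩ.mem_nhds hu)
  have hden := (hd.clm_apply contDiffOn_const (g := fun _ => Pi.single i 1)).contDiffAt
    (hΩ.mem_nhds hu)
  refine ((hnum.div hden hi).congr_of_eventuallyEq ?_).contDiffWithinAt
  filter_upwards [hΩ.mem_nhds hu, hden.continuousAt.eventually_ne hi] with v hv hv'
  rw [Pi.div_apply, hΦ.left_eigenvector k v hv, mul_div_cancel_right₀ _ hv']

/-- `S` is the `C¹` inverse of the coordinates `(Φ 0, Φ 1)`, and the eigenvalues are of
class `C¹`. -/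
structure IsStateChart (lam : Fin 2 → State → ℝ) (Ω : Set State) (Φ : Fin 2 → State → ℝ)
    (J : Fin 2 → Set ℝ) (S : Plane → State) : Prop where
  smooth : ∀ k, ContDiffOn ℝ 1 (Φ k) Ω
  smooth_inv : ContDiffOn ℝ 1 S (J 0 ×ˢ J 1)
  mapsTo : MapsTo (riem Φ) Ω (J 0 ×ˢ J 1)
  mapsTo_inv : MapsTo S (J 0 ×ˢ J 1) Ω
  left_inv : ∀ u ∈ Ω, S (riem Φ u) = u
  right_inv : ∀ r ∈ J 0 ×ˢ J 1, riem Φ (S r) = r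
  smooth_eigenvalue : ∀ k, ContDiffOn ℝ 1 (lam k) Ω
  ne : ∀ u ∈ Ω, lam 0 u ≠ lam 1 u

/-- Independence of the two differentials makes the derivative of (Φ₁, Φ₂) invertible, so the
inverse function theorem upgrades the given bijection to a C¹ chart. -/
theorem IsRiemannInvariants.exists_stateChart (hΦ : IsRiemannInvariants A lam Ω Φ J)
    (hΩ : IsOpen Ω) (hA : ∀ i j, ContDiffOn ℝ 2 (fun u => A u i j) Ω)
    (hyp : StrictlyHyperbolic A lam Ω) : ∃ S, IsStateChart lam Ω Φ J S := by
  have hr : ContDiffOn ℝ 1 (riem Φ) Ω := (hΦ.contDiffOn_one 0).prodMk (hΦ.contDiffOn_one 1)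
  have hd : ∀ u ∈ Ω, ∃ e : State ≃L[ℝ] Plane, HasFDerivAt (riem Φ) (e : State →L[ℝ] Plane) u := by
    intro u hu
    set D : State →L[ℝ] Plane := (fderiv ℝ (Φ 0) u).prod (fderiv ℝ (Φ 1) u)
    have hD : HasFDerivAt (riem Φ) D u := (hΦ.hasFDerivAt hΩ 0 hu).prodMk (hΦ.hasFDerivAt hΩ 1 hu)
    have hinj : Function.Injective D.toLinearMap := by
      rw [← LinearMap.ker_eq_bot, LinearMap.ker_eq_bot']
      intro w hw
      exact hΦ.eq_zero hyp hu (congrArg Prod.fst hw) (congrArg Prod.snd hw)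
    exact ⟨(LinearMap.linearEquivOfInjective D.toLinearMap hinj
      (by simp)).toContinuousLinearEquiv, hD⟩
  obtain ⟨-, S, hS, hSl⟩ := exists_contDiffOn_inverse hΩ hr hd hΦ.bijOn.injOn
  rw [hΦ.bijOn.image_eq] at hS
  have hmem : ∀ r ∈ J 0 ×ˢ J 1, ∃ u ∈ Ω, riem Φ u = r := fun r hr => hΦ.bijOn.surjOn hr
  refine ⟨S, hΦ.contDiffOn_one, hS, hΦ.bijOn.mapsTo, fun r hr => ?_, hSl, fun r hr => ?_,
    hΦ.contDiffOn_eigenvalue hΩ hA, fun u hu => (hyp u hu).1⟩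
  · obtain ⟨u, hu, rfl⟩ := hmem r hr
    rwa [hSl u hu]
  · obtain ⟨u, hu, rfl⟩ := hmem r hr
    rw [hSl u hu]

/-- The eigenvalue as a function of the Riemann invariants. -/
theorem IsStateChart.contDiffOn_comp_inv {S : Plane → State} (hS : IsStateChart lam Ω Φ J S)
    (k : Fin 2) : ContDiffOn ℝ 1 (fun r => lam k (S r)) (J 0 ×ˢ J 1) :=
  (hS.smooth_eigenvalue k).comp hS.smooth_inv hS.mapsTo_inv

theorem IsStateChart.comp_inv_ne {S : Plane → State} (hS : IsStateChart lam Ω Φ J S) :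
    ∀ r ∈ J 0 ×ˢ J 1, lam 0 (S r) ≠ lam 1 (S r) := fun _ hr => hS.ne _ (hS.mapsTo_inv hr)

theorem IsStateChart.isLinearSolution_iff {S : Plane → State} (hS : IsStateChart lam Ω Φ J S)
    {φ ψ : Plane → ℝ} : IsLinearSolution lam Ω Φ J φ ψ ↔
      IsDiagonalSolution (fun r => lam 0 (S r)) (fun r => lam 1 (S r)) (J 0 ×ˢ J 1) φ ψ := by
  constructor
  · intro h
    refine ⟨h.smooth_fst, h.smooth_snd, fun r hr => ?_, fun r hr => ?_⟩
    · have := h.eq_one _ (hS.mapsTo_inv hr)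
      rwa [hS.right_inv r hr] at this
    · have := h.eq_two _ (hS.mapsTo_inv hr)
      rwa [hS.right_inv r hr] at this
  · intro h
    refine ⟨h.smooth_fst, h.smooth_snd, fun u hu => ?_, fun u hu => ?_⟩
    · have := h.eq_one _ (hS.mapsTo hu)
      simp only [hS.left_inv u hu] at this
      exact this
    · have := h.eq_two _ (hS.mapsTo hu)
      simp only [hS.left_inv u hu] at this
      exact this

/-- Passes from states to points of the box. The predicate takes both the state and its invariants
because the Goursat conditions combine eigenvalues at the one with φ, ψ at the other. -/
theorem IsStateChart.forall_on_one_iff {S : Plane → State} (hS : IsStateChart lam Ω Φ J S)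
    {r₀ : Plane} (hr₀ : r₀ ∈ J 0 ×ˢ J 1) {P : State → Plane → Prop} :
    (∀ u ∈ Ω, Φ 0 u = r₀.1 → P u (riem Φ u)) ↔ ∀ t ∈ J 1, P (S (r₀.1, t)) (r₀.1, t) := by
  constructor
  · intro h t ht
    have hr : (r₀.1, t) ∈ J 0 ×ˢ J 1 := ⟨hr₀.1, ht⟩
    have := h _ (hS.mapsTo_inv hr) (congrArg Prod.fst (hS.right_inv _ hr))
    rwa [hS.right_inv _ hr] at this
  · intro h u hu hu0
    have e : riem Φ u = (r₀.1, Φ 1 u) := by rw [← hu0]; rfl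
    have := h (Φ 1 u) (hS.mapsTo hu).2
    rwa [← e, hS.left_inv u hu] at this

theorem IsStateChart.forall_on_two_iff {S : Plane → State} (hS : IsStateChart lam Ω Φ J S)
    {r₀ : Plane} (hr₀ : r₀ ∈ J 0 ×ˢ J 1) {P : State → Plane → Prop} :
    (∀ u ∈ Ω, Φ 1 u = r₀.2 → P u (riem Φ u)) ↔ ∀ s ∈ J 0, P (S (s, r₀.2)) (s, r₀.2) := by
  constructor
  · intro h t ht
    have hr : (t, r₀.2) ∈ J 0 ×ˢ J 1 := ⟨ht, hr₀.2⟩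
    have := h _ (hS.mapsTo_inv hr) (congrArg Prod.snd (hS.right_inv _ hr))
    rwa [hS.right_inv _ hr] at this
  · intro h u hu hu0
    have e : riem Φ u = (Φ 0 u, r₀.2) := by rw [← hu0]; rfl
    have := h (Φ 0 u) (hS.mapsTo hu).1
    rwa [← e, hS.left_inv u hu] at this

theorem IsStateChart.isGoursatX_iff {S : Plane → State} (hS : IsStateChart lam Ω Φ J S)
    {r₀ : Plane} (hr₀ : r₀ ∈ J 0 ×ˢ J 1) {φ ψ : Plane → ℝ} : IsGoursatX lam Ω Φ J r₀ φ ψ ↔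
      IsDiagonalSolution (fun r => lam 0 (S r)) (fun r => lam 1 (S r)) (J 0 ×ˢ J 1) φ ψ ∧
      (∀ t ∈ J 1, ψ (r₀.1, t) - lam 0 (S (r₀.1, t)) * φ (r₀.1, t) = 1) ∧
      ∀ s ∈ J 0, ψ (s, r₀.2) - lam 1 (S (s, r₀.2)) * φ (s, r₀.2) = 0 := by
  rw [← hS.isLinearSolution_iff, ← hS.forall_on_one_iff hr₀
    (P := fun u r => ψ r - lam 0 u * φ r = 1), ← hS.forall_on_two_iff hr₀
    (P := fun u r => ψ r - lam 1 u * φ r = 0)]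
  exact ⟨fun h => ⟨h.1, h.2, h.3⟩, fun h => ⟨h.1, h.2.1, h.2.2⟩⟩

theorem IsStateChart.isGoursatY_iff {S : Plane → State} (hS : IsStateChart lam Ω Φ J S)
    {r₀ : Plane} (hr₀ : r₀ ∈ J 0 ×ˢ J 1) {φ ψ : Plane → ℝ} : IsGoursatY lam Ω Φ J r₀ φ ψ ↔
      IsDiagonalSolution (fun r => lam 0 (S r)) (fun r => lam 1 (S r)) (J 0 ×ˢ J 1) φ ψ ∧
      (∀ t ∈ J 1, ψ (r₀.1, t) - lam 0 (S (r₀.1, t)) * φ (r₀.1, t) = lam 0 (S (r₀.1, t))) ∧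
      ∀ s ∈ J 0, ψ (s, r₀.2) - lam 1 (S (s, r₀.2)) * φ (s, r₀.2) = 0 := by
  rw [← hS.isLinearSolution_iff, ← hS.forall_on_one_iff hr₀
    (P := fun u r => ψ r - lam 0 u * φ r = lam 0 u), ← hS.forall_on_two_iff hr₀
    (P := fun u r => ψ r - lam 1 u * φ r = 0)]
  exact ⟨fun h => ⟨h.1, h.2, h.3⟩, fun h => ⟨h.1, h.2.1, h.2.2⟩⟩

theorem IsStateChart.existsUnique_goursatX {S : Plane → State} (hS : IsStateChart lam Ω Φ J S)
    (hJ : ∀ k, IsOpen (J k) ∧ (J k).OrdConnected) {r₀ : Plane} (hr₀ : r₀ ∈ J 0 ×ˢ J 1) :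
    ∃ φ ψ : Plane → ℝ, IsGoursatX lam Ω Φ J r₀ φ ψ ∧
      ∀ φ' ψ' : Plane → ℝ, IsGoursatX lam Ω Φ J r₀ φ' ψ' →
        EqOn φ' φ (J 0 ×ˢ J 1) ∧ EqOn ψ' ψ (J 0 ×ˢ J 1) := by
  obtain ⟨φ, ψ, h1, h2, h3⟩ := exists_goursat (hJ 0).1 (hJ 0).2 (hJ 1).1 (hJ 1).2
    (hS.contDiffOn_comp_inv 0) (hS.contDiffOn_comp_inv 1) hS.comp_inv_ne hr₀.1 hr₀.2
    (f := fun _ => 1) (fun t _ => hasDerivAt_const t 1) continuousOn_const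
  refine ⟨φ, ψ, (hS.isGoursatX_iff hr₀).2 ⟨h1, h2, h3⟩, fun φ' ψ' h' => ?_⟩
  obtain ⟨k1, k2, k3⟩ := (hS.isGoursatX_iff hr₀).1 h'
  exact k1.eqOn (hJ 0).1 (hJ 0).2 (hJ 1).1 (hJ 1).2 (hS.contDiffOn_comp_inv 0)
    (hS.contDiffOn_comp_inv 1) hS.comp_inv_ne hr₀.1 hr₀.2 h1
    (fun t ht => (k2 t ht).trans (h2 t ht).symm) (fun s hs => (k3 s hs).trans (h3 s hs).symm)

theorem IsStateChart.existsUnique_goursatY {S : Plane → State} (hS : IsStateChart lam Ω Φ J S)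
    (hJ : ∀ k, IsOpen (J k) ∧ (J k).OrdConnected) {r₀ : Plane} (hr₀ : r₀ ∈ J 0 ×ˢ J 1) :
    ∃ φ ψ : Plane → ℝ, IsGoursatY lam Ω Φ J r₀ φ ψ ∧
      ∀ φ' ψ' : Plane → ℝ, IsGoursatY lam Ω Φ J r₀ φ' ψ' →
        EqOn φ' φ (J 0 ×ˢ J 1) ∧ EqOn ψ' ψ (J 0 ×ˢ J 1) := by
  -- Here the Goursat datum f is λ₁ itself on the line r₁ = r₁⁰; its C¹ regularity is what the
  -- existence theorem needs.
  have hl : ContDiffOn ℝ 1 (fun t => lam 0 (S (r₀.1, t))) (J 1) :=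
    (hS.contDiffOn_comp_inv 0).comp (f := fun t : ℝ => (r₀.1, t)) (by fun_prop)
      fun t ht => ⟨hr₀.1, ht⟩
  obtain ⟨φ, ψ, h1, h2, h3⟩ := exists_goursat (hJ 0).1 (hJ 0).2 (hJ 1).1 (hJ 1).2
    (hS.contDiffOn_comp_inv 0) (hS.contDiffOn_comp_inv 1) hS.comp_inv_ne hr₀.1 hr₀.2
    (f := fun t => lam 0 (S (r₀.1, t))) (fun t ht => hasDerivAt_of_contDiffOn (hJ 1).1 hl ht)
    (hl.continuousOn_deriv_of_isOpen (hJ 1).1 le_rfl)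
  refine ⟨φ, ψ, (hS.isGoursatY_iff hr₀).2 ⟨h1, h2, h3⟩, fun φ' ψ' h' => ?_⟩
  obtain ⟨k1, k2, k3⟩ := (hS.isGoursatY_iff hr₀).1 h'
  exact k1.eqOn (hJ 0).1 (hJ 0).2 (hJ 1).1 (hJ 1).2 (hS.contDiffOn_comp_inv 0)
    (hS.contDiffOn_comp_inv 1) hS.comp_inv_ne hr₀.1 hr₀.2 h1
    (fun t ht => (k2 t ht).trans (h2 t ht).symm) (fun s hs => (k3 s hs).trans (h3 s hs).symm)

end StateSpace

end QuasiHyp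

namespace QuasiHyp

open Set Filter Topology MeasureTheory intervalIntegral

/-! ### Solutions in the plane and their characteristics -/

section Solutions

variable {A : State → Matrix (Fin 2) (Fin 2) ℝ} {lam : Fin 2 → State → ℝ} {Ω : Set State}
  {Φ : Fin 2 → State → ℝ} {J : Fin 2 → Set ℝ} {G : Set Plane} {U : Plane → State}

/-- A Riemann invariant of a solution satisfies `∂r/∂x + λ ∂r/∂y = 0`. -/
theorem IsSolution.hasFDerivAt_riemannInvariant (hU : IsSolution A Ω G U) (hG : IsOpen G)
    (hΦ : IsRiemannInvariants A lam Ω Φ J) (hΩ : IsOpen Ω) (k : Fin 2) {p : Plane} (hp : p ∈ G) :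
    HasFDerivAt (fun q => Φ k (U q))
      (linForm (-lam k (U p) * fderiv ℝ (fun q => Φ k (U q)) p (0, 1))
        (fderiv ℝ (fun q => Φ k (U q)) p (0, 1))) p := by
  have hd := (hΦ.hasFDerivAt hΩ k (hU.mapsTo hp)).comp p
    ((hU.smooth.differentiableOn one_ne_zero).differentiableAt (hG.mem_nhds hp)).hasFDerivAt
  have hd' : HasFDerivAt (fun q => Φ k (U q)) _ p := hd
  refine hd'.congr_fderiv ?_
  rw [hd'.fderiv, eq_linForm ((fderiv ℝ (Φ k) (U p)).comp (fderiv ℝ U p))]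
  have e : fderiv ℝ U p (1, 0) = -(A (U p)).mulVec (fderiv ℝ U p (0, 1)) :=
    eq_neg_of_add_eq_zero_left (hU.pde p hp)
  simp only [ContinuousLinearMap.comp_apply, linForm_apply, e, map_neg,
    hΦ.left_eigenvector k _ (hU.mapsTo hp)]
  congr 1 <;> ring

/-- A function of class `C¹` whose Riemann invariants satisfy the diagonal system is a solution. -/
theorem isSolution_of_riemannInvariants (hG : IsOpen G) (hΦ : IsRiemannInvariants A lam Ω Φ J)
    (hΩ : IsOpen Ω) (hyp : StrictlyHyperbolic A lam Ω) (hU : ContDiffOn ℝ 1 U G)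
    (hm : MapsTo U G Ω) (hd : ∀ k, ∀ p ∈ G, fderiv ℝ (fun q => Φ k (U q)) p (1, 0) +
      lam k (U p) * fderiv ℝ (fun q => Φ k (U q)) p (0, 1) = 0) : IsSolution A Ω G U where
  smooth := hU
  mapsTo := hm
  pde p hp := by
    have key : ∀ k, fderiv ℝ (Φ k) (U p)
        (fderiv ℝ U p (1, 0) + (A (U p)).mulVec (fderiv ℝ U p (0, 1))) = 0 := by
      intro k
      have h1 : HasFDerivAt (fun q => Φ k (U q)) _ p :=
        (hΦ.hasFDerivAt hΩ k (hm hp)).comp p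
          ((hU.differentiableOn one_ne_zero).differentiableAt (hG.mem_nhds hp)).hasFDerivAt
      have h2 := hd k p hp
      rw [h1.fderiv] at h2
      rw [map_add, hΦ.left_eigenvector k _ (hm hp)]
      exact h2
    exact hΦ.eq_zero hyp (hm hp) (key 0) (key 1)

theorem IsSolution.contDiffOn_riem (hU : IsSolution A Ω G U)
    (hΦ : IsRiemannInvariants A lam Ω Φ J) (k : Fin 2) :
    ContDiffOn ℝ 1 (fun q => Φ k (U q)) G := (hΦ.contDiffOn_one k).comp hU.smooth hU.mapsTo

/-- The form `ψ dx - φ dy`, taken at the Riemann invariants of a solution, has a primitive. -/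
theorem IsSolution.exists_primitive (hU : IsSolution A Ω G U) (hG : IsOpen G)
    [SimplyConnectedSpace G] (hΦ : IsRiemannInvariants A lam Ω Φ J) (hΩ : IsOpen Ω)
    (hJ : ∀ k, IsOpen (J k) ∧ (J k).OrdConnected) {φ ψ : Plane → ℝ}
    (h : IsLinearSolution lam Ω Φ J φ ψ) :
    ∃ W : Plane → ℝ, ∀ p ∈ G, HasFDerivAt W (linForm (ψ (riem Φ (U p))) (-φ (riem Φ (U p)))) p := by
  have hJo : IsOpen (J 0 ×ˢ J 1) := (hJ 0).1.prod (hJ 1).1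
  have comp : ∀ {f : Plane → ℝ} (_ : ContDiffOn ℝ 1 f (J 0 ×ˢ J 1)) {p : Plane} (_ : p ∈ G),
      HasFDerivAt (fun q => f (riem Φ (U q)))
        (linForm (fderiv ℝ f (riem Φ (U p)) (1, 0) *
            (-lam 0 (U p) * fderiv ℝ (fun q => Φ 0 (U q)) p (0, 1)) +
          fderiv ℝ f (riem Φ (U p)) (0, 1) *
            (-lam 1 (U p) * fderiv ℝ (fun q => Φ 1 (U q)) p (0, 1)))
          (fderiv ℝ f (riem Φ (U p)) (1, 0) * fderiv ℝ (fun q => Φ 0 (U q)) p (0, 1) +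
          fderiv ℝ f (riem Φ (U p)) (0, 1) * fderiv ℝ (fun q => Φ 1 (U q)) p (0, 1))) p := by
    intro f hf p hp
    have h1 : HasFDerivAt (fun q => riem Φ (U q)) _ p :=
      (hU.hasFDerivAt_riemannInvariant hG hΦ hΩ 0 hp).prodMk
        (hU.hasFDerivAt_riemannInvariant hG hΦ hΩ 1 hp)
    refine ((hasFDerivAt_of_contDiffOn hJo hf (hΦ.bijOn.mapsTo (hU.mapsTo hp))).comp p
      h1).congr_fderiv ?_
    ext <;> simp
  -- Closedness means ψ_y = -φ_x. Each r_k satisfies (r_k)_x = -λ_k (r_k)_y, so this is the sum over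
  -- k of (∂ψ/∂r_k - λ_k ∂φ/∂r_k) (r_k)_y = 0.
  have dω : ∀ p ∈ G, HasFDerivAt
      (fun q => linForm (ψ (riem Φ (U q))) (-φ (riem Φ (U q)))) _ p := fun p hp =>
    ((comp h.smooth_snd hp).smul_const (ContinuousLinearMap.fst ℝ ℝ ℝ)).add
      ((comp h.smooth_fst hp).neg.smul_const (ContinuousLinearMap.snd ℝ ℝ ℝ))
  refine exists_primitive_of_simplyConnected hG
    (fun p hp => (dω p hp).differentiableAt.differentiableWithinAt) fun p hp x y => ?_
  rw [(dω p hp).fderiv]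
  have e1 := h.eq_one _ (hU.mapsTo hp)
  have e2 := h.eq_two _ (hU.mapsTo hp)
  simp only [add_apply, ContinuousLinearMap.smulRight_apply, neg_apply, linForm_apply, smul_apply,
    ContinuousLinearMap.coe_fst', ContinuousLinearMap.coe_snd', smul_eq_mul, ← e1, ← e2]
  ring

theorem eq_of_hasDerivWithinAt_zero {f : ℝ → ℝ}
    (h : ∀ σ ∈ Icc (0 : ℝ) 1, HasDerivWithinAt f 0 (Icc 0 1) σ) :
    ∀ σ ∈ Icc (0 : ℝ) 1, f σ = f 0 :=
  constant_of_derivWithin_zero (fun σ hσ => (h σ hσ).differentiableWithinAt) fun σ hσ =>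
    (h σ (Ico_subset_Icc_self hσ)).derivWithin
      (uniqueDiffOn_Icc zero_lt_one σ (Ico_subset_Icc_self hσ))

theorem hasDerivWithinAt_comp_linForm {W : Plane → ℝ} {a b : ℝ} {c : ℝ → Plane} {c' : Plane}
    {s : Set ℝ} {τ : ℝ} (hW : HasFDerivAt W (linForm a b) (c τ)) (hc : HasDerivWithinAt c c' s τ) :
    HasDerivWithinAt (fun τ => W (c τ)) (a * c'.1 + b * c'.2) s τ :=
  (hW.comp_hasDerivWithinAt τ hc).congr_deriv (linForm_apply _ _ _)

theorem IsCharacteristic.hasDerivWithinAt {l : State → ℝ} {c : ℝ → Plane} {p q : Plane}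
    (h : IsCharacteristic l U G c p q) {σ : ℝ} (hσ : σ ∈ Icc (0 : ℝ) 1) :
    HasDerivWithinAt c (derivWithin c (Icc 0 1) σ) (Icc 0 1) σ :=
  (h.smooth.differentiableOn one_ne_zero σ hσ).hasDerivWithinAt

/-- A Riemann invariant is constant along the characteristics of its family. -/
theorem IsSolution.eq_on_characteristic (hU : IsSolution A Ω G U) (hG : IsOpen G)
    (hΦ : IsRiemannInvariants A lam Ω Φ J) (hΩ : IsOpen Ω) {k : Fin 2} {c : ℝ → Plane} {p q : Plane}
    (hc : IsCharacteristic (lam k) U G c p q) {σ : ℝ} (hσ : σ ∈ Icc (0 : ℝ) 1) :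
    Φ k (U (c σ)) = Φ k (U p) := by
  rw [← hc.source]
  refine eq_of_hasDerivWithinAt_zero (f := fun σ => Φ k (U (c σ))) (fun τ hτ => ?_) σ hσ
  refine (hasDerivWithinAt_comp_linForm
    (hU.hasFDerivAt_riemannInvariant hG hΦ hΩ k (hc.mapsTo hτ))
    (hc.hasDerivWithinAt hτ)).congr_deriv ?_
  rw [hc.slope τ hτ]
  ring

/-- The intersection point of two characteristics that start from the initial curve: a linear
function `Z` that agrees with `ψ dx - φ dy` along the first characteristic, where this form
vanishes along the second one, is given at that point by an integral over the initial curve. -/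
theorem IsSolution.apply_meetingPoint (hU : IsSolution A Ω G U) (hG : IsOpen G)
    [SimplyConnectedSpace G] (hΦ : IsRiemannInvariants A lam Ω Φ J) (hΩ : IsOpen Ω)
    (hJ : ∀ k, IsOpen (J k) ∧ (J k).OrdConnected) {I : Set ℝ} (hI : IsOpen I)
    (hI' : I.OrdConnected) {γ : ℝ → Plane} {U₀ : ℝ → State} (hdata : IsCauchyData lam Ω I γ U₀)
    {s t : ℝ} (hs : s ∈ I) (ht : t ∈ I) (hst : ∀ τ ∈ uIcc s t, γ τ ∈ G ∧ U (γ τ) = U₀ τ)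
    {m : Plane} {c₁ c₂ : ℝ → Plane} (hc₁ : IsCharacteristic (lam 0) U G c₁ (γ t) m)
    (hc₂ : IsCharacteristic (lam 1) U G c₂ (γ s) m) {φ ψ : Plane → ℝ}
    (h : IsLinearSolution lam Ω Φ J φ ψ) {Z : Plane →L[ℝ] ℝ}
    (h₁ : ∀ u ∈ Ω, Φ 0 u = Φ 0 (U₀ t) → ∀ d : Plane, d.2 = lam 0 u * d.1 →
      ψ (riem Φ u) * d.1 - φ (riem Φ u) * d.2 = Z d)
    (h₂ : ∀ u ∈ Ω, Φ 1 u = Φ 1 (U₀ s) → ψ (riem Φ u) - lam 1 u * φ (riem Φ u) = 0) :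
    Z m = Z (γ t) - lineIntegral Φ γ U₀ φ ψ s t := by
  obtain ⟨W, hW⟩ := hU.exists_primitive hG hΦ hΩ hJ h
  -- On `c₁` the invariant r₁ keeps its value at γ(t), so the boundary condition on r₁ = r₁⁰ applies
  -- all along the curve; on `c₂` the same is true of r₂ and γ(s).
  have e₁ : W m - Z m = W (γ t) - Z (γ t) := by
    have := eq_of_hasDerivWithinAt_zero (f := fun σ => W (c₁ σ) - Z (c₁ σ)) (fun σ hσ => ?_) 1
      (right_mem_Icc.2 zero_le_one)
    · simpa only [hc₁.source, hc₁.target] using this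
    · have d1 := hasDerivWithinAt_comp_linForm (hW _ (hc₁.mapsTo hσ)) (hc₁.hasDerivWithinAt hσ)
      have d2 := Z.hasFDerivAt.comp_hasDerivWithinAt σ (hc₁.hasDerivWithinAt hσ)
      refine (d1.sub d2).congr_deriv ?_
      rw [← h₁ _ (hU.mapsTo (hc₁.mapsTo hσ)) _ _ (hc₁.slope σ hσ)]
      · ring
      · rw [hU.eq_on_characteristic hG hΦ hΩ hc₁ hσ, (hst t right_mem_uIcc).2]
  have e₂ : W m = W (γ s) := by
    have := eq_of_hasDerivWithinAt_zero (f := fun σ => W (c₂ σ)) (fun σ hσ => ?_) 1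
      (right_mem_Icc.2 zero_le_one)
    · simpa only [hc₂.source, hc₂.target] using this
    · have d1 := hasDerivWithinAt_comp_linForm (hW _ (hc₂.mapsTo hσ)) (hc₂.hasDerivWithinAt hσ)
      refine d1.congr_deriv ?_
      have e := h₂ _ (hU.mapsTo (hc₂.mapsTo hσ)) (by
        rw [hU.eq_on_characteristic hG hΦ hΩ hc₂ hσ, (hst s left_mem_uIcc).2])
      rw [hc₂.slope σ hσ]
      linear_combination (derivWithin c₂ (Icc 0 1) σ).1 * e
  have e₃ : lineIntegral Φ γ U₀ φ ψ s t = W (γ t) - W (γ s) := by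
    refine integral_eq_sub_of_hasDerivAt (f := fun τ => W (γ τ)) (fun τ hτ => ?_) ?_
    · obtain ⟨hτG, hτU⟩ := hst τ hτ
      refine (hasDerivAt_comp_linForm (hW _ hτG) (hasDerivAt_of_contDiffOn hI hdata.curve_smooth
        (hI'.uIcc_subset hs ht hτ))).congr_deriv ?_
      rw [hτU]
      ring
    · refine ContinuousOn.intervalIntegrable (ContinuousOn.mono ?_ (hI'.uIcc_subset hs ht))
      have cγ := hdata.curve_smooth.continuousOn_deriv_of_isOpen hI le_rfl
      have cr : ContinuousOn (fun τ => riem Φ (U₀ τ)) I :=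
        ((hΦ.contDiffOn_one 0).prodMk (hΦ.contDiffOn_one 1)).continuousOn.comp
          hdata.data_smooth.continuousOn hdata.data_mapsTo
      have mr : MapsTo (fun τ => riem Φ (U₀ τ)) I (J 0 ×ˢ J 1) := fun τ hτ =>
        hΦ.bijOn.mapsTo (hdata.data_mapsTo hτ)
      exact ((h.smooth_snd.continuousOn.comp cr mr).mul cγ.fst).sub
        ((h.smooth_fst.continuousOn.comp cr mr).mul cγ.snd)
  linarith

end Solutions

end QuasiHyp

namespace QuasiHyp

open Set Filter Topology MeasureTheory intervalIntegral

/-! ### The map H and its charts -/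

section MeetingPoint

variable {A : State → Matrix (Fin 2) (Fin 2) ℝ} {lam : Fin 2 → State → ℝ} {Ω : Set State}
  {Φ : Fin 2 → State → ℝ} {J : Fin 2 → Set ℝ} {S : Plane → State} {I : Set ℝ}
  {γ : ℝ → Plane} {U₀ : ℝ → State}

/-- The eigenvalue `lam k` at the state with Riemann invariants `r₁ = r₁(t)`, `r₂ = r₂(s)`, as a
function of `(s, t)`. -/
def cornerEigenvalue (lam : Fin 2 → State → ℝ) (Φ : Fin 2 → State → ℝ) (S : Plane → State)
    (U₀ : ℝ → State) (k : Fin 2) : Plane → ℝ :=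
  pullback (fun τ => Φ 0 (U₀ τ)) (fun τ => Φ 1 (U₀ τ)) fun r => lam k (S r)

/-- `ξ`, `η` are the nonvanishing factors on the diagonal in the derivative `H_s = ξ (1, λ₁)`,
`H_t = η (1, λ₂)` of the map `H`, and `H` extends the initial curve. -/
structure IsCauchyMap (μ₁ μ₂ : Plane → ℝ) (I : Set ℝ) (γ : ℝ → Plane) (ξ η : Plane → ℝ)
    (H : Plane → Plane) : Prop where
  continuousOn_ξ : ContinuousOn ξ (I ×ˢ I)
  continuousOn_η : ContinuousOn η (I ×ˢ I)
  smooth : ContDiffOn ℝ 1 H (I ×ˢ I)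
  hasFDerivAt : ∀ p ∈ I ×ˢ I,
    HasFDerivAt H ((linForm (ξ p) (η p)).prod (linForm (μ₁ p * ξ p) (μ₂ p * η p))) p
  diagonal : ∀ τ ∈ I, H (τ, τ) = γ τ ∧ ξ (τ, τ) ≠ 0 ∧ η (τ, τ) ≠ 0

theorem IsCauchyData.contDiffOn_riemannInvariant (hdata : IsCauchyData lam Ω I γ U₀)
    (hS : IsStateChart lam Ω Φ J S) (k : Fin 2) : ContDiffOn ℝ 1 (fun τ => Φ k (U₀ τ)) I :=
  (hS.smooth k).comp hdata.data_smooth hdata.data_mapsTo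

/-- By Riemann's representation, H is the solution (X, Y) of the linear Cauchy problem. This also
gives smoothness of H, although its definition picks a Goursat solution for each (r₁⁰, r₂⁰) with no
regularity assumed in that parameter. -/
theorem IsCauchyData.exists_isCauchyMap (hdata : IsCauchyData lam Ω I γ U₀)
    (hS : IsStateChart lam Ω Φ J S) (hJ : ∀ k, IsOpen (J k) ∧ (J k).OrdConnected) (hI : IsOpen I)
    (hI' : I.OrdConnected) {τ₀ : ℝ} (hτ₀ : τ₀ ∈ I) {φx ψx φy ψy : Plane → Plane → ℝ}
    (hx : ∀ r₀ ∈ J 0 ×ˢ J 1, IsGoursatX lam Ω Φ J r₀ (φx r₀) (ψx r₀))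
    (hy : ∀ r₀ ∈ J 0 ×ˢ J 1, IsGoursatY lam Ω Φ J r₀ (φy r₀) (ψy r₀)) :
    ∃ ξ η : Plane → ℝ, IsCauchyMap (cornerEigenvalue lam Φ S U₀ 0) (cornerEigenvalue lam Φ S U₀ 1)
      I γ ξ η (meetingPoint Φ γ U₀ φx ψx φy ψy) := by
  have hr := hdata.contDiffOn_riemannInvariant hS
  have hm : ∀ τ ∈ I, riem Φ (U₀ τ) ∈ J 0 ×ˢ J 1 := fun τ hτ => hS.mapsTo (hdata.data_mapsTo hτ)
  have hm₁ : MapsTo (fun τ => Φ 0 (U₀ τ)) I (J 0) := fun τ hτ => (hm τ hτ).1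
  have hm₂ : MapsTo (fun τ => Φ 1 (U₀ τ)) I (J 1) := fun τ hτ => (hm τ hτ).2
  have hμ : ∀ k, ContDiffOn ℝ 1 (cornerEigenvalue lam Φ S U₀ k) (I ×ˢ I) := fun k =>
    contDiffOn_pullback (hr 0) (hr 1) hm₁ hm₂ (hS.contDiffOn_comp_inv k)
  have hμd : ∀ k, ∀ τ ∈ I, cornerEigenvalue lam Φ S U₀ k (τ, τ) = lam k (U₀ τ) := fun k τ hτ =>
    congrArg (lam k) (hS.left_inv _ (hdata.data_mapsTo hτ))
  obtain ⟨ξ, η, m, X, Y, h, hdiag⟩ := exists_cauchy hI hI' (hμ 0) (hμ 1)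
    (fun p hp => hS.comp_inv_ne _ (mapsTo_pullback hm₁ hm₂ hp)) hdata.curve_smooth
    (fun τ hτ => by rw [hμd 0 τ hτ]; exact hdata.noncharacteristic 0 τ hτ)
    (fun τ hτ => by rw [hμd 1 τ hτ]; exact hdata.noncharacteristic 1 τ hτ) hτ₀
  have hD : IsOpen (I ×ˢ I) := hI.prod hI
  have hH : EqOn (meetingPoint Φ γ U₀ φx ψx φy ψy) (fun p => (X p, Y p)) (I ×ˢ I) := by
    rintro ⟨s, t⟩ ⟨hs, ht⟩
    have hr₀ : corner Φ U₀ s t ∈ J 0 ×ˢ J 1 := ⟨hm₁ ht, hm₂ hs⟩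
    obtain ⟨x1, x2, x3⟩ := (hS.isGoursatX_iff hr₀).1 (hx _ hr₀)
    obtain ⟨y1, y2, y3⟩ := (hS.isGoursatY_iff hr₀).1 (hy _ hr₀)
    have eX := h.eq_sub_integral hI hI' (hJ 0).1 (hJ 1).1 (hr 0) (hr 1) hm₁ hm₂
      (hS.contDiffOn_comp_inv 0) (hS.contDiffOn_comp_inv 1) hdata.curve_smooth
      (fun τ hτ => (hdiag τ hτ).1) x1 hs ht (Z := fun σ => X (σ, t))
      (fun σ hσ => (hasDerivAt_fst_linForm (h.deriv_X (σ, t) ⟨hσ, ht⟩)).congr_deriv (by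
        have := x2 _ (hm₂ hσ)
        simp only [corner] at this ⊢
        rw [this, one_mul]))
      (fun τ hτ => x3 _ (hm₁ hτ))
    have eY := h.eq_sub_integral hI hI' (hJ 0).1 (hJ 1).1 (hr 0) (hr 1) hm₁ hm₂
      (hS.contDiffOn_comp_inv 0) (hS.contDiffOn_comp_inv 1) hdata.curve_smooth
      (fun τ hτ => (hdiag τ hτ).1) y1 hs ht (Z := fun σ => Y (σ, t))
      (fun σ hσ => (hasDerivAt_fst_linForm (h.deriv_Y (σ, t) ⟨hσ, ht⟩)).congr_deriv (by
        have := y2 _ (hm₂ hσ)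
        simp only [corner] at this ⊢
        rw [this]
        rfl))
      (fun τ hτ => y3 _ (hm₁ hτ))
    have e0 := (hdiag t ht).1
    refine Prod.ext ?_ ?_
    · simp only [eX]
      rw [meetingPoint, ← e0]
      rfl
    · simp only [eY]
      rw [meetingPoint, ← e0]
      rfl
  have hsys := h.isDiagonalSolution hD (hμ 0).continuousOn (hμ 1).continuousOn
  refine ⟨ξ, η, h.continuousOn_ξ, h.continuousOn_η,
    (hsys.smooth_fst.prodMk hsys.smooth_snd).congr hH, fun p hp => ?_, fun τ hτ => ?_⟩
  · exact ((h.deriv_X p hp).prodMk (h.deriv_Y p hp)).congr_of_eventuallyEq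
      (hH.eventuallyEq_of_mem (hD.mem_nhds hp))
  · obtain ⟨e1, e2⟩ := hdiag τ hτ
    exact ⟨(hH ⟨hτ, hτ⟩).trans e1, e2⟩

section CauchyMap

variable {μ₁ μ₂ ξ η : Plane → ℝ} {H : Plane → Plane}

/-- The columns of the derivative are ξ (1, μ₁) and η (1, μ₂), which are independent. -/
theorem IsCauchyMap.exists_equiv (h : IsCauchyMap μ₁ μ₂ I γ ξ η H) {p : Plane} (hp : p ∈ I ×ˢ I)
    (hne : μ₁ p ≠ μ₂ p) (hξ : ξ p ≠ 0) (hη : η p ≠ 0) :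
    ∃ e : Plane ≃L[ℝ] Plane, HasFDerivAt H (e : Plane →L[ℝ] Plane) p := by
  set D : Plane →L[ℝ] Plane := (linForm (ξ p) (η p)).prod (linForm (μ₁ p * ξ p) (μ₂ p * η p))
  have hinj : Function.Injective D.toLinearMap := by
    rw [← LinearMap.ker_eq_bot, LinearMap.ker_eq_bot']
    intro w hw
    have e1 : ξ p * w.1 + η p * w.2 = 0 := by
      simpa [D] using congrArg Prod.fst hw
    have e2 : μ₁ p * ξ p * w.1 + μ₂ p * η p * w.2 = 0 := by
      simpa [D] using congrArg Prod.snd hw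
    have e3 : (μ₁ p - μ₂ p) * ξ p * w.1 = 0 := by linear_combination e2 - μ₂ p * e1
    have e4 : (μ₁ p - μ₂ p) * η p * w.2 = 0 := by linear_combination μ₁ p * e1 - e2
    have hs := sub_ne_zero.2 hne
    exact Prod.ext ((mul_eq_zero.1 e3).resolve_left (mul_ne_zero hs hξ))
      ((mul_eq_zero.1 e4).resolve_left (mul_ne_zero hs hη))
  exact ⟨(LinearMap.linearEquivOfInjective D.toLinearMap hinj rfl).toContinuousLinearEquiv,
    h.hasFDerivAt p hp⟩

/-- A differentiable left inverse forces the derivative of H to be injective, while a zero of ξ or η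
kills a coordinate direction. -/
theorem IsCauchyMap.ne_zero_of_isChart (h : IsCauchyMap μ₁ μ₂ I γ ξ η H) {V G : Set Plane}
    (hV : IsChart I H V G) {p : Plane} (hp : p ∈ V) : ξ p ≠ 0 ∧ η p ≠ 0 := by
  obtain ⟨K, hK, hKH⟩ := hV.inverse
  have hd := h.hasFDerivAt p (hV.subset hp)
  have hKd := ((hK.differentiableOn one_ne_zero).differentiableAt
    (hV.isOpen_target.mem_nhds (hV.bijOn.mapsTo hp))).hasFDerivAt
  have hid : HasFDerivAt (fun q => K (H q)) (ContinuousLinearMap.id ℝ Plane) p :=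
    (hasFDerivAt_id p).congr_of_eventuallyEq (by
      filter_upwards [hV.isOpen_source.mem_nhds hp] with q hq using hKH q hq)
  have e := (hKd.comp p hd).unique hid
  constructor
  · intro h0
    have := DFunLike.congr_fun e ((1, 0) : Plane)
    have h2 : ((0 : ℝ), (0 : ℝ)) = ((1, 0) : Plane) := by
      rw [← ContinuousLinearMap.id_apply (R₁ := ℝ) ((1, 0) : Plane), ← this]
      simp only [ContinuousLinearMap.comp_apply, ContinuousLinearMap.prod_apply, linForm_apply, h0,
        mul_zero, zero_mul, add_zero]
      exact (map_zero _).symm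
    simp at h2
  · intro h0
    have := DFunLike.congr_fun e ((0, 1) : Plane)
    have h2 : ((0 : ℝ), (0 : ℝ)) = ((0, 1) : Plane) := by
      rw [← ContinuousLinearMap.id_apply (R₁ := ℝ) ((0, 1) : Plane), ← this]
      simp only [ContinuousLinearMap.comp_apply, ContinuousLinearMap.prod_apply, linForm_apply, h0,
        mul_zero, zero_mul, add_zero]
      exact (map_zero _).symm
    simp at h2

theorem IsCauchyMap.hasDerivAt_fst (h : IsCauchyMap μ₁ μ₂ I γ ξ η H) {p : Plane}
    (hp : p ∈ I ×ˢ I) : HasDerivAt (fun σ => H (σ, p.2)) (ξ p, μ₁ p * ξ p) p.1 := by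
  have h1 : HasDerivAt (fun σ : ℝ => (σ, p.2)) ((1, 0) : Plane) p.1 :=
    (hasDerivAt_id p.1).prodMk (hasDerivAt_const p.1 p.2)
  exact ((h.hasFDerivAt p hp).comp_hasDerivAt (f := fun σ => (σ, p.2)) p.1 h1).congr_deriv
    (by simp)

theorem IsCauchyMap.hasDerivAt_snd (h : IsCauchyMap μ₁ μ₂ I γ ξ η H) {p : Plane}
    (hp : p ∈ I ×ˢ I) : HasDerivAt (fun τ => H (p.1, τ)) (η p, μ₂ p * η p) p.2 := by
  have h1 : HasDerivAt (fun τ : ℝ => (p.1, τ)) ((0, 1) : Plane) p.2 :=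
    (hasDerivAt_const p.2 p.1).prodMk (hasDerivAt_id p.2)
  exact ((h.hasFDerivAt p hp).comp_hasDerivAt (f := fun τ => (p.1, τ)) p.2 h1).congr_deriv
    (by simp)

/-- Each neighbourhood of a compact injective piece of the initial curve contains the image of a
chart around the corresponding piece of the diagonal. -/
theorem IsCauchyMap.exists_isChart (h : IsCauchyMap μ₁ μ₂ I γ ξ η H) (hI : IsOpen I)
    (hne : ∀ p ∈ I ×ˢ I, μ₁ p ≠ μ₂ p) {a b : ℝ} (hab : a ≤ b) (habI : Icc a b ⊆ I)
    (hinj : InjOn γ (Icc a b)) {N : Set Plane} (hN : IsOpen N) (hγN : γ '' Icc a b ⊆ N) :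
    ∃ V G : Set Plane, IsChart I H V G ∧ G ⊆ N ∧ ∀ τ ∈ Icc a b, (τ, τ) ∈ V := by
  have hD : IsOpen (I ×ˢ I) := hI.prod hI
  set Δ : Set Plane := (fun τ : ℝ => (τ, τ)) '' Icc a b
  have hΔ : IsCompact Δ := isCompact_Icc.image (by fun_prop)
  have hΔI : ∀ p ∈ Δ, p ∈ I ×ˢ I := by
    rintro _ ⟨τ, hτ, rfl⟩
    exact ⟨habI hτ, habI hτ⟩
  have hΔd : ∀ p ∈ Δ, ξ p ≠ 0 ∧ η p ≠ 0 := by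
    rintro _ ⟨τ, hτ, rfl⟩
    exact (h.diagonal τ (habI hτ)).2
  have hinjΔ : InjOn H Δ := by
    rintro _ ⟨τ, hτ, rfl⟩ _ ⟨σ, hσ, rfl⟩ e
    simp only [(h.diagonal τ (habI hτ)).1, (h.diagonal σ (habI hσ)).1] at e
    rw [hinj hτ hσ e]
  -- Injectivity on a compact set together with local injectivity at its points gives injectivity on
  -- a neighbourhood.
  obtain ⟨T, hT, hTinj⟩ := hinjΔ.exists_mem_nhdsSet hΔ
    (fun p hp => (h.hasFDerivAt p (hΔI p hp)).continuousAt) (fun p hp => by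
      obtain ⟨e, he⟩ := h.exists_equiv (hΔI p hp) (hne p (hΔI p hp)) (hΔd p hp).1 (hΔd p hp).2
      have hfa : ContDiffAt ℝ 1 H p := h.smooth.contDiffAt (hD.mem_nhds (hΔI p hp))
      exact ⟨_, (hfa.toOpenPartialHomeomorph H he one_ne_zero).open_source.mem_nhds
        (hfa.mem_toOpenPartialHomeomorph_source he one_ne_zero),
        (hfa.toOpenPartialHomeomorph H he one_ne_zero).injOn⟩)
  obtain ⟨T', hT'o, hΔT', hT'T⟩ := mem_nhdsSet_iff_exists.1 hT
  have hξo : IsOpen (I ×ˢ I ∩ ξ ⁻¹' {0}ᶜ) := h.continuousOn_ξ.isOpen_inter_preimage hD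
    isOpen_compl_singleton
  have hηo : IsOpen (I ×ˢ I ∩ η ⁻¹' {0}ᶜ) := h.continuousOn_η.isOpen_inter_preimage hD
    isOpen_compl_singleton
  have hNo : IsOpen (I ×ˢ I ∩ H ⁻¹' N) := h.smooth.continuousOn.isOpen_inter_preimage hD hN
  obtain ⟨δ, hδ, hδs⟩ := hΔ.exists_thickening_subset_open
    (((hT'o.inter hξo).inter hηo).inter hNo) (fun p hp => ⟨⟨⟨hΔT' hp, hΔI p hp, (hΔd p hp).1⟩,
      hΔI p hp, (hΔd p hp).2⟩, hΔI p hp, by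
        obtain ⟨τ, hτ, rfl⟩ := hp
        exact hγN ⟨τ, hτ, ((h.diagonal τ (habI hτ)).1).symm⟩⟩)
  -- Clamping s to [a, b] moves it by less than ε, and |s - t| < ε, so (s, t) lies within 2ε = δ of
  -- the diagonal piece in the sup metric. The band |s - t| < ε also makes V contain all pairs
  -- between s and t.
  set ε := δ / 2
  have hε : 0 < ε := half_pos hδ
  set V : Set Plane := {p | p.1 ∈ Ioo (a - ε) (b + ε) ∧ p.2 ∈ Ioo (a - ε) (b + ε) ∧
    dist p.1 p.2 < ε}
  have hdiagV : ∀ τ ∈ Icc a b, (τ, τ) ∈ V := fun τ hτ =>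
    ⟨⟨by linarith [hτ.1], by linarith [hτ.2]⟩, ⟨by linarith [hτ.1], by linarith [hτ.2]⟩,
      by simpa using hε⟩
  have hVo : IsOpen V := (isOpen_Ioo.preimage continuous_fst).inter
    ((isOpen_Ioo.preimage continuous_snd).inter
      (isOpen_lt (continuous_fst.dist continuous_snd) continuous_const))
  have hVs : ∀ p ∈ V, p ∈ ((T' ∩ (I ×ˢ I ∩ ξ ⁻¹' {0}ᶜ)) ∩ (I ×ˢ I ∩ η ⁻¹' {0}ᶜ)) ∩
      (I ×ˢ I ∩ H ⁻¹' N) := by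
    rintro ⟨s, t⟩ ⟨h1, h2, h3⟩
    refine hδs (Metric.mem_thickening_iff.2 ⟨_, ⟨max a (min b s),
      ⟨le_max_left _ _, max_le hab (min_le_left _ _)⟩, rfl⟩, ?_⟩)
    have e1 : |s - max a (min b s)| < ε := by
      simp only [mem_Ioo] at h1
      rw [abs_lt]
      rcases le_total b s with hbs | hbs
      · rw [min_eq_left hbs, max_eq_right hab]
        constructor <;> linarith
      · rw [min_eq_right hbs]
        rcases le_total a s with has | has
        · rw [max_eq_right has]
          constructor <;> linarith
        · rw [max_eq_left has]
          constructor <;> linarith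
    rw [Real.dist_eq, abs_lt] at h3
    rw [abs_lt] at e1
    rw [Prod.dist_eq, Real.dist_eq, Real.dist_eq, max_lt_iff, abs_lt, abs_lt]
    simp only [ε] at e1 h3 ⊢
    refine ⟨⟨?_, ?_⟩, ?_, ?_⟩ <;> linarith [e1.1, e1.2, h3.1, h3.2]
  have hVI : V ⊆ I ×ˢ I := fun p hp => (hVs p hp).2.1
  have hVsm := h.smooth.mono hVI
  have hVinj : InjOn H V := hTinj.mono fun p hp => hT'T (hVs p hp).1.1.1
  obtain ⟨hGo, K, hK, hKH⟩ := exists_contDiffOn_inverse hVo hVsm (fun p hp =>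
    h.exists_equiv (hVI hp) (hne p (hVI hp)) (hVs p hp).1.1.2.2 (hVs p hp).1.2.2) hVinj
  refine ⟨V, H '' V, ⟨hVI, hVo, hGo, ?_, hVinj.bijOn_image, hVsm, K, hK, hKH⟩, ?_, hdiagV⟩
  · rintro s t ⟨h1, h2, h3⟩ ⟨σ, τ⟩ ⟨hσ, hτ⟩
    exact ⟨ordConnected_Ioo.uIcc_subset h1 h2 hσ, ordConnected_Ioo.uIcc_subset h1 h2 hτ,
      (Real.dist_le_of_mem_uIcc hσ hτ).trans_lt h3⟩
  · rintro _ ⟨p, hp, rfl⟩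
    exact (hVs p hp).2.2

end CauchyMap

end MeetingPoint

end QuasiHyp

namespace QuasiHyp

open Set Filter Topology MeasureTheory intervalIntegral

/-! ### The equivalence on a chart -/

theorem exists_Icc_of_isCompact {J C : Set ℝ} (hJ : J.OrdConnected) (hC : IsCompact C)
    (hCJ : C ⊆ J) : ∃ a b, C ⊆ Icc a b ∧ Icc a b ⊆ J := by
  rcases C.eq_empty_or_nonempty with rfl | hne
  · exact ⟨1, 0, empty_subset _, by simp⟩
  · obtain ⟨a, ha, ha'⟩ := hC.exists_isLeast hne
    obtain ⟨b, hb, hb'⟩ := hC.exists_isGreatest hne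
    exact ⟨a, b, fun x hx => ⟨ha' hx, hb' hx⟩, hJ.out (hCJ ha) (hCJ hb)⟩

/-- A `C¹` function on a box is Lipschitz along two continuous maps of a compact set to the box. -/
theorem exists_lipschitz_on_compact {J₁ J₂ : Set ℝ} (h₁ : J₁.OrdConnected) (h₂ : J₂.OrdConnected)
    {Λ : Plane → ℝ} (hΛ : ContDiffOn ℝ 1 Λ (J₁ ×ˢ J₂)) {K : Set Plane} (hK : IsCompact K)
    {f g : Plane → Plane} (hf : ContinuousOn f K) (hg : ContinuousOn g K)
    (hfm : MapsTo f K (J₁ ×ˢ J₂)) (hgm : MapsTo g K (J₁ ×ˢ J₂)) :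
    ∃ L : ℝ, 0 ≤ L ∧ ∀ p ∈ K,
      |Λ (f p) - Λ (g p)| ≤ L * (|(f p).1 - (g p).1| + |(f p).2 - (g p).2|) := by
  -- Both images are enclosed in one compact convex box, on which a C¹ function is Lipschitz.
  obtain ⟨a, b, hab, habJ⟩ := exists_Icc_of_isCompact h₁
    ((hK.image_of_continuousOn hf.fst).union (hK.image_of_continuousOn hg.fst))
    (by rintro _ (⟨p, hp, rfl⟩ | ⟨p, hp, rfl⟩); exacts [(hfm hp).1, (hgm hp).1])
  obtain ⟨c, d, hcd, hcdJ⟩ := exists_Icc_of_isCompact h₂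
    ((hK.image_of_continuousOn hf.snd).union (hK.image_of_continuousOn hg.snd))
    (by rintro _ (⟨p, hp, rfl⟩ | ⟨p, hp, rfl⟩); exacts [(hfm hp).2, (hgm hp).2])
  obtain ⟨L, hL⟩ := (hΛ.mono (prod_mono habJ hcdJ)).exists_lipschitzOnWith one_ne_zero
    ((convex_Icc a b).prod (convex_Icc c d)) (isCompact_Icc.prod isCompact_Icc)
  refine ⟨L, L.2, fun p hp => ?_⟩
  have := hL.dist_le_mul (f p) ⟨hab (Or.inl ⟨p, hp, rfl⟩), hcd (Or.inl ⟨p, hp, rfl⟩)⟩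
    (g p) ⟨hab (Or.inr ⟨p, hp, rfl⟩), hcd (Or.inr ⟨p, hp, rfl⟩)⟩
  rw [Real.dist_eq, Prod.dist_eq, Real.dist_eq, Real.dist_eq] at this
  refine this.trans (mul_le_mul_of_nonneg_left ?_ L.2)
  exact max_le (le_add_of_nonneg_right (abs_nonneg _)) (le_add_of_nonneg_left (abs_nonneg _))

theorem abs_sub_le_integral_of_deriv_le {f f' e : ℝ → ℝ} {x y B : ℝ}
    (hf : ∀ z ∈ uIcc x y, HasDerivAt f (f' z) z) (hf' : ContinuousOn f' (uIcc x y))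
    (he : ContinuousOn e (uIcc x y)) (hle : ∀ z ∈ uIcc x y, |f' z| ≤ B * e z)
    (he0 : ∀ z ∈ uIcc x y, 0 ≤ e z) (hB : 0 ≤ B) :
    |f y - f x| ≤ B * |(∫ z in x..y, |e z|)| := by
  rw [← integral_eq_sub_of_hasDerivAt hf hf'.intervalIntegrable]
  have h1 : ‖∫ z in x..y, f' z‖ ≤ |(∫ z in x..y, B * |e z|)| := by
    refine norm_integral_le_abs_of_norm_le ?_ (he.abs.const_smul B).intervalIntegrable
    refine (ae_restrict_iff' measurableSet_uIoc).2 (ae_of_all _ fun z hz => ?_)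
    rw [abs_of_nonneg (he0 z (uIoc_subset_uIcc hz))]
    exact hle z (uIoc_subset_uIcc hz)
  rwa [intervalIntegral.integral_const_mul, abs_mul, abs_of_nonneg hB] at h1

variable {A : State → Matrix (Fin 2) (Fin 2) ℝ} {lam : Fin 2 → State → ℝ} {Ω : Set State}
  {Φ : Fin 2 → State → ℝ} {J : Fin 2 → Set ℝ} {S : Plane → State} {I : Set ℝ}
  {γ : ℝ → Plane} {U₀ : ℝ → State} {ξ η : Plane → ℝ} {H : Plane → Plane}
  {V G : Set Plane} {U : Plane → State}

/-- A function whose Riemann invariants at `H (s, t)` are `r₁(t)`, `r₂(s)` is a solution. -/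
theorem IsCauchyMap.isSolution_of_corner
    (h : IsCauchyMap (cornerEigenvalue lam Φ S U₀ 0) (cornerEigenvalue lam Φ S U₀ 1) I γ ξ η H)
    (hV : IsChart I H V G) (hdata : IsCauchyData lam Ω I γ U₀) (hS : IsStateChart lam Ω Φ J S)
    (hΦ : IsRiemannInvariants A lam Ω Φ J) (hΩ : IsOpen Ω) (hyp : StrictlyHyperbolic A lam Ω)
    (hU : ∀ s t : ℝ, (s, t) ∈ V → U (H (s, t)) ∈ Ω ∧ riem Φ (U (H (s, t))) = corner Φ U₀ s t) :
    IsSolution A Ω G U ∧ ∀ τ, (τ, τ) ∈ V → U (γ τ) = U₀ τ := by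
  have hr := hdata.contDiffOn_riemannInvariant hS
  have hm : ∀ τ ∈ I, riem Φ (U₀ τ) ∈ J 0 ×ˢ J 1 := fun τ hτ => hS.mapsTo (hdata.data_mapsTo hτ)
  have hm₁ : MapsTo (fun τ => Φ 0 (U₀ τ)) I (J 0) := fun τ hτ => (hm τ hτ).1
  have hm₂ : MapsTo (fun τ => Φ 1 (U₀ τ)) I (J 1) := fun τ hτ => (hm τ hτ).2
  have hUS : ∀ p ∈ V, U (H p) = S (corner Φ U₀ p.1 p.2) := fun p hp => by
    rw [← (hU p.1 p.2 hp).2, hS.left_inv _ (hU p.1 p.2 hp).1]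
  have hmap : MapsTo U G Ω := by
    intro q hq
    obtain ⟨p, hp, rfl⟩ := hV.bijOn.surjOn hq
    exact (hU p.1 p.2 hp).1
  have hsm : ContDiffOn ℝ 1 U G := by
    obtain ⟨K, hK, hKH⟩ := hV.inverse
    have hKV : MapsTo K G V := by
      intro q hq
      obtain ⟨p, hp, rfl⟩ := hV.bijOn.surjOn hq
      rwa [hKH p hp]
    have hc : ContDiffOn ℝ 1 (fun p : Plane => corner Φ U₀ p.1 p.2) (I ×ˢ I) :=
      ((hr 0).comp contDiff_snd.contDiffOn fun p hp => hp.2).prodMk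
        ((hr 1).comp contDiff_fst.contDiffOn fun p hp => hp.1)
    have h1 : ContDiffOn ℝ 1 (fun q => S (corner Φ U₀ (K q).1 (K q).2)) G :=
      (hS.smooth_inv.comp hc (mapsTo_pullback hm₁ hm₂)).comp hK fun q hq => hV.subset (hKV hq)
    refine h1.congr fun q hq => ?_
    obtain ⟨p, hp, rfl⟩ := hV.bijOn.surjOn hq
    rw [hUS p hp, hKH p hp]
  refine ⟨isSolution_of_riemannInvariants hV.isOpen_target hΦ hΩ hyp hsm hmap fun k q hq => ?_,
    fun τ hτ => ?_⟩
  · have hd : ∀ k, HasFDerivAt (fun q => Φ k (U q)) (linForm (fderiv ℝ (fun q => Φ k (U q)) q (1, 0))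
        (fderiv ℝ (fun q => Φ k (U q)) q (0, 1))) q := fun k =>
      hasFDerivAt_of_contDiffOn hV.isOpen_target ((hS.smooth k).comp hsm hmap) hq
    obtain ⟨⟨s, t⟩, hp, rfl⟩ := hV.bijOn.surjOn hq
    have hpI := hV.subset hp
    obtain ⟨hξ, hη⟩ := h.ne_zero_of_isChart hV hp
    have hlam : ∀ k, cornerEigenvalue lam Φ S U₀ k (s, t) = lam k (U (H (s, t))) := fun k => by
      rw [hUS _ hp]; rfl
    fin_cases k
    -- Since r₁ depends on t only, its derivative along H_s = ξ (1, λ₁) is zero; cancelling ξ leaves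
    -- the equation for r₁. The other family is treated with H_t and η.
    · have d1 := hasDerivAt_comp_linForm (c := fun σ => H (σ, t)) (hd 0) (h.hasDerivAt_fst hpI)
      have d2 : HasDerivAt (fun σ => Φ 0 (U (H (σ, t)))) 0 s := by
        refine (hasDerivAt_const s (Φ 0 (U₀ t))).congr_of_eventuallyEq ?_
        have : ∀ᶠ σ in 𝓝 s, (σ, t) ∈ V :=
          (by fun_prop : Continuous fun σ : ℝ => (σ, t)).continuousAt.eventually
            (hV.isOpen_source.mem_nhds hp)
        filter_upwards [this] with σ hσ
        exact congrArg Prod.fst (hU σ t hσ).2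
      have e := d1.unique d2
      rw [hlam] at e
      refine mul_left_cancel₀ hξ ?_
      simp only [Fin.zero_eta]
      linear_combination e
    · have d1 := hasDerivAt_comp_linForm (c := fun τ => H (s, τ)) (hd 1) (h.hasDerivAt_snd hpI)
      have d2 : HasDerivAt (fun τ => Φ 1 (U (H (s, τ)))) 0 t := by
        refine (hasDerivAt_const t (Φ 1 (U₀ s))).congr_of_eventuallyEq ?_
        have : ∀ᶠ τ in 𝓝 t, (s, τ) ∈ V :=
          (by fun_prop : Continuous fun τ : ℝ => (s, τ)).continuousAt.eventually
            (hV.isOpen_source.mem_nhds hp)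
        filter_upwards [this] with τ hτ
        exact congrArg Prod.snd (hU s τ hτ).2
      have e := d1.unique d2
      rw [hlam] at e
      refine mul_left_cancel₀ hη ?_
      simp only [Fin.mk_one]
      linear_combination e
  · have hτI : τ ∈ I := (hV.subset hτ).1
    rw [← (h.diagonal τ hτI).1, hUS _ hτ]
    exact hS.left_inv _ (hdata.data_mapsTo hτI)

/-- The Riemann invariants of a solution at `H (s, t)` are `r₁(t)`, `r₂(s)`. -/
theorem IsCauchyMap.corner_of_isSolution
    (h : IsCauchyMap (cornerEigenvalue lam Φ S U₀ 0) (cornerEigenvalue lam Φ S U₀ 1) I γ ξ η H)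
    (hV : IsChart I H V G) (hdata : IsCauchyData lam Ω I γ U₀) (hS : IsStateChart lam Ω Φ J S)
    (hJ : ∀ k, IsOpen (J k) ∧ (J k).OrdConnected)
    (hΦ : IsRiemannInvariants A lam Ω Φ J) (hΩ : IsOpen Ω)
    (hU : IsSolution A Ω G U) (hU₀ : ∀ τ, (τ, τ) ∈ V → U (γ τ) = U₀ τ) {s₀ t₀ : ℝ}
    (hst : (s₀, t₀) ∈ V) : riem Φ (U (H (s₀, t₀))) = corner Φ U₀ s₀ t₀ := by
  have hG := hV.isOpen_target
  have hr := hdata.contDiffOn_riemannInvariant hS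
  have hm : ∀ τ ∈ I, riem Φ (U₀ τ) ∈ J 0 ×ˢ J 1 := fun τ hτ => hS.mapsTo (hdata.data_mapsTo hτ)
  -- The square condition on a chart puts this dependence domain inside V, so U is defined at every
  -- point needed.
  set K : Set Plane := uIcc s₀ t₀ ×ˢ uIcc s₀ t₀
  have hK : IsCompact K := isCompact_uIcc.prod isCompact_uIcc
  have hKV : K ⊆ V := hV.square s₀ t₀ hst
  have hKI : K ⊆ I ×ˢ I := hKV.trans hV.subset
  have hKG : MapsTo H K G := hV.bijOn.mapsTo.mono_left hKV
  have hKd : IsDependenceDomain (fun t => t) (fun s => s) (fun p => |p.1 - p.2|) K :=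
    isDependenceDomain_diagonal _ _
  have cH : ContinuousOn H K := h.smooth.continuousOn.mono hKI
  set ρ : Plane → Plane := fun p => riem Φ (U (H p))
  set κ : Plane → Plane := fun p => corner Φ U₀ p.1 p.2
  have cρ : ContinuousOn ρ K :=
    ((hU.contDiffOn_riem hΦ 0).prodMk (hU.contDiffOn_riem hΦ 1)).continuousOn.comp cH hKG
  have cκ : ContinuousOn κ K :=
    ((hr 0).continuousOn.comp continuousOn_snd fun p hp => (hKI hp).2).prodMk
      ((hr 1).continuousOn.comp continuousOn_fst fun p hp => (hKI hp).1)
  have mρ : MapsTo ρ K (J 0 ×ˢ J 1) := fun p hp => hS.mapsTo (hU.mapsTo (hKG hp))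
  have mκ : MapsTo κ K (J 0 ×ˢ J 1) := fun p hp => ⟨(hm _ (hKI hp).2).1, (hm _ (hKI hp).1).2⟩
  have hlam : ∀ k, ∀ p ∈ K, lam k (U (H p)) = lam k (S (ρ p)) := fun k p hp => by
    rw [hS.left_inv _ (hU.mapsTo (hKG hp))]
  set e : Plane → ℝ := fun p => |(κ p).1 - (ρ p).1| + |(κ p).2 - (ρ p).2|
  have ce : ContinuousOn e K := (cκ.fst.sub cρ.fst).abs.add (cκ.snd.sub cρ.snd).abs
  have he0 : ∀ p, 0 ≤ e p := fun p => by positivity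
  have hdiag : ∀ τ ∈ uIcc s₀ t₀, ρ (τ, τ) = κ (τ, τ) := by
    intro τ hτ
    have hp : (τ, τ) ∈ V := hKV ⟨hτ, hτ⟩
    simp only [ρ]
    rw [(h.diagonal τ (hV.subset hp).1).1, hU₀ τ hp]
    rfl
  have cl : ∀ k, ContinuousOn (fun p => cornerEigenvalue lam Φ S U₀ k p - lam k (U (H p))) K := by
    intro k
    refine ContinuousOn.sub ?_ ?_
    · exact (hS.contDiffOn_comp_inv k).continuousOn.comp cκ mκ
    · exact ((hS.smooth_eigenvalue k).continuousOn.comp hU.smooth.continuousOn hU.mapsTo).comp cH hKG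
  have cR : ∀ k, ContinuousOn (fun p => fderiv ℝ (fun q => Φ k (U q)) (H p) (0, 1)) K := fun k =>
    (continuousOn_fderiv_apply_of_contDiffOn hG (hU.contDiffOn_riem hΦ k) (0, 1)).comp cH hKG
  -- Along H_s the invariant r₁ of U changes at the rate ξ ∂_y r₁ (μ₁ - λ₁(U)). The last factor is
  -- the difference of λ₁ at the prescribed and at the actual invariants, hence at most a multiple
  -- of `e`.
  have bound : ∀ (k : Fin 2) (θ : Plane → ℝ), ContinuousOn θ K → ∃ B : ℝ, 0 ≤ B ∧ ∀ p ∈ K,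
      |θ p * fderiv ℝ (fun q => Φ k (U q)) (H p) (0, 1) *
        (cornerEigenvalue lam Φ S U₀ k p - lam k (U (H p)))| ≤ B * e p := by
    intro k θ hθ
    obtain ⟨L, hL0, hL⟩ := exists_lipschitz_on_compact (hJ 0).2 (hJ 1).2 (hS.contDiffOn_comp_inv k)
      hK cκ cρ mκ mρ
    obtain ⟨B, hB⟩ := hK.exists_bound_of_continuousOn (hθ.mul (cR k))
    refine ⟨|B| * L, by positivity, fun p hp => ?_⟩
    rw [abs_mul, mul_assoc |B|, hlam k p hp]
    exact mul_le_mul ((hB p hp).trans (le_abs_self B)) (hL p hp) (abs_nonneg _) (abs_nonneg _)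
  obtain ⟨B₁, hB₁0, hB₁⟩ := bound 0 ξ (h.continuousOn_ξ.mono hKI)
  obtain ⟨B₂, hB₂0, hB₂⟩ := bound 1 η (h.continuousOn_η.mono hKI)
  have hle : ∀ p ∈ K, |e p| ≤ (B₁ + B₂) * (|(∫ σ in p.2..p.1, |e (σ, p.2)|)| +
      |(∫ τ in p.1..p.2, |e (p.1, τ)|)|) := by
    intro p hp
    have hh : ∀ σ ∈ uIcc p.2 p.1, (σ, p.2) ∈ K := fun σ hσ => (hKd.horizontal p hp σ hσ).1
    have hv : ∀ τ ∈ uIcc p.1 p.2, (p.1, τ) ∈ K := fun σ hσ => (hKd.vertical p hp σ hσ).1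
    have b1 := abs_sub_le_integral_of_deriv_le (f := fun σ => Φ 0 (U (H (σ, p.2))))
      (x := p.2) (y := p.1) (e := fun σ => e (σ, p.2)) (B := B₁)
      (fun σ hσ => (hasDerivAt_comp_linForm (c := fun σ => H (σ, p.2))
        (hU.hasFDerivAt_riemannInvariant hG hΦ hΩ 0 (hKG (hh σ hσ)))
        (h.hasDerivAt_fst (p := (σ, p.2)) (hKI (hh σ hσ)))).congr_deriv
        (show _ = ξ (σ, p.2) * fderiv ℝ (fun q => Φ 0 (U q)) (H (σ, p.2)) (0, 1) *
          (cornerEigenvalue lam Φ S U₀ 0 (σ, p.2) - lam 0 (U (H (σ, p.2)))) by ring))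
      ((((h.continuousOn_ξ.mono hKI).mul (cR 0)).mul (cl 0)).comp (by fun_prop) hh)
      (ce.comp (by fun_prop) hh) (fun σ hσ => hB₁ _ (hh σ hσ)) (fun _ _ => he0 _) hB₁0
    have b2 := abs_sub_le_integral_of_deriv_le (f := fun τ => Φ 1 (U (H (p.1, τ))))
      (x := p.1) (y := p.2) (e := fun τ => e (p.1, τ)) (B := B₂)
      (fun τ hτ => (hasDerivAt_comp_linForm (c := fun τ => H (p.1, τ))
        (hU.hasFDerivAt_riemannInvariant hG hΦ hΩ 1 (hKG (hv τ hτ)))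
        (h.hasDerivAt_snd (p := (p.1, τ)) (hKI (hv τ hτ)))).congr_deriv
        (show _ = η (p.1, τ) * fderiv ℝ (fun q => Φ 1 (U q)) (H (p.1, τ)) (0, 1) *
          (cornerEigenvalue lam Φ S U₀ 1 (p.1, τ) - lam 1 (U (H (p.1, τ)))) by ring))
      ((((h.continuousOn_η.mono hKI).mul (cR 1)).mul (cl 1)).comp (by fun_prop) hv)
      (ce.comp (by fun_prop) hv) (fun σ hσ => hB₂ _ (hv σ hσ)) (fun _ _ => he0 _) hB₂0
    -- The prescribed r₁ is constant along the horizontal segment and equals the actual one at its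
    -- diagonal end.
    have e1 : Φ 0 (U (H (p.2, p.2))) = (κ p).1 := congrArg Prod.fst (hdiag p.2 hp.2)
    have e2 : Φ 1 (U (H (p.1, p.1))) = (κ p).2 := congrArg Prod.snd (hdiag p.1 hp.1)
    rw [e1, abs_sub_comm] at b1
    rw [e2, abs_sub_comm] at b2
    rw [abs_of_nonneg (he0 p)]
    refine (add_le_add b1 b2).trans ?_
    set x := |(∫ σ in p.2..p.1, |e (σ, p.2)|)|
    set y := |(∫ τ in p.1..p.2, |e (p.1, τ)|)|
    have : 0 ≤ B₁ * y + B₂ * x := by positivity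
    linarith
  have hp : (s₀, t₀) ∈ K := ⟨left_mem_uIcc, right_mem_uIcc⟩
  have hz := hKd.eq_zero_of_le hK (by fun_prop) ce hle hp
  obtain ⟨z1, z2⟩ := (add_eq_zero_iff_of_nonneg (abs_nonneg _) (abs_nonneg _)).1 hz
  exact Prod.ext (sub_eq_zero.1 (abs_eq_zero.1 z1)).symm (sub_eq_zero.1 (abs_eq_zero.1 z2)).symm

end QuasiHyp

/-! ### Assembly of the theorem -/

theorem theorem1
    (A : State → Matrix (Fin 2) (Fin 2) ℝ) (lam : Fin 2 → State → ℝ) (Ω : Set State)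
    (hΩ : IsOpen Ω) (hA : ∀ i j, ContDiffOn ℝ 2 (fun u => A u i j) Ω)
    (hyp : StrictlyHyperbolic A lam Ω)
    (Φ : Fin 2 → State → ℝ) (J : Fin 2 → Set ℝ)
    (hJ : ∀ k, IsOpen (J k) ∧ (J k).OrdConnected)
    (hΦ : IsRiemannInvariants A lam Ω Φ J)
    (I : Set ℝ) (hI : IsOpen I) (hI' : I.OrdConnected)
    (γ : ℝ → Plane) (U₀ : ℝ → State) (hdata : IsCauchyData lam Ω I γ U₀)
    (a b : ℝ) (hab : a < b) (habI : Set.Icc a b ⊆ I) (hinj : Set.InjOn γ (Set.Icc a b)) :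
    -- each of the two linear problems has exactly one solution
    (∀ r₀ ∈ J 0 ×ˢ J 1,
      (∃ φ ψ : Plane → ℝ, IsGoursatX lam Ω Φ J r₀ φ ψ ∧
        ∀ φ' ψ' : Plane → ℝ, IsGoursatX lam Ω Φ J r₀ φ' ψ' →
          Set.EqOn φ' φ (J 0 ×ˢ J 1) ∧ Set.EqOn ψ' ψ (J 0 ×ˢ J 1)) ∧
      (∃ φ ψ : Plane → ℝ, IsGoursatY lam Ω Φ J r₀ φ ψ ∧
        ∀ φ' ψ' : Plane → ℝ, IsGoursatY lam Ω Φ J r₀ φ' ψ' →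
          Set.EqOn φ' φ (J 0 ×ˢ J 1) ∧ Set.EqOn ψ' ψ (J 0 ×ˢ J 1))) ∧
    -- the intersection point of the characteristics of a solution of the Cauchy problem
    (∀ (G : Set Plane) (U : Plane → State), IsOpen G → SimplyConnectedSpace G →
      IsSolution A Ω G U →
      ∀ s ∈ I, ∀ t ∈ I, (∀ τ ∈ Set.uIcc s t, γ τ ∈ G ∧ U (γ τ) = U₀ τ) →
      ∀ (m : Plane) (c₁ c₂ : ℝ → Plane),
        IsCharacteristic (lam 0) U G c₁ (γ t) m → IsCharacteristic (lam 1) U G c₂ (γ s) m →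
        riem Φ (U m) = corner Φ U₀ s t ∧
        (∀ φ ψ : Plane → ℝ, IsGoursatX lam Ω Φ J (corner Φ U₀ s t) φ ψ →
          m.1 = (γ t).1 - lineIntegral Φ γ U₀ φ ψ s t) ∧
        (∀ φ ψ : Plane → ℝ, IsGoursatY lam Ω Φ J (corner Φ U₀ s t) φ ψ →
          m.2 = (γ t).2 - lineIntegral Φ γ U₀ φ ψ s t)) ∧
    -- the equivalence
    (∀ φx ψx φy ψy : Plane → Plane → ℝ,
      (∀ r₀ ∈ J 0 ×ˢ J 1, IsGoursatX lam Ω Φ J r₀ (φx r₀) (ψx r₀)) →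
      (∀ r₀ ∈ J 0 ×ˢ J 1, IsGoursatY lam Ω Φ J r₀ (φy r₀) (ψy r₀)) →
      (∀ V G : Set Plane, IsChart I (meetingPoint Φ γ U₀ φx ψx φy ψy) V G →
        ∀ U : Plane → State,
          (IsSolution A Ω G U ∧ ∀ τ, (τ, τ) ∈ V → U (γ τ) = U₀ τ) ↔
          ∀ s t : ℝ, (s, t) ∈ V →
            U (meetingPoint Φ γ U₀ φx ψx φy ψy (s, t)) ∈ Ω ∧
            riem Φ (U (meetingPoint Φ γ U₀ φx ψx φy ψy (s, t))) = corner Φ U₀ s t) ∧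
      (∀ N : Set Plane, IsOpen N → γ '' Set.Icc a b ⊆ N →
        ∃ V G : Set Plane, IsChart I (meetingPoint Φ γ U₀ φx ψx φy ψy) V G ∧ G ⊆ N ∧
          ∀ τ ∈ Set.Icc a b, (τ, τ) ∈ V)) := by
  -- A base point at which X and Y are normalised.
  have ha : a ∈ I := habI (Set.left_mem_Icc.2 hab.le)
  obtain ⟨S, hS⟩ := hΦ.exists_stateChart hΩ hA hyp
  refine ⟨fun r₀ hr₀ => ⟨hS.existsUnique_goursatX hJ hr₀, hS.existsUnique_goursatY hJ hr₀⟩,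
    fun G U hG hGs hU s hs t ht hst m c₁ c₂ hc₁ hc₂ => ⟨?_, fun φ ψ h => ?_, fun φ ψ h => ?_⟩,
    fun φx ψx φy ψy hx hy => ?_⟩
  · have e₁ := hU.eq_on_characteristic hG hΦ hΩ hc₁ (Set.right_mem_Icc.2 zero_le_one)
    have e₂ := hU.eq_on_characteristic hG hΦ hΩ hc₂ (Set.right_mem_Icc.2 zero_le_one)
    rw [hc₁.target, (hst t Set.right_mem_uIcc).2] at e₁
    rw [hc₂.target, (hst s Set.left_mem_uIcc).2] at e₂
    exact Prod.ext e₁ e₂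
  · refine hU.apply_meetingPoint hG hΦ hΩ hJ hI hI' hdata hs ht hst hc₁ hc₂ h.linear
      (Z := ContinuousLinearMap.fst ℝ ℝ ℝ) (fun u hu hr d hd => ?_) h.on_two
    rw [hd, ContinuousLinearMap.coe_fst']
    -- With dy = λ₁ dx the form is (ψ - λ₁ φ) dx, which is dx by (2); in the next case (3) makes it
    -- λ₁ dx = dy.
    linear_combination d.1 * h.on_one u hu hr
  · refine hU.apply_meetingPoint hG hΦ hΩ hJ hI hI' hdata hs ht hst hc₁ hc₂ h.linear
      (Z := ContinuousLinearMap.snd ℝ ℝ ℝ) (fun u hu hr d hd => ?_) h.on_two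
    rw [ContinuousLinearMap.coe_snd', hd]
    linear_combination d.1 * h.on_one u hu hr
  · obtain ⟨ξ, η, h⟩ := hdata.exists_isCauchyMap hS hJ hI hI' ha hx hy
    refine ⟨fun V G hV U => ⟨fun ⟨hU, hU₀⟩ s t hst => ?_, fun hU => ?_⟩, fun N hN hγN => ?_⟩
    · exact ⟨hU.mapsTo (hV.bijOn.mapsTo hst),
        h.corner_of_isSolution hV hdata hS hJ hΦ hΩ hU hU₀ hst⟩
    · exact h.isSolution_of_corner hV hdata hS hΦ hΩ hyp hU
    · exact h.exists_isChart hI (fun p hp => hS.comp_inv_ne _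
        ⟨(hS.mapsTo (hdata.data_mapsTo hp.2)).1, (hS.mapsTo (hdata.data_mapsTo hp.1)).2⟩)
        hab.le habI hinj hN hγN
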